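/- Let $\Gamma$ be a (possibly infinite) simplicial graph, i.e. an undirected graph without loops and multiple edges, with vertex set $V\Gamma$. For every $w\in V\Gamma$ let $A_w$ be a unital C*-algebra with a state $\omega_w$ whose GNS representation is faithful, let $(\mathcal H_w,\xi_w)$ be its GNS space with cyclic vector, view $A_w\subset\mathcal B(\mathcal H_w)$, and put $\mathcal H_w^\circ=\mathcal H_w\ominus\mathbb C\xi_w$. *Graph products.* A word $(v_1,\dots,v_n)$ in $V\Gamma$ is *reduced* if, whenever $v_k=v_l$ with $k<l$, some $v_p$ with $k<p<l$ is neither equal nor adjacent to $v_k$. The graph product Hilbert space $\mathcal H_\Gamma$ with vacuum vector $\Omega_\Gamma$ is $\mathbb C\Omega_\Gamma\oplus\bigoplus_{\mathbf w}\mathcal H_{v_1}^\circ\otimes\cdots\otimes\mathcal H_{v_n}^\circ$, where $\mathbf w=(v_1,\dots,v_n)$ runs over one representative of each class of non-empty reduced words modulo exchanging neighbouring letters that are adjacent in $\Gamma$, and tensor products along equivalent words are identified by permuting the factors accordingly. For $w\in V\Gamma$ let $\mathcal H(w)\subset\mathcal H_\Gamma$ be the closed span of $\Omega_\Gamma$ and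 of the summands of those $\mathbf w$ for which $(w,v_1,\dots,v_n)$ is reduced, let $U_w:\mathcal H_w\otimes\mathcal H(w)\to\mathcal H_\Gamma$ be the unitary with $\xi_w\otimes\zeta\mapsto\zeta$ and $\eta\otimes\zeta\mapsto$ (the class of) $\eta\otimes\zeta$ for $\eta\in\mathcal H_w^\circ$, and $\lambda_w(x)=U_w(x\otimes 1)U_w^*$. The reduced graph product $A_\Gamma\subset\mathcal B(\mathcal H_\Gamma)$ is the C*-algebra generated by all $\lambda_w(A_w)$, and $\omega_\Gamma(x)=\langle x\Omega_\Gamma,\Omega_\Gamma\rangle$ is the graph product state. For $S\subset V\Gamma$ let $A_S$, $\mathcal H_S$, $\omega_S$ be the same objects for the subgraph induced on $S$; there are canonical injective unital $*$-homomorphisms $A_S\subset A_T\subset A_\Gamma$ for $S\subset T\subset V\Gamma$, which are the identity on every $A_w$, $w\in S$, and canonically $\mathcal H_S\subset\mathcal H_\Gamma$. *Amalgamated free products.* Let $B$ be a unital C*-subalgebra of unital C*-algebras $A_1,A_2$ with conditional expectations $E_i:A_i\to B$, and let $A_i^\circ=\ker E_i$. The reduced amalgamated free product $A_1\star_BA_2$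 is the C*-algebra generated by the canonical left actions of $A_1$ and $A_2$ on the free product Hilbert $B$-module $F=B\oplus\bigoplus_{n\ge1}\bigoplus_{i_1\ne i_2\ne\cdots\ne i_n}A_{i_1}^\circ\otimes_B\cdots\otimes_BA_{i_n}^\circ$, whose inner product is $\langle a_1\otimes\cdots\otimes a_n,b_1\otimes\cdots\otimes b_n\rangle=E_{i_n}(a_n^*\cdots E_{i_2}(a_2^*E_{i_1}(a_1^*b_1)b_2)\cdots b_n)$; the compression to the summand $B$ is its canonical conditional expectation $E$ onto $B$. **Theorem.** Let $v\in V\Gamma$, let $\mathrm{Link}(v)$ be the set of neighbours of $v$, $\mathrm{Star}(v)=\mathrm{Link}(v)\cup\{v\}$, and put $A_1=A_{\mathrm{Star}(v)}$, $A_2=A_{V\Gamma\setminus\{v\}}$, $B=A_{\mathrm{Link}(v)}$, with the canonical inclusions $B\subset A_i\subset A_\Gamma$. With $P$ the orthogonal projection of $\mathcal H_\Gamma$ onto $\mathcal H_{\mathrm{Link}(v)}$, the maps $x\mapsto PxP|_{\mathcal H_{\mathrm{Link}(v)}}$ define conditional expectations $E_i:A_i\to B$, $i=1,2$. Let $A_1\star_BA_2$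 be the reduced amalgamated free product with respect to $E_1,E_2$. There exists a unique $*$-isomorphism $\pi:A_1\star_BA_2\to A_\Gamma$ such that $\pi|_{A_1}$ and $\pi|_{A_2}$ are the canonical inclusions $A_1\subset A_\Gamma$ and $A_2\subset A_\Gamma$. Moreover $\pi$ is state-preserving: $\omega_\Gamma\circ\pi=\omega_{\mathrm{Link}(v)}\circ E$, where $E:A_1\star_BA_2\to B$ is the canonical conditional expectation. -/

import Mathlib

open scoped ComplexOrder InnerProductSpace

/-! ### Hilbert spaces presented by generators and their inner products -/

/-- A positive semidefinite kernel `X × X → ℂ`. -/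
structure PosKernel (X : Type*) where
  /-- the prescribed inner products of the generators -/
  ker : X → X → ℂ
  psd : (Matrix.of ker).PosSemidef

namespace PosKernel

variable {X : Type*} (k : PosKernel X)

/-- Formal linear combinations of the generators. -/
def Pre (_ : PosKernel X) : Type _ := X →₀ ℂ

noncomputable instance : AddCommGroup k.Pre := inferInstanceAs (AddCommGroup (X →₀ ℂ))
noncomputable instance : Module ℂ k.Pre := inferInstanceAs (Module ℂ (X →₀ ℂ))

/-- The coefficients of a formal linear combination. -/
noncomputable def coef : k.Pre ≃ₗ[ℂ] (X →₀ ℂ) := LinearEquiv.refl ℂ _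

/-- The formal generator `x`. -/
noncomputable def gen (x : X) : k.Pre := k.coef.symm (Finsupp.single x 1)

/-- The sesquilinear form `∑ conj aₓ * m x y * b_y`. -/
noncomputable def form (m : X → X → ℂ) (f g : X →₀ ℂ) : ℂ :=
  f.sum fun x a => g.sum fun y b => star a * m x y * b

theorem form_add_left (m : X → X → ℂ) (f g h : X →₀ ℂ) :
    form m (f + g) h = form m f h + form m g h := by
  unfold form
  rw [Finsupp.sum_add_index'] <;> simp [← Finsupp.sum_add, add_mul]

theorem form_smul_left (m : X → X → ℂ) (r : ℂ) (f h : X →₀ ℂ) :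
    form m (r • f) h = star r * form m f h := by
  unfold form
  rw [Finsupp.sum_smul_index] <;> simp [Finsupp.mul_sum, ← mul_assoc]

theorem form_conj (f g : X →₀ ℂ) : star (form k.ker g f) = form k.ker f g := by
  unfold form
  rw [Finsupp.sum_comm]
  simp only [Finsupp.sum, star_sum]
  refine Finset.sum_congr rfl fun x _ => Finset.sum_congr rfl fun y _ => ?_
  rw [show k.ker x y = star (k.ker y x) from (k.psd.isHermitian.apply x y).symm]
  simp only [star_mul, star_star]
  ring

/-- The semi-inner product `⟪∑ aₓ x, ∑ b_y y⟫ = ∑ conj aₓ * k x y * b_y`. -/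
noncomputable abbrev core : PreInnerProductSpace.Core ℂ k.Pre where
  inner f g := form k.ker (k.coef f) (k.coef g)
  conj_inner_symm f g := k.form_conj _ _
  re_inner_nonneg f := (RCLike.nonneg_iff.mp (k.psd.2 (k.coef f))).1
  add_left f g h := by rw [map_add, form_add_left]
  smul_left f g r := by rw [map_smul, form_smul_left]; rfl

noncomputable instance : SeminormedAddCommGroup k.Pre :=
  InnerProductSpace.Core.toSeminormedAddCommGroup (c := k.core)
noncomputable instance : InnerProductSpace ℂ k.Pre := InnerProductSpace.ofCore k.core

/-- The Hilbert space generated by vectors `k.vec x` with inner products `k.ker x y`. -/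
def Space : Type _ := UniformSpace.Completion k.Pre

noncomputable instance : NormedAddCommGroup k.Space :=
  inferInstanceAs (NormedAddCommGroup (UniformSpace.Completion k.Pre))
noncomputable instance : InnerProductSpace ℂ k.Space :=
  inferInstanceAs (InnerProductSpace ℂ (UniformSpace.Completion k.Pre))
instance : CompleteSpace k.Space :=
  inferInstanceAs (CompleteSpace (UniformSpace.Completion k.Pre))

/-- The canonical map with dense range of the formal linear combinations into the Hilbert space. -/
noncomputable def toSpace : k.Pre →L[ℂ] k.Space :=
  (UniformSpace.Completion.toComplL : k.Pre →L[ℂ] UniformSpace.Completion k.Pre)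

/-- The generating vectors. -/
noncomputable def vec (x : X) : k.Space := k.toSpace (k.gen x)

theorem inner_def (f g : k.Pre) : ⟪f, g⟫_ℂ = form k.ker (k.coef f) (k.coef g) := rfl

theorem inner_vec (x y : X) : ⟪k.vec x, k.vec y⟫_ℂ = k.ker x y := by
  refine (UniformSpace.Completion.inner_coe (𝕜 := ℂ) (k.gen x) (k.gen y)).trans ?_
  simp only [inner_def, gen, form, LinearEquiv.apply_symm_apply]
  rw [Finsupp.sum_single_index (by simp), Finsupp.sum_single_index (by simp)]
  simp

variable {E : Type*} [NormedAddCommGroup E] [InnerProductSpace ℂ E]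

/-- The linear extension of a map defined on the generators. -/
noncomputable def preLift (f : X → E) : k.Pre →ₗ[ℂ] E :=
  Finsupp.linearCombination ℂ f ∘ₗ k.coef.toLinearMap

theorem preLift_gen (f : X → E) (x : X) : k.preLift f (k.gen x) = f x := by
  simp [preLift, gen]

theorem inner_preLift (f : X → E) (g : k.Pre) :
    ⟪k.preLift f g, k.preLift f g⟫_ℂ = form (fun x y => ⟪f x, f y⟫_ℂ) (k.coef g) (k.coef g) := by
  simp only [preLift, LinearMap.comp_apply, LinearEquiv.coe_coe,
    Finsupp.linearCombination_apply, form]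
  simp only [Finsupp.sum, sum_inner, inner_sum, inner_smul_left, inner_smul_right,
    Finset.mul_sum]
  rw [Finset.sum_comm]
  refine Finset.sum_congr rfl fun x _ => Finset.sum_congr rfl fun y _ => ?_
  rw [Complex.star_def]
  ring

theorem preLift_le (f : X → E) (hf : ∀ x y, ⟪f x, f y⟫_ℂ = k.ker x y) (g : k.Pre) :
    ‖k.preLift f g‖ ≤ 1 * ‖g‖ := by
  have h : ⟪k.preLift f g, k.preLift f g⟫_ℂ = ⟪g, g⟫_ℂ := by
    rw [inner_preLift, inner_def]; simp only [hf]
  rw [inner_self_eq_norm_sq_to_K, inner_self_eq_norm_sq_to_K] at h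
  have h' : ‖k.preLift f g‖ ^ 2 = ‖g‖ ^ 2 := by exact_mod_cast h
  rw [one_mul]
  exact ((sq_eq_sq₀ (norm_nonneg _) (norm_nonneg _)).mp h').le

variable [CompleteSpace E]

/-- The bounded linear extension to `k.Space` of a map defined on the generators. -/
noncomputable def liftBdd (f : X → E) (C : ℝ) (hf : ∀ g : k.Pre, ‖k.preLift f g‖ ≤ C * ‖g‖) :
    k.Space →L[ℂ] E :=
  ((k.preLift f).mkContinuous C hf).extend k.toSpace

theorem liftBdd_vec (f : X → E) (C : ℝ) (hf : ∀ g : k.Pre, ‖k.preLift f g‖ ≤ C * ‖g‖) (x : X) :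
    k.liftBdd f C hf (k.vec x) = f x := by
  have := ContinuousLinearMap.extend_eq ((k.preLift f).mkContinuous C hf)
    (e := k.toSpace)
    UniformSpace.Completion.denseRange_coe
    (UniformSpace.Completion.isUniformInducing_coe _) (k.gen x)
  exact this.trans (by simp [preLift_gen])

/-- The isometry determined by an inner product preserving map on the generators. -/
noncomputable def lift (f : X → E) (hf : ∀ x y, ⟪f x, f y⟫_ℂ = k.ker x y) : k.Space →L[ℂ] E :=
  k.liftBdd f 1 (k.preLift_le f hf)

theorem lift_vec (f : X → E) (hf : ∀ x y, ⟪f x, f y⟫_ℂ = k.ker x y) (x : X) :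
    k.lift f hf (k.vec x) = f x := k.liftBdd_vec f 1 _ x

/-- A C⋆-algebra `A` acting on the generators compatibly with the inner product. -/
structure Action (A : Type*) [CStarAlgebra A] where
  /-- the action on generators -/
  act : A → X → X
  adj : ∀ a x y, k.ker (act a x) y = k.ker x (act (star a) y)
  one : ∀ x y, k.ker x (act 1 y) = k.ker x y
  mul : ∀ a b x y, k.ker x (act (a * b) y) = k.ker x (act a (act b y))
  add : ∀ a b x y, k.ker x (act (a + b) y) = k.ker x (act a y) + k.ker x (act b y)
  smul : ∀ (c : ℂ) a x y, k.ker x (act (c • a) y) = c * k.ker x (act a y)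

variable {k} {A : Type*} [CStarAlgebra A]

theorem Action.bound (α : k.Action A) (a : A) (g : k.Pre) :
    ‖k.preLift (fun x => k.vec (α.act a x)) g‖ ≤ ‖a‖ * ‖g‖ := by
  let _ := CStarAlgebra.spectralOrder A
  have := CStarAlgebra.spectralOrderedRing A
  have key : ∀ c : A, ⟪k.preLift (fun x => k.vec (α.act c x)) g,
      k.preLift (fun x => k.vec (α.act c x)) g⟫_ℂ =
      form (fun x y => k.ker x (α.act (star c * c) y)) (k.coef g) (k.coef g) := by
    intro c
    rw [inner_preLift]
    simp only [inner_vec, α.adj, α.mul]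
  have hle : 0 ≤ algebraMap ℝ A (‖a‖ ^ 2) - star a * a :=
    sub_nonneg.mpr CStarAlgebra.star_mul_le_algebraMap_norm_sq
  obtain ⟨d, hd⟩ := CStarAlgebra.nonneg_iff_eq_star_mul_self.mp hle
  have hsum : star a * a + star d * d = ((‖a‖ ^ 2 : ℝ) : ℂ) • (1 : A) := by
    rw [← hd, Complex.coe_smul, Algebra.algebraMap_eq_smul_one]; abel
  have htot : ⟪k.preLift (fun x => k.vec (α.act a x)) g,
        k.preLift (fun x => k.vec (α.act a x)) g⟫_ℂ +
      ⟪k.preLift (fun x => k.vec (α.act d x)) g,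
        k.preLift (fun x => k.vec (α.act d x)) g⟫_ℂ = ((‖a‖ ^ 2 : ℝ) : ℂ) * ⟪g, g⟫_ℂ := by
    rw [key, key, inner_def]
    unfold form
    rw [Finsupp.mul_sum, ← Finsupp.sum_add]
    refine Finsupp.sum_congr fun x _ => ?_
    rw [Finsupp.mul_sum, ← Finsupp.sum_add]
    refine Finsupp.sum_congr fun y _ => ?_
    rw [← add_mul, ← mul_add, ← α.add, hsum, α.smul, α.one]
    ring
  have h2 : ‖k.preLift (fun x => k.vec (α.act a x)) g‖ ^ 2 +
      ‖k.preLift (fun x => k.vec (α.act d x)) g‖ ^ 2 = ‖a‖ ^ 2 * ‖g‖ ^ 2 := by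
    have h := congrArg Complex.re htot
    rw [Complex.add_re, Complex.re_ofReal_mul] at h
    rw [← inner_self_eq_norm_sq (𝕜 := ℂ), ← inner_self_eq_norm_sq (𝕜 := ℂ),
      ← inner_self_eq_norm_sq (𝕜 := ℂ) g]
    exact h
  rw [← sq_le_sq₀ (norm_nonneg _) (by positivity), mul_pow]
  nlinarith [sq_nonneg ‖k.preLift (fun x => k.vec (α.act d x)) g‖]

/-- The bounded operator by which `a` acts on the Hilbert space. -/
noncomputable def Action.op (α : k.Action A) (a : A) : k.Space →L[ℂ] k.Space :=
  k.liftBdd (fun x => k.vec (α.act a x)) ‖a‖ (α.bound a)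

theorem Action.op_vec (α : k.Action A) (a : A) (x : X) :
    α.op a (k.vec x) = k.vec (α.act a x) := k.liftBdd_vec _ _ _ x

end PosKernel

namespace GraphProduct

/-! ### Reduced words -/

section Words

variable {V : Type*} (Γ : SimpleGraph V)

/-- Type II equivalence of words: the equivalence relation generated by exchanging two
neighbouring letters that are adjacent in `Γ`. -/
inductive EquivII : List V → List V → Prop
  | refl (w : List V) : EquivII w w
  | swap (a b : V) (w : List V) : Γ.Adj a b → EquivII (a :: b :: w) (b :: a :: w)
  | cons (a : V) {w w' : List V} : EquivII w w' → EquivII (a :: w) (a :: w')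
  | trans {w₁ w₂ w₃ : List V} : EquivII w₁ w₂ → EquivII w₂ w₃ → EquivII w₁ w₃

/-- A word is reduced if between two occurrences of a letter `v` there is always a letter
outside `Star(v)`. -/
def IsReducedWord (w : List V) : Prop :=
  ∀ (v : V) (u m z : List V), w = u ++ v :: (m ++ v :: z) → ¬ ∀ x ∈ m, x = v ∨ Γ.Adj v x

variable {Γ}

theorem EquivII.symm {w w' : List V} (h : EquivII Γ w w') : EquivII Γ w' w := by
  induction h with
  | refl w => exact .refl w
  | swap a b w h => exact .swap b a w h.symm
  | cons a _ ih => exact .cons a ih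
  | trans _ _ ih₁ ih₂ => exact .trans ih₂ ih₁

theorem EquivII.perm {w w' : List V} (h : EquivII Γ w w') : w.Perm w' := by
  induction h with
  | refl w => exact .refl w
  | swap a b w _ => exact .swap b a w
  | cons a _ ih => exact .cons a ih
  | trans _ _ ih₁ ih₂ => exact .trans ih₁ ih₂

theorem EquivII.erase [DecidableEq V] (v : V) {w w' : List V} (h : EquivII Γ w w') :
    EquivII Γ (w.erase v) (w'.erase v) := by
  induction h with
  | refl w => exact .refl _
  | swap a b w h =>
    have hab := h.ne
    by_cases ha : a = v
    · subst ha
      rw [List.erase_cons_head, List.erase_cons_tail (by simpa using hab.symm),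
        List.erase_cons_head]
      exact .refl _
    · by_cases hb : b = v
      · subst hb
        rw [List.erase_cons_head, List.erase_cons_tail (by simpa using hab),
          List.erase_cons_head]
        exact .refl _
      · rw [List.erase_cons_tail (by simpa using ha), List.erase_cons_tail (by simpa using hb),
          List.erase_cons_tail (by simpa using hb), List.erase_cons_tail (by simpa using ha)]
        exact .swap a b _ h
  | cons a h ih =>
    by_cases ha : a = v
    · subst ha; simpa using h
    · rw [List.erase_cons_tail (by simpa using ha), List.erase_cons_tail (by simpa using ha)]
      exact .cons a ih
  | trans _ _ ih₁ ih₂ => exact .trans ih₁ ih₂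

theorem EquivII.of_cons {v : V} {w w' : List V} (h : EquivII Γ (v :: w) (v :: w')) :
    EquivII Γ w w' := by
  classical
  simpa using h.erase v

theorem EquivII.filterMap {W : Type*} {Δ : SimpleGraph W} (f : V → Option W)
    (hf : ∀ a b a' b', Γ.Adj a b → f a = some a' → f b = some b' → Δ.Adj a' b')
    {w w' : List V} (h : EquivII Γ w w') : EquivII Δ (w.filterMap f) (w'.filterMap f) := by
  induction h with
  | refl w => exact .refl _
  | swap a b w h =>
    cases ha : f a with
    | none => cases hb : f b <;> simp [ha, hb] <;> exact .refl _
    | some a' =>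
      cases hb : f b with
      | none => simp [ha, hb]; exact .refl _
      | some b' =>
        simp only [List.filterMap_cons, ha, hb]
        exact .swap _ _ _ (hf a b a' b' h ha hb)
  | cons a _ ih =>
    cases ha : f a with
    | none => simpa [List.filterMap_cons, ha] using ih
    | some a' => simpa [List.filterMap_cons, ha] using EquivII.cons a' ih
  | trans _ _ ih₁ ih₂ => exact .trans ih₁ ih₂

/-- The word is type II equivalent to one that starts with `v`. -/
def CanStart (Γ : SimpleGraph V) (v : V) : List V → Prop
  | [] => False
  | a :: w => a = v ∨ (Γ.Adj v a ∧ CanStart Γ v w)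

theorem EquivII.canStart (v : V) {w w' : List V} (h : EquivII Γ w w') :
    CanStart Γ v w → CanStart Γ v w' := by
  induction h with
  | refl w => exact id
  | swap a b w h =>
    rintro (rfl | ⟨h1, rfl | ⟨h2, h3⟩⟩)
    · exact Or.inr ⟨h, Or.inl rfl⟩
    · exact Or.inl rfl
    · exact Or.inr ⟨h2, Or.inr ⟨h1, h3⟩⟩
  | cons a _ ih => exact Or.imp_right (And.imp_right ih)
  | trans _ _ ih₁ ih₂ => exact ih₂ ∘ ih₁

theorem CanStart.exists_eq {v : V} : ∀ {w : List V}, CanStart Γ v w →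
    ∃ m z, w = m ++ v :: z ∧ ∀ x ∈ m, Γ.Adj v x
  | [], h => h.elim
  | a :: w, Or.inl h => ⟨[], w, by simp [h], by simp⟩
  | a :: w, Or.inr ⟨h1, h2⟩ => by
    obtain ⟨m, z, rfl, hm⟩ := h2.exists_eq
    exact ⟨a :: m, z, rfl, by simpa [h1] using hm⟩

theorem IsReducedWord.not_canStart {v : V} {w : List V} (h : IsReducedWord Γ (v :: w)) :
    ¬ CanStart Γ v w := by
  intro hs
  obtain ⟨m, z, rfl, hm⟩ := hs.exists_eq
  exact h v [] m z rfl fun x hx => Or.inr (hm x hx)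

theorem IsReducedWord.tail {v : V} {w : List V} (h : IsReducedWord Γ (v :: w)) : IsReducedWord Γ w :=
  fun x u m z e => h x (v :: u) m z (by simp [e])

theorem IsReducedWord.nil : IsReducedWord Γ [] := by
  intro v u m z h; simp at h

theorem IsReducedWord.map_val {S : Set V} {w : List S} (h : IsReducedWord (Γ.induce S) w) :
    IsReducedWord Γ (w.map Subtype.val) := by
  intro v u m z e hm
  obtain ⟨u', r, rfl, rfl, e₁⟩ := List.map_eq_append_iff.mp e
  obtain ⟨v', r', rfl, rfl, e₂⟩ := List.map_eq_cons_iff.mp e₁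
  obtain ⟨m', r'', rfl, rfl, e₃⟩ := List.map_eq_append_iff.mp e₂
  obtain ⟨v'', z', rfl, hv, rfl⟩ := List.map_eq_cons_iff.mp e₃
  obtain rfl := Subtype.ext hv
  refine h v'' u' m' z' rfl fun x hx => ?_
  rcases hm x (List.mem_map_of_mem hx) with h | h
  · exact Or.inl (Subtype.ext h)
  · exact Or.inr h

theorem equivII_map_val {S : Set V} {w w' : List S} :
    EquivII Γ (w.map Subtype.val) (w'.map Subtype.val) ↔ EquivII (Γ.induce S) w w' := by
  classical
  constructor
  · intro h
    have := h.filterMap (Δ := Γ.induce S) (fun x => if hx : x ∈ S then some ⟨x, hx⟩ else none) (by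
      intro a b a' b' hab ha hb
      split_ifs at ha hb
      cases ha; cases hb
      exact hab)
    rw [List.filterMap_map, List.filterMap_map] at this
    simpa [Function.comp_def] using this
  · intro h
    induction h with
    | refl w => exact .refl _
    | swap a b w h => exact .swap _ _ _ h
    | cons a _ ih => exact .cons _ ih
    | trans _ _ ih₁ ih₂ => exact .trans ih₁ ih₂

end Words

/-! ### The graph product of pointed Hilbert spaces -/

section GraphHilbert

variable {V : Type*} {H : V → Type*} [∀ v, NormedAddCommGroup (H v)]
  [∀ v, InnerProductSpace ℂ (H v)]

/-- A letter of colour `v` is a vector of `H_v° = H_v ⊖ ℂ ξ_v`. -/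
abbrev Letter (ξ : ∀ v, H v) := Σ v : V, (ℂ ∙ ξ v)ᗮ

/-- The sequence of vertices `(v₁, …, vₙ)` of `x₁ ⊗ ⋯ ⊗ xₙ`, `xᵢ ∈ H_{vᵢ}°`. -/
def verts {ξ : ∀ v, H v} (x : List (Letter ξ)) : List V := x.map Sigma.fst

open Classical in
/-- The subsequence of letters of colour `v`. -/
noncomputable def colour {ξ : ∀ v, H v} (v : V) : List (Letter ξ) → List (ℂ ∙ ξ v)ᗮ :=
  List.filterMap fun p => if h : p.1 = v then some (h ▸ p.2) else none

/-- The `k`-th letter of colour `v`. -/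
noncomputable def letter {ξ : ∀ v, H v} (v : V) (k : ℕ) (x : List (Letter ξ)) : (ℂ ∙ ξ v)ᗮ :=
  (colour v x).getD k 0

open Classical in
/-- For a word `w`, the product over all `v` and `k` of the inner products of the `k`-th letters
of colour `v`. -/
noncomputable def matched {ξ : ∀ v, H v} (w : List V) (x y : List (Letter ξ)) : ℂ :=
  ∏ v ∈ w.toFinset, ∏ k ∈ Finset.range (w.count v), ⟪letter v k x, letter v k y⟫_ℂ

open Classical in
/-- The inner product of the elementary tensors `x₁ ⊗ ⋯ ⊗ xₙ` and `y₁ ⊗ ⋯ ⊗ yₘ` after the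
identification of the tensor products along type II equivalent words, which matches the `k`-th
occurrence of a vertex with the `k`-th occurrence of this vertex. Elementary tensors along
inequivalent words are orthogonal. -/
noncomputable def elemInner (Γ : SimpleGraph V) {ξ : ∀ v, H v} (x y : List (Letter ξ)) : ℂ :=
  if EquivII Γ (verts x) (verts y) then matched (verts x) x y else 0

theorem colour_cons_self {ξ : ∀ v, H v} (v : V) (a : (ℂ ∙ ξ v)ᗮ) (x : List (Letter ξ)) :
    colour v (⟨v, a⟩ :: x) = a :: colour v x := by
  simp [colour]

theorem colour_cons_ne {ξ : ∀ v, H v} {v w : V} (h : w ≠ v) (a : (ℂ ∙ ξ w)ᗮ)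
    (x : List (Letter ξ)) : colour v (⟨w, a⟩ :: x) = colour v x := by
  simp [colour, h]

theorem matched_congr {ξ : ∀ v, H v} {w w' : List V} (h : w.Perm w') (x y : List (Letter ξ)) :
    matched w x y = matched w' x y := by
  classical
  unfold matched
  rw [List.toFinset_eq_of_perm _ _ h]
  exact Finset.prod_congr rfl fun v _ => by rw [h.count_eq]

theorem matched_subset [DecidableEq V] {ξ : ∀ v, H v} {w : List V} {s : Finset V}
    (hs : w.toFinset ⊆ s) (x y : List (Letter ξ)) :
    matched w x y =
      ∏ v ∈ s, ∏ k ∈ Finset.range (w.count v), ⟪letter v k x, letter v k y⟫_ℂ := by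
  classical
  unfold matched
  have e : ∀ v, @List.count V (@instBEqOfDecidableEq V fun a b => Classical.propDecidable _) v w
    = List.count v w := fun v => by congr!
  simp only [e]
  have e2 : @List.toFinset V (fun a b => Classical.propDecidable _) w = w.toFinset := by congr!
  rw [e2]
  refine Finset.prod_subset hs fun v _ hv => ?_
  rw [List.count_eq_zero_of_not_mem (by simpa using hv)]
  simp

theorem matched_cons {ξ : ∀ v, H v} (v : V) (w : List V) (a b : (ℂ ∙ ξ v)ᗮ)
    (x y : List (Letter ξ)) :
    matched (v :: w) (⟨v, a⟩ :: x) (⟨v, b⟩ :: y) = ⟪a, b⟫_ℂ * matched w x y := by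
  classical
  rw [matched_subset (s := insert v w.toFinset) (by simp),
    matched_subset (w := w) (s := insert v w.toFinset) (by simp)]
  rw [← Finset.mul_prod_erase _ _ (Finset.mem_insert_self v w.toFinset),
    ← Finset.mul_prod_erase _ (fun v => ∏ k ∈ Finset.range (w.count v),
      ⟪letter v k x, letter v k y⟫_ℂ) (Finset.mem_insert_self v w.toFinset), ← mul_assoc]
  congr 1
  · rw [List.count_cons_self, Finset.prod_range_succ']
    rw [mul_comm]
    congr 1
    · simp [letter, colour_cons_self]
    · refine Finset.prod_congr rfl fun k _ => ?_
      simp [letter, colour_cons_self]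
  · refine Finset.prod_congr rfl fun u hu => ?_
    have hu : v ≠ u := (Finset.ne_of_mem_erase hu).symm
    rw [List.count_cons_of_ne hu]
    simp [letter, colour_cons_ne hu]

theorem elemInner_cons (Γ : SimpleGraph V) {ξ : ∀ v, H v} (v : V) (a b : (ℂ ∙ ξ v)ᗮ)
    (x y : List (Letter ξ)) :
    elemInner Γ (⟨v, a⟩ :: x) (⟨v, b⟩ :: y) = ⟪a, b⟫_ℂ * elemInner Γ x y := by
  unfold elemInner
  have : EquivII Γ (verts (⟨v, a⟩ :: x)) (verts (⟨v, b⟩ :: y)) ↔ EquivII Γ (verts x) (verts y) :=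
    ⟨fun h => h.of_cons, fun h => h.cons v⟩
  by_cases h : EquivII Γ (verts x) (verts y)
  · rw [if_pos h, if_pos (this.mpr h)]
    exact matched_cons v (verts x) a b x y
  · rw [if_neg h, if_neg (mt this.mp h), mul_zero]

theorem elemInner_cons_left_eq_zero {Γ : SimpleGraph V} {ξ : ∀ v, H v} {v : V} (a : (ℂ ∙ ξ v)ᗮ)
    {x y : List (Letter ξ)} (hy : IsReducedWord Γ (v :: verts y)) :
    elemInner Γ (⟨v, a⟩ :: x) y = 0 :=
  if_neg fun h => hy.not_canStart (h.canStart v (Or.inl rfl))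

theorem elemInner_cons_right_eq_zero {Γ : SimpleGraph V} {ξ : ∀ v, H v} {v : V} (b : (ℂ ∙ ξ v)ᗮ)
    {x y : List (Letter ξ)} (hx : IsReducedWord Γ (v :: verts x)) :
    elemInner Γ x (⟨v, b⟩ :: y) = 0 :=
  if_neg fun h => hx.not_canStart (h.symm.canStart v (Or.inl rfl))

theorem posSemidef_inner {X E : Type*} [NormedAddCommGroup E] [InnerProductSpace ℂ E]
    (f : X → E) : (Matrix.of fun x y => ⟪f x, f y⟫_ℂ).PosSemidef := by
  refine ⟨Matrix.ext fun x y => by simp, fun g => ?_⟩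
  have : (g.sum fun x a => g.sum fun y b => star a * (Matrix.of fun x y => ⟪f x, f y⟫_ℂ) x y * b)
      = ⟪g.sum fun x a => a • f x, g.sum fun x a => a • f x⟫_ℂ := by
    simp only [Finsupp.sum, sum_inner, inner_sum, inner_smul_left, inner_smul_right,
      Finset.mul_sum, Matrix.of_apply]
    rw [Finset.sum_comm]
    refine Finset.sum_congr rfl fun x _ => Finset.sum_congr rfl fun y _ => ?_
    rw [Complex.star_def]
    ring
  rw [this, inner_self_eq_norm_sq_to_K, ← RCLike.ofReal_pow]
  exact RCLike.ofReal_nonneg.mpr (sq_nonneg _)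

theorem posSemidef_prod {X ι : Type*} (s : Finset ι) (m : ι → X → X → ℂ)
    (h : ∀ i ∈ s, (Matrix.of (m i)).PosSemidef) :
    (Matrix.of fun x y => ∏ i ∈ s, m i x y).PosSemidef := by
  classical
  induction s using Finset.induction_on with
  | empty =>
    have := posSemidef_inner (X := X) (fun _ => (1 : ℂ))
    simpa using this
  | insert i s hi ih =>
    have := (h i (by simp)).hadamard (ih fun j hj => h j (by simp [hj]))
    simp only [Finset.prod_insert hi]
    exact this

theorem posSemidef_block {X C : Type*} [DecidableEq C] (c : X → C) (m : C → X → X → ℂ)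
    (h : ∀ i, (Matrix.of (m i)).PosSemidef) :
    (Matrix.of fun x y => if c x = c y then m (c x) x y else 0).PosSemidef := by
  refine ⟨Matrix.ext fun x y => ?_, fun f => ?_⟩
  · have := (h (c x)).isHermitian.apply x y
    simp only [Matrix.of_apply] at this
    simp only [Matrix.conjTranspose_apply, Matrix.of_apply]
    by_cases e : c x = c y
    · rw [if_pos e, if_pos e.symm, ← e, this]
    · rw [if_neg e, if_neg (Ne.symm e), star_zero]
  · have key : (f.sum fun x a => f.sum fun y b => star a *
        (Matrix.of fun x y => if c x = c y then m (c x) x y else 0) x y * b) =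
        ∑ i ∈ f.support.image c, ((f.filter fun x => c x = i).sum fun x a =>
          (f.filter fun x => c x = i).sum fun y b => star a * (Matrix.of (m i)) x y * b) := by
      simp only [Finsupp.sum, Finsupp.support_filter, Matrix.of_apply]
      rw [← Finset.sum_fiberwise_of_maps_to (s := f.support) (t := f.support.image c) (g := c)
        (fun x hx => Finset.mem_image_of_mem c hx)]
      refine Finset.sum_congr rfl fun i _ => Finset.sum_congr rfl fun x hx => ?_
      have hx := (Finset.mem_filter.mp hx).2
      rw [Finset.sum_filter]
      refine Finset.sum_congr rfl fun y _ => ?_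
      by_cases e : c y = i
      · simp [e, hx]
      · rw [if_neg e, hx, if_neg (Ne.symm e)]; simp
    rw [key]
    exact Finset.sum_nonneg fun i _ => (h i).2 _

theorem posSemidef_elemInner (Γ : SimpleGraph V) (ξ : ∀ v, H v) :
    (Matrix.of fun x y : List (Letter ξ) => elemInner Γ x y).PosSemidef := by
  classical
  let s : Setoid (List V) := ⟨EquivII Γ, ⟨.refl, .symm, .trans⟩⟩
  have hs : ∀ w : List V, EquivII Γ (Quotient.mk s w).out w := fun w => Quotient.mk_out (s := s) w
  have := posSemidef_block (fun x : List (Letter ξ) => Quotient.mk s (verts x))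
    (fun i x y => matched i.out x y) fun i =>
      posSemidef_prod _ (fun v x y => ∏ k ∈ Finset.range (i.out.count v),
        ⟪letter v k x, letter v k y⟫_ℂ) fun v _ =>
        posSemidef_prod _ (fun k x y => ⟪letter v k x, letter v k y⟫_ℂ) fun k _ =>
          posSemidef_inner (letter v k)
  convert this using 1
  ext x y
  simp only [Matrix.of_apply, elemInner]
  have e : (Quotient.mk s (verts x) = Quotient.mk s (verts y)) ↔
      EquivII Γ (verts x) (verts y) := Quotient.eq (r := s)
  by_cases h : EquivII Γ (verts x) (verts y)
  · rw [if_pos h, if_pos (e.mpr h)]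
    exact matched_congr (hs _).perm.symm x y
  · rw [if_neg h, if_neg (mt e.mp h)]

/-- Elementary tensors along reduced words; the empty one is the vacuum. -/
abbrev RedTensor (Γ : SimpleGraph V) (ξ : ∀ v, H v) :=
  {x : List (Letter ξ) // IsReducedWord Γ (verts x)}

/-- The inner products of the elementary tensors along reduced words. -/
noncomputable def graphKernel (Γ : SimpleGraph V) (ξ : ∀ v, H v) : PosKernel (RedTensor Γ ξ) where
  ker x y := elemInner Γ x.1 y.1
  psd := (posSemidef_elemInner Γ ξ).submatrix Subtype.val

/-- The graph product Hilbert space `ℂΩ ⊕ ⨁_w H_{w₁}° ⊗ ⋯ ⊗ H_{wₙ}°`, the sum being over the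
classes of reduced words: it is generated by the elementary tensors along reduced words, those
along type II equivalent words being identified. -/
abbrev GraphHilbert (Γ : SimpleGraph V) (ξ : ∀ v, H v) := (graphKernel Γ ξ).Space

/-- The elementary tensor `x₁ ⊗ ⋯ ⊗ xₙ` along a reduced word. -/
noncomputable def elem (Γ : SimpleGraph V) {ξ : ∀ v, H v} (x : List (Letter ξ))
    (hx : IsReducedWord Γ (verts x)) : GraphHilbert Γ ξ := (graphKernel Γ ξ).vec ⟨x, hx⟩

theorem inner_elem (Γ : SimpleGraph V) {ξ : ∀ v, H v} (x y : List (Letter ξ))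
    (hx : IsReducedWord Γ (verts x)) (hy : IsReducedWord Γ (verts y)) :
    ⟪elem Γ x hx, elem Γ y hy⟫_ℂ = elemInner Γ x y := (graphKernel Γ ξ).inner_vec _ _

/-- The vacuum vector `Ω`. -/
noncomputable def vacuum (Γ : SimpleGraph V) (ξ : ∀ v, H v) : GraphHilbert Γ ξ :=
  elem Γ [] .nil

/-- The generators `η ⊗ x` of `H_v ⊗ H(v)`, where `x` is an elementary tensor along a word `w`
such that `v w` is reduced. -/
abbrev FrontTensor (Γ : SimpleGraph V) (ξ : ∀ v, H v) (v : V) :=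
  H v × {x : List (Letter ξ) // IsReducedWord Γ (v :: verts x)}

/-- The inner products of the generators of `H_v ⊗ H(v)`. -/
noncomputable def frontKernel (Γ : SimpleGraph V) (ξ : ∀ v, H v) (v : V) :
    PosKernel (FrontTensor Γ ξ v) where
  ker p q := ⟪p.1, q.1⟫_ℂ * elemInner Γ p.2.1 q.2.1
  psd := (posSemidef_inner fun p : FrontTensor Γ ξ v => p.1).hadamard
    ((posSemidef_elemInner Γ ξ).submatrix fun p : FrontTensor Γ ξ v => p.2.1)

theorem inner_decomp {E : Type*} [NormedAddCommGroup E] [InnerProductSpace ℂ E] {e : E}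
    (he : ‖e‖ = 1) (a b : E) :
    ⟪(ℂ ∙ e)ᗮ.orthogonalProjectionOnto a, (ℂ ∙ e)ᗮ.orthogonalProjectionOnto b⟫_ℂ +
      star ⟪e, a⟫_ℂ * ⟪e, b⟫_ℂ = ⟪a, b⟫_ℂ := by
  have hdec : ∀ a : E, a = ((ℂ ∙ e)ᗮ.orthogonalProjectionOnto a : E) + ⟪e, a⟫_ℂ • e := by
    intro a
    have h := Submodule.starProjection_add_starProjection_orthogonal (K := ℂ ∙ e) a
    rw [Submodule.starProjection_unit_singleton ℂ he] at h
    rw [add_comm]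
    exact h.symm
  have horth : ∀ x : (ℂ ∙ e)ᗮ, ⟪e, (x : E)⟫_ℂ = 0 := fun x =>
    Submodule.mem_orthogonal_singleton_iff_inner_right.mp x.2
  have horth' : ∀ x : (ℂ ∙ e)ᗮ, ⟪(x : E), e⟫_ℂ = 0 := fun x =>
    Submodule.mem_orthogonal_singleton_iff_inner_left.mp x.2
  conv_rhs => rw [hdec a, hdec b]
  simp only [inner_add_left, inner_add_right, inner_smul_left, inner_smul_right, horth, horth',
    inner_self_eq_norm_sq_to_K, he, Submodule.coe_inner]
  simp [mul_comm]

theorem IsReducedWord.cons_letter {Γ : SimpleGraph V} {ξ : ∀ v, H v} {v : V}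
    {x : List (Letter ξ)} (hx : IsReducedWord Γ (v :: verts x)) (a : (ℂ ∙ ξ v)ᗮ) :
    IsReducedWord Γ (verts (⟨v, a⟩ :: x)) := hx

/-- The map `U_v : H_v ⊗ H(v) → H`, `η ⊗ x ↦ η° ⊗ x + ⟪ξ_v, η⟫ x`, where `η°` is the component
of `η` in `H_v°`. -/
noncomputable def frontMap (Γ : SimpleGraph V) (ξ : ∀ v, H v) (hξ : ∀ v, ‖ξ v‖ = 1) (v : V) :
    (frontKernel Γ ξ v).Space →L[ℂ] GraphHilbert Γ ξ :=
  (frontKernel Γ ξ v).lift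
    (fun p => elem Γ (⟨v, (ℂ ∙ ξ v)ᗮ.orthogonalProjectionOnto p.1⟩ :: p.2.1)
        (p.2.2.cons_letter _) +
      ⟪ξ v, p.1⟫_ℂ • elem Γ p.2.1 p.2.2.tail)
    (fun p q => by
      simp only [inner_add_left, inner_add_right, inner_smul_left, inner_smul_right,
        inner_elem, elemInner_cons, elemInner_cons_left_eq_zero _ q.2.2,
        elemInner_cons_right_eq_zero _ p.2.2, mul_zero, add_zero, zero_add]
      refine Eq.trans ?_ (congrArg (· * elemInner Γ p.2.1 q.2.1) (inner_decomp (hξ v) p.1 q.1))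
      simp only [Complex.star_def]
      ring)

variable [∀ v, CompleteSpace (H v)]

/-- `B(H_v)` acts on `H_v ⊗ H(v)` by `T ⊗ 1`. -/
noncomputable def frontAction (Γ : SimpleGraph V) (ξ : ∀ v, H v) (v : V) :
    (frontKernel Γ ξ v).Action (H v →L[ℂ] H v) where
  act T p := (T p.1, p.2)
  adj T p q := by
    simp [frontKernel, ContinuousLinearMap.star_eq_adjoint, ContinuousLinearMap.adjoint_inner_right]
  one p q := rfl
  mul S T p q := rfl
  add S T p q := by simp [frontKernel, add_mul]
  smul c T p q := by simp [frontKernel, mul_assoc]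

/-- The representation `λ_v(T) = U_v (T ⊗ 1) U_v⋆` of `B(H_v)` on the graph product Hilbert
space. -/
noncomputable def graphRep (Γ : SimpleGraph V) (ξ : ∀ v, H v) (hξ : ∀ v, ‖ξ v‖ = 1) (v : V)
    (T : H v →L[ℂ] H v) : GraphHilbert Γ ξ →L[ℂ] GraphHilbert Γ ξ :=
  frontMap Γ ξ hξ v ∘L (frontAction Γ ξ v).op T ∘L (frontMap Γ ξ hξ v).adjoint

end GraphHilbert

section SubgraphHilbert

variable {V : Type*} {H : V → Type*} [∀ v, NormedAddCommGroup (H v)]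
  [∀ v, InnerProductSpace ℂ (H v)]

/-- A letter over an induced subgraph, viewed as a letter over the whole graph. -/
def Letter.ofSub {ξ : ∀ v, H v} {S : Set V} (p : Letter fun v : S => ξ v) : Letter ξ :=
  ⟨p.1, p.2⟩

theorem verts_ofSub {ξ : ∀ v, H v} {S : Set V} (x : List (Letter fun v : S => ξ v)) :
    verts (x.map Letter.ofSub) = (verts x).map Subtype.val := by
  simp only [verts, List.map_map]; rfl

theorem colour_ofSub {ξ : ∀ v, H v} {S : Set V} (v : S) (x : List (Letter fun v : S => ξ v)) :
    colour v.1 (x.map Letter.ofSub) = colour v x := by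
  induction x with
  | nil => rfl
  | cons p x ih =>
    obtain ⟨w, a⟩ := p
    by_cases h : w = v
    · subst h
      rw [List.map_cons, colour_cons_self, ← ih]
      exact colour_cons_self w.1 a _
    · rw [List.map_cons, colour_cons_ne h, ← ih]
      exact colour_cons_ne (fun e => h (Subtype.ext e)) a _

theorem elemInner_ofSub (Γ : SimpleGraph V) {ξ : ∀ v, H v} {S : Set V}
    (x y : List (Letter fun v : S => ξ v)) :
    elemInner Γ (x.map Letter.ofSub) (y.map Letter.ofSub) = elemInner (Γ.induce S) x y := by
  classical
  unfold elemInner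
  rw [verts_ofSub, verts_ofSub]
  simp only [equivII_map_val]
  congr 1
  rw [matched_subset (s := (verts x).toFinset.image Subtype.val) (by
      intro v; simp),
    matched_subset (s := (verts x).toFinset) subset_rfl,
    Finset.prod_image Subtype.val_injective.injOn]
  refine Finset.prod_congr rfl fun v _ => ?_
  rw [List.count_map_of_injective _ _ Subtype.val_injective]
  refine Finset.prod_congr (by congr!) fun k _ => ?_
  simp only [letter, colour_ofSub]

/-- The canonical isometry of the graph product Hilbert space of the induced subgraph on `S` onto
the subspace of the graph product Hilbert space of `Γ` given by the words in `S`. -/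
noncomputable def subIsometry (Γ : SimpleGraph V) (ξ : ∀ v, H v) (S : Set V) :
    GraphHilbert (Γ.induce S) (fun v : S => ξ v) →L[ℂ] GraphHilbert Γ ξ :=
  (graphKernel (Γ.induce S) fun v : S => ξ v).lift
    (fun x => elem Γ (x.1.map Letter.ofSub) (by rw [verts_ofSub]; exact x.2.map_val))
    (fun x y => by rw [inner_elem, elemInner_ofSub]; rfl)

end SubgraphHilbert

/-! ### The reduced graph product of C⋆-algebras -/

/-- A state on a unital C⋆-algebra whose GNS representation is faithful. -/
structure GNSFaithfulState (A : Type*) [CStarAlgebra A] [PartialOrder A] [StarOrderedRing A] where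
  /-- the underlying positive linear functional -/
  toPos : A →ₚ[ℂ] ℂ
  map_one : toPos 1 = 1
  gns_faithful : Function.Injective toPos.gnsStarAlgHom

namespace GNSFaithfulState

variable {A : Type*} [CStarAlgebra A] [PartialOrder A] [StarOrderedRing A]

/-- The cyclic vector of the GNS construction. -/
noncomputable def cyclic (φ : GNSFaithfulState A) : φ.toPos.GNS :=
  ((φ.toPos.toPreGNS 1 : φ.toPos.PreGNS) : φ.toPos.GNS)

theorem norm_cyclic (φ : GNSFaithfulState A) : ‖φ.cyclic‖ = 1 := by
  rw [cyclic, UniformSpace.Completion.norm_coe, PositiveLinearMap.preGNS_norm_def]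
  simp [φ.map_one]

end GNSFaithfulState

section GraphAlgebra

variable {V : Type*} {A : V → Type*} [∀ v, CStarAlgebra (A v)] [∀ v, PartialOrder (A v)]
  [∀ v, StarOrderedRing (A v)]

/-- The graph product of the GNS spaces. -/
abbrev GraphGNS (Γ : SimpleGraph V) (φ : ∀ v, GNSFaithfulState (A v)) :=
  GraphHilbert Γ fun v => (φ v).cyclic

/-- The action `λ_v(a)` of `a ∈ A_v` on the graph product Hilbert space. -/
noncomputable def vertexOp (Γ : SimpleGraph V) (φ : ∀ v, GNSFaithfulState (A v)) (v : V) (a : A v) :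
    GraphGNS Γ φ →L[ℂ] GraphGNS Γ φ :=
  graphRep Γ (fun v => (φ v).cyclic) (fun v => (φ v).norm_cyclic) v ((φ v).toPos.gnsStarAlgHom a)

/-- The C⋆-algebra of operators on the graph product Hilbert space generated by all `λ_v(A_v)`. -/
noncomputable def redGraphAlg (Γ : SimpleGraph V) (φ : ∀ v, GNSFaithfulState (A v)) :
    StarSubalgebra ℂ (GraphGNS Γ φ →L[ℂ] GraphGNS Γ φ) :=
  (StarAlgebra.adjoin ℂ (⋃ v, Set.range (vertexOp Γ φ v))).topologicalClosure

instance (Γ : SimpleGraph V) (φ : ∀ v, GNSFaithfulState (A v)) :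
    IsClosed (redGraphAlg Γ φ : Set (GraphGNS Γ φ →L[ℂ] GraphGNS Γ φ)) :=
  StarSubalgebra.isClosed_topologicalClosure _

/-- The reduced graph product C⋆-algebra `A_Γ`. -/
def RedGraphProd (Γ : SimpleGraph V) (φ : ∀ v, GNSFaithfulState (A v)) : Type _ :=
  redGraphAlg Γ φ

noncomputable instance (Γ : SimpleGraph V) (φ : ∀ v, GNSFaithfulState (A v)) :
    CStarAlgebra (RedGraphProd Γ φ) := inferInstanceAs (CStarAlgebra (redGraphAlg Γ φ))
noncomputable instance (Γ : SimpleGraph V) (φ : ∀ v, GNSFaithfulState (A v)) :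
    PartialOrder (RedGraphProd Γ φ) := CStarAlgebra.spectralOrder _
instance (Γ : SimpleGraph V) (φ : ∀ v, GNSFaithfulState (A v)) :
    StarOrderedRing (RedGraphProd Γ φ) := CStarAlgebra.spectralOrderedRing _

/-- The elements of `A_Γ` as operators on the graph product Hilbert space. -/
noncomputable def toOp (Γ : SimpleGraph V) (φ : ∀ v, GNSFaithfulState (A v)) :
    RedGraphProd Γ φ →⋆ₐ[ℂ] (GraphGNS Γ φ →L[ℂ] GraphGNS Γ φ) := (redGraphAlg Γ φ).subtype

/-- The embedding of `A_v` into the reduced graph product. -/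
noncomputable def vertexIncl (Γ : SimpleGraph V) (φ : ∀ v, GNSFaithfulState (A v)) (v : V)
    (a : A v) : RedGraphProd Γ φ :=
  ⟨vertexOp Γ φ v a, StarSubalgebra.le_topologicalClosure _
    (StarAlgebra.subset_adjoin ℂ _ (Set.mem_iUnion.mpr ⟨v, a, rfl⟩))⟩

/-- The vacuum vector of the graph product of the GNS spaces. -/
noncomputable def gnsVacuum (Γ : SimpleGraph V) (φ : ∀ v, GNSFaithfulState (A v)) : GraphGNS Γ φ :=
  vacuum Γ fun v => (φ v).cyclic

/-- The graph product state `ω_Γ(x) = ⟪Ω, x Ω⟫`. -/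
noncomputable def graphState (Γ : SimpleGraph V) (φ : ∀ v, GNSFaithfulState (A v))
    (x : RedGraphProd Γ φ) : ℂ := ⟪gnsVacuum Γ φ, toOp Γ φ x (gnsVacuum Γ φ)⟫_ℂ

/-- The reduced graph product `A_S` of the subgraph of `Γ` induced on a set `S` of vertices. -/
abbrev SubProd (Γ : SimpleGraph V) (φ : ∀ v, GNSFaithfulState (A v)) (S : Set V) :=
  RedGraphProd (Γ.induce S) fun v : S => φ v

end GraphAlgebra

/-! ### The reduced amalgamated free product -/

section Amalgam

/-- A conditional expectation of `A` onto a unital C⋆-subalgebra `B`, embedded by `j`: a completely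
positive `B`-bimodule map which is the identity on `B`. -/
structure CondExp {A B : Type*} [CStarAlgebra A] [PartialOrder A] [StarOrderedRing A]
    [CStarAlgebra B] [PartialOrder B] [StarOrderedRing B] (j : B →⋆ₐ[ℂ] A) extends
    CompletelyPositiveMap A B where
  map_incl : ∀ b, toFun (j b) = b
  map_mul_left : ∀ b a, toFun (j b * a) = b * toFun a
  map_mul_right : ∀ a b, toFun (a * j b) = toFun a * b

noncomputable instance {A B : Type*} [CStarAlgebra A] [PartialOrder A] [StarOrderedRing A]
    [CStarAlgebra B] [PartialOrder B] [StarOrderedRing B] (j : B →⋆ₐ[ℂ] A) :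
    CoeFun (CondExp j) fun _ => A → B := ⟨fun E => E.toCompletelyPositiveMap⟩

variable {ι : Type*} {A : ι → Type*} {B : Type*} {K : Type*}
  [∀ i, CStarAlgebra (A i)] [∀ i, PartialOrder (A i)] [∀ i, StarOrderedRing (A i)]
  [CStarAlgebra B] [PartialOrder B] [StarOrderedRing B]
  [NormedAddCommGroup K] [InnerProductSpace ℂ K]
  {j : ∀ i, B →⋆ₐ[ℂ] A i} (E : ∀ i, CondExp (j i))

/-- A letter is an element of some `A_i° = ker E_i`. -/
abbrev AmLetter := Σ i, {a : A i // E i a = 0}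

variable {E}

open Classical in
/-- `E_i(a⋆ c b)` for letters `a, b ∈ A_i°`, and `0` for letters of different colours. -/
noncomputable def step (c : B) (p q : AmLetter E) : B :=
  if h : q.1 = p.1 then E p.1 (star p.2.1 * j p.1 c * (h ▸ q.2.1)) else 0

/-- Two words of the same length are processed letter by letter by `f`; words of different lengths
give `0`. -/
def nestWith {B L : Type*} [Zero B] (f : B → L → L → B) : B → List L → List L → B
  | c, [], [] => c
  | c, p :: x, q :: y => nestWith f (f c p q) x y
  | _, [], _ :: _ => 0
  | _, _ :: _, [] => 0

/-- `E(aₙ⋆ ⋯ E(a₂⋆ E(a₁⋆ c b₁) b₂) ⋯ bₙ)`. For `c = 1` this is the `B`-valued inner product of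
`a₁ ⊗ ⋯ ⊗ aₙ` and `b₁ ⊗ ⋯ ⊗ bₙ` in the free product Hilbert `B`-module; it is zero if the colours
of the two words are different. -/
noncomputable def nest (c : B) (x y : List (AmLetter E)) : B := nestWith step c x y

theorem nest_nil (c : B) : nest (E := E) c [] [] = c := by simp [nest, nestWith]
theorem nest_cons (c : B) (p q : AmLetter E) (x y : List (AmLetter E)) :
    nest c (p :: x) (q :: y) = nest (step c p q) x y := by simp [nest, nestWith]
theorem nest_nil_cons (c : B) (q : AmLetter E) (y : List (AmLetter E)) :
    nest c [] (q :: y) = 0 := by simp [nest, nestWith]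
theorem nest_cons_nil (c : B) (p : AmLetter E) (x : List (AmLetter E)) :
    nest c (p :: x) [] = 0 := by simp [nest, nestWith]

theorem step_self (c : B) (i : ι) (a b : {a : A i // E i a = 0}) :
    step (E := E) c ⟨i, a⟩ ⟨i, b⟩ = E i (star a.1 * j i c * b.1) := by simp [step]

theorem step_ne (c : B) {p q : AmLetter E} (h : q.1 ≠ p.1) : step c p q = 0 := dif_neg h

theorem step_add (c d : B) (p q : AmLetter E) : step (c + d) p q = step c p q + step d p q := by
  unfold step
  split_ifs
  · rw [map_add, mul_add, add_mul, map_add]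
  · simp

theorem step_smul (r : ℂ) (c : B) (p q : AmLetter E) : step (r • c) p q = r • step c p q := by
  unfold step
  split_ifs
  · rw [map_smul, mul_smul_comm, smul_mul_assoc, map_smul]
  · simp

theorem nest_add (c d : B) (x y : List (AmLetter E)) :
    nest (c + d) x y = nest c x y + nest d x y := by
  induction x generalizing c d y with
  | nil => cases y <;> simp [nest_nil, nest_nil_cons]
  | cons p x ih => cases y <;> simp [nest_cons_nil, nest_cons, step_add, ih]

theorem nest_smul (r : ℂ) (c : B) (x y : List (AmLetter E)) :
    nest (r • c) x y = r • nest c x y := by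
  induction x generalizing c y with
  | nil => cases y <;> simp [nest_nil, nest_nil_cons]
  | cons p x ih => cases y <;> simp [nest_cons_nil, nest_cons, step_smul, ih]

theorem nest_zero (x y : List (AmLetter E)) : nest 0 x y = 0 := by
  simpa using nest_smul 0 (0 : B) x y

open Classical in
/-- The first letter of a word if it has colour `i`, and `0` otherwise. -/
noncomputable def headOf (i : ι) : List (AmLetter E) → A i
  | [] => 0
  | p :: _ => if h : p.1 = i then h ▸ p.2.1 else 0

theorem cstarMatrix_conj_nonneg {S C : Type*} [Fintype S] [CStarAlgebra C] [PartialOrder C]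
    [StarOrderedRing C] (c : S → S → C) (hc : 0 ≤ CStarMatrix.ofMatrix (Matrix.of c)) (a : S → C) :
    0 ≤ CStarMatrix.ofMatrix (Matrix.of fun s t => star (a s) * c s t * a t) := by
  classical
  have := star_left_conjugate_nonneg hc (CStarMatrix.ofMatrix (Matrix.diagonal a))
  convert this using 1
  ext s t
  simp [CStarMatrix.mul_apply, CStarMatrix.star_apply, Matrix.diagonal_apply, apply_ite star]

theorem nest_nonneg {S : Type*} [Fintype S] (n : ℕ) :
    ∀ (c : S → S → B), 0 ≤ CStarMatrix.ofMatrix (Matrix.of c) → ∀ x : S → List (AmLetter E),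
      (∀ s, (x s).length ≤ n) →
      0 ≤ CStarMatrix.ofMatrix (Matrix.of fun s t => nest (c s t) (x s) (x t)) := by
  classical
  induction n with
  | zero =>
    intro c hc x hx
    have hx' : ∀ s, x s = [] := fun s => List.length_eq_zero_iff.mp (Nat.le_zero.mp (hx s))
    simpa only [hx', nest_nil] using hc
  | succ n ih =>
    intro c hc x hx
    let I : Finset ι := Finset.univ.biUnion fun s => ((x s).map Sigma.fst).toFinset
    let d : S → S → B := fun s t =>
      ∑ i ∈ I, E i (star (headOf i (x s)) * j i (c s t) * headOf i (x t))
    let e : S → B := fun s => if x s = [] then 1 else 0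
    have hI : ∀ i, 0 ≤ CStarMatrix.ofMatrix (Matrix.of fun s t =>
        E i (star (headOf i (x s)) * j i (c s t) * headOf i (x t))) := fun i =>
      (E i).toCompletelyPositiveMap.map_cstarMatrix_nonneg _
        (cstarMatrix_conj_nonneg (fun s t => j i (c s t))
          (CompletelyPositiveMap.map_cstarMatrix_nonneg
            (CompletelyPositiveMapClass.toCompletelyPositiveLinearMap (j i)) _ hc)
          fun s => headOf i (x s))
    have hd : 0 ≤ CStarMatrix.ofMatrix (Matrix.of d) := by
      have : CStarMatrix.ofMatrix (Matrix.of d) = ∑ i ∈ I, CStarMatrix.ofMatrix (Matrix.of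
          fun s t => E i (star (headOf i (x s)) * j i (c s t) * headOf i (x t))) := by
        ext s t
        have : ∀ J : Finset ι, (∑ i ∈ J, CStarMatrix.ofMatrix (Matrix.of fun s t =>
            E i (star (headOf i (x s)) * j i (c s t) * headOf i (x t)))) s t =
            ∑ i ∈ J, E i (star (headOf i (x s)) * j i (c s t) * headOf i (x t)) := by
          intro J
          induction J using Finset.induction_on with
          | empty => simp
          | insert i J hi ih => rw [Finset.sum_insert hi, Finset.sum_insert hi,
              CStarMatrix.add_apply, ih]; rfl
        exact (this I).symm
      rw [this]
      exact Finset.sum_nonneg fun i _ => hI i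
    have h1 := ih d hd (fun s => (x s).tail) fun s => by
      have := hx s
      rw [List.length_tail]; omega
    have h2 := cstarMatrix_conj_nonneg c hc e
    have h3 := add_nonneg h2 h1
    convert h3 using 1
    ext s t
    change nest (c s t) (x s) (x t) = star (e s) * c s t * e t + nest (d s t) (x s).tail (x t).tail
    have hzl : x s = [] → d s t = 0 := fun h => Finset.sum_eq_zero fun i _ => by
      simp [h, headOf]
    have hzr : x t = [] → d s t = 0 := fun h => Finset.sum_eq_zero fun i _ => by
      simp [h, headOf]
    cases hs : x s with
    | nil =>
      rw [hzl hs, nest_zero, add_zero]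
      cases ht : x t with
      | nil => simp [nest_nil, e, hs, ht]
      | cons q y => simp [nest_nil_cons, e, ht]
    | cons p y =>
      cases ht : x t with
      | nil => rw [hzr ht, nest_zero, add_zero]; simp [nest_cons_nil, e, hs]
      | cons q z =>
        have hd' : d s t = step (c s t) p q := by
          have hpI : p.1 ∈ I := Finset.mem_biUnion.mpr ⟨s, Finset.mem_univ s, by simp [hs]⟩
          have := Finset.sum_eq_single_of_mem (f := fun i =>
            E i (star (headOf i (x s)) * j i (c s t) * headOf i (x t))) p.1 hpI (by
              intro i _ hi
              simp [hs, headOf, hi.symm])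
          refine this.trans ?_
          by_cases h : q.1 = p.1
          · simp [hs, ht, headOf, step, h]
          · simp [hs, ht, headOf, step, h]
        rw [nest_cons, hd']
        simp [e, hs, ht]

theorem exists_star_mul_self {C : Type*} [NonUnitalCStarAlgebra C] [PartialOrder C]
    [StarOrderedRing C] {a : C} (h : 0 ≤ a) : ∃ b, a = star b * b :=
  CStarAlgebra.nonneg_iff_eq_star_mul_self.mp h

theorem inner_factor {B K : Type*} [CStarAlgebra B] [NormedAddCommGroup K]
    [InnerProductSpace ℂ K] [CompleteSpace K] (ρ : B →⋆ₐ[ℂ] (K →L[ℂ] K)) (b c : B) (ξ η : K) :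
    ⟪ξ, ρ (star b * c) η⟫_ℂ = ⟪ρ b ξ, ρ c η⟫_ℂ := by
  rw [map_mul, map_star]
  exact ContinuousLinearMap.adjoint_inner_right (ρ b) ξ (ρ c η)

theorem form_nonneg [CompleteSpace K] {S : Type*} [Fintype S] (ρ : B →⋆ₐ[ℂ] (K →L[ℂ] K))
    (M : S → S → B) (hM : 0 ≤ CStarMatrix.ofMatrix (Matrix.of M)) (ξ : S → K) (g : S → ℂ) :
    0 ≤ ∑ s, ∑ t, star (g s) * ⟪ξ s, ρ (M s t) (ξ t)⟫_ℂ * g t := by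
  obtain ⟨N, hN⟩ := exists_star_mul_self hM
  have hN' : ∀ s t, M s t = ∑ k, star (N k s) * N k t := fun s t =>
    (congrFun (congrFun hN s) t).trans CStarMatrix.mul_apply
  have e1 : ∀ s t, ⟪ξ s, ρ (M s t) (ξ t)⟫_ℂ = ∑ k, ⟪ρ (N k s) (ξ s), ρ (N k t) (ξ t)⟫_ℂ := by
    intro s t
    rw [hN', map_sum, sum_apply, inner_sum]
    exact Finset.sum_congr rfl fun k _ => inner_factor ρ _ _ _ _
  have e2 : ∀ k, ⟪∑ s, g s • ρ (N k s) (ξ s), ∑ s, g s • ρ (N k s) (ξ s)⟫_ℂ =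
      ∑ s, ∑ t, star (g s) * ⟪ρ (N k s) (ξ s), ρ (N k t) (ξ t)⟫_ℂ * g t := by
    intro k
    simp only [sum_inner, inner_sum, inner_smul_left, inner_smul_right, Finset.mul_sum]
    rw [Finset.sum_comm]
    refine Finset.sum_congr rfl fun s _ => Finset.sum_congr rfl fun t _ => ?_
    rw [Complex.star_def]
    ring
  have e3 : ∑ s, ∑ t, star (g s) * ⟪ξ s, ρ (M s t) (ξ t)⟫_ℂ * g t =
      ∑ k, ⟪∑ s, g s • ρ (N k s) (ξ s), ∑ s, g s • ρ (N k s) (ξ s)⟫_ℂ := by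
    simp only [e1, e2, Finset.mul_sum, Finset.sum_mul]
    rw [Finset.sum_comm' (s := Finset.univ) (t := fun _ => Finset.univ) (t' := Finset.univ)
      (s' := fun _ => Finset.univ) (by simp)]
    conv_rhs => rw [Finset.sum_comm]; enter [2, s]; rw [Finset.sum_comm]
    rw [Finset.sum_comm]
  rw [e3]
  refine Finset.sum_nonneg fun k _ => ?_
  rw [inner_self_eq_norm_sq_to_K, ← RCLike.ofReal_pow]
  exact RCLike.ofReal_nonneg.mpr (sq_nonneg _)

/-- Matrices over `B` that are positive on all finite sets give positive semidefinite kernels. -/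
theorem posSemidef_of_cstarMatrix {X : Type*} [CompleteSpace K] (ρ : B →⋆ₐ[ℂ] (K →L[ℂ] K))
    (M : X → X → B)
    (hM : ∀ S : Finset X, 0 ≤ CStarMatrix.ofMatrix (Matrix.of fun s t : S => M s t)) (ξ : X → K) :
    (Matrix.of fun x y => ⟪ξ x, ρ (M x y) (ξ y)⟫_ℂ).PosSemidef := by
  classical
  refine ⟨Matrix.ext fun x y => ?_, fun f => ?_⟩
  · have h := (IsSelfAdjoint.of_nonneg (hM {x, y})).star_eq
    have h' : star (M y x) = M x y := congrFun (congrFun h ⟨x, by simp⟩) ⟨y, by simp⟩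
    have h2 := inner_factor ρ (M y x) 1 (ξ x) (ξ y)
    rw [mul_one, h', map_one] at h2
    rw [Matrix.conjTranspose_apply, Matrix.of_apply, Matrix.of_apply, h2]
    exact inner_conj_symm _ _
  · have e := form_nonneg ρ _ (hM f.support) (fun s => ξ s) (fun s => f s)
    simp only [Finsupp.sum, Matrix.of_apply]
    rw [← Finset.sum_coe_sort]
    exact e.trans_eq (Finset.sum_congr rfl fun s _ =>
      Finset.sum_coe_sort f.support fun t => star (f s) * ⟪ξ s, ρ (M s t) (ξ t)⟫_ℂ * f t)

variable (E) in
/-- Alternating words: neighbouring letters have different colours. -/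
abbrev AmWord := {x : List (AmLetter E) // (x.map Sigma.fst).IsChain (· ≠ ·)}

theorem nest_posSemidef {X : Type*} [CompleteSpace K] (ρ : B →⋆ₐ[ℂ] (K →L[ℂ] K)) (c : X → X → B)
    (hc : ∀ S : Finset X, 0 ≤ CStarMatrix.ofMatrix (Matrix.of fun s t : S => c s t))
    (x : X → List (AmLetter E)) (ξ : X → K) :
    (Matrix.of fun s t => ⟪ξ s, ρ (nest (c s t) (x s) (x t)) (ξ t)⟫_ℂ).PosSemidef :=
  posSemidef_of_cstarMatrix ρ _ (fun S => nest_nonneg (S.sup fun s => (x s).length) _ (hc S)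
    (fun s => x s) fun s => Finset.le_sup (f := fun s => (x s).length) s.2) ξ

theorem gram_nonneg {S C : Type*} [Fintype S] [CStarAlgebra C] [PartialOrder C]
    [StarOrderedRing C] (a : S → C) :
    0 ≤ CStarMatrix.ofMatrix (Matrix.of fun s t => star (a s) * a t) := by
  classical
  rcases isEmpty_or_nonempty S with h | ⟨⟨s₀⟩⟩
  · rw [show CStarMatrix.ofMatrix (Matrix.of fun s t => star (a s) * a t) = 0 from
      CStarMatrix.ext fun s => h.elim s]
  have := star_mul_self_nonneg (CStarMatrix.ofMatrix
    (Matrix.of fun s t => if s = s₀ then a t else 0))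
  convert this using 1
  ext s t
  simp [CStarMatrix.mul_apply, CStarMatrix.star_apply, apply_ite star]

variable [CompleteSpace K] (ρ : B →⋆ₐ[ℂ] (K →L[ℂ] K))

variable (E) in
/-- The inner products of the elementary tensors `a₁ ⊗ ⋯ ⊗ aₙ ⊗ ξ`. -/
noncomputable def amKernel : PosKernel (AmWord E × K) where
  ker p q := ⟪p.2, ρ (nest 1 p.1.1 q.1.1) q.2⟫_ℂ
  psd := nest_posSemidef ρ (fun _ _ => 1)
    (fun S => by simpa using gram_nonneg fun _ : S => (1 : B)) _ _

variable (E) in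
/-- The Hilbert space `F ⊗_B K`, where `F = B ⊕ ⨁ A_{i₁}° ⊗_B ⋯ ⊗_B A_{iₙ}°` (`i₁ ≠ i₂ ≠ ⋯ ≠ iₙ`)
is the free product Hilbert `B`-module. -/
abbrev AmHilbert := (amKernel E ρ).Space

variable (E) in
/-- The elementary tensor `a₁ ⊗ ⋯ ⊗ aₙ ⊗ ξ`. -/
noncomputable def amElem (x : List (AmLetter E)) (hx : (x.map Sigma.fst).IsChain (· ≠ ·))
    (ξ : K) : AmHilbert E ρ := (amKernel E ρ).vec (⟨x, hx⟩, ξ)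

variable (E) in
theorem inner_amElem (x y : List (AmLetter E)) (hx : (x.map Sigma.fst).IsChain (· ≠ ·))
    (hy : (y.map Sigma.fst).IsChain (· ≠ ·)) (ξ η : K) :
    ⟪amElem E ρ x hx ξ, amElem E ρ y hy η⟫_ℂ = ⟪ξ, ρ (nest 1 x y) η⟫_ℂ :=
  (amKernel E ρ).inner_vec _ _

variable (E) in
/-- The generators `a ⊗ w` of `A_i ⊗_B F(i) ⊗_B K`, where `w = a₁ ⊗ ⋯ ⊗ aₙ ⊗ ξ` is an elementary
tensor whose first letter does not have the colour `i`. -/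
abbrev AmFront (i : ι) :=
  A i × {x : List (AmLetter E) // (i :: x.map Sigma.fst).IsChain (· ≠ ·)} × K

variable (E) in
/-- The inner products of the generators of `A_i ⊗_B F(i) ⊗_B K`. -/
noncomputable def amFrontKernel (i : ι) : PosKernel (AmFront (K := K) E i) where
  ker p q := ⟪p.2.2, ρ (nest (E i (star p.1 * q.1)) p.2.1.1 q.2.1.1) q.2.2⟫_ℂ
  psd := nest_posSemidef ρ (fun p q : AmFront (K := K) E i => E i (star p.1 * q.1))
    (fun S => (E i).toCompletelyPositiveMap.map_cstarMatrix_nonneg _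
      (gram_nonneg fun p : S => p.1.1)) _ _

/-- `b · a` for `b ∈ B` and a letter `a ∈ A_i°`. -/
noncomputable def bLetter (b : B) (p : AmLetter E) : AmLetter E :=
  ⟨p.1, j p.1 b * p.2.1, ((E p.1).map_mul_left b p.2.1).trans
    ((congrArg (b * ·) p.2.2).trans (mul_zero b))⟩

/-- The word part of `b · (a₁ ⊗ ⋯ ⊗ aₙ ⊗ ξ)`. -/
noncomputable def bWord (b : B) : List (AmLetter E) → List (AmLetter E)
  | [] => []
  | p :: x => bLetter b p :: x

/-- The vector part of `b · (a₁ ⊗ ⋯ ⊗ aₙ ⊗ ξ)`. -/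
noncomputable def bVec (b : B) : List (AmLetter E) → K → K
  | [], ξ => ρ b ξ
  | _ :: _, ξ => ξ

theorem map_fst_bWord (b : B) (x : List (AmLetter E)) :
    (bWord b x).map Sigma.fst = x.map Sigma.fst := by
  cases x <;> rfl

/-- The component `a - E_i(a)` of `a` in `A_i°`. -/
noncomputable def amCentre (i : ι) (a : A i) : AmLetter E :=
  ⟨i, a - j i (E i a), by
    rw [map_sub]; exact sub_eq_zero.mpr ((E i).map_incl _).symm⟩

theorem step_bLetter (b c : B) (p q : AmLetter E) :
    step 1 (bLetter b p) (bLetter c q) = step (star b * c) p q := by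
  obtain ⟨i, a⟩ := p
  obtain ⟨k, a'⟩ := q
  by_cases h : k = i
  · subst h
    simp only [bLetter]
    rw [step_self, step_self]
    congr 1
    rw [star_mul, map_one, mul_one, map_mul, map_star]
    simp only [mul_assoc]
  · simp [bLetter, step, h]

theorem inner_bWord (b c : B) (x y : List (AmLetter E)) (ξ η : K) :
    ⟪bVec ρ b x ξ, ρ (nest 1 (bWord b x) (bWord c y)) (bVec ρ c y η)⟫_ℂ =
      ⟪ξ, ρ (nest (star b * c) x y) η⟫_ℂ := by
  cases x with
  | nil =>
    cases y with
    | nil =>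
      simp only [bVec, bWord, nest_nil, map_one, map_mul, map_star]
      exact (ContinuousLinearMap.adjoint_inner_right (ρ b) ξ (ρ c η)).symm
    | cons q y => simp [bWord, nest_nil_cons]
  | cons p x =>
    cases y with
    | nil => simp [bWord, nest_cons_nil]
    | cons q y => simp [bWord, bVec, nest_cons, step_bLetter]

theorem nest_centre_left {i : ι} (a : A i) (x : List (AmLetter E)) {y : List (AmLetter E)}
    (hy : (i :: y.map Sigma.fst).IsChain (· ≠ ·)) (b : B) :
    nest 1 (amCentre i a :: x) (bWord b y) = 0 := by
  cases y with
  | nil => exact nest_cons_nil _ _ _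
  | cons q y =>
    rw [bWord, nest_cons, step_ne, nest_zero]
    have := List.isChain_cons_cons.mp hy
    exact this.1.symm

theorem nest_centre_right {i : ι} (a : A i) {x : List (AmLetter E)} (y : List (AmLetter E))
    (hx : (i :: x.map Sigma.fst).IsChain (· ≠ ·)) (b : B) :
    nest 1 (bWord b x) (amCentre i a :: y) = 0 := by
  cases x with
  | nil => exact nest_nil_cons _ _ _
  | cons q x =>
    rw [bWord, nest_cons, step_ne, nest_zero]
    have := List.isChain_cons_cons.mp hx
    exact this.1

theorem condExp_star (i : ι) (a : A i) : E i (star a) = star (E i a) := by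
  have h := (E i).toCompletelyPositiveMap.map_cstarMatrix_nonneg _
    (gram_nonneg fun s : Bool => if s then a else 1)
  have h' := congrFun (congrFun (IsSelfAdjoint.of_nonneg h).star_eq true) false
  have h'' : star (E i (star 1 * a)) = E i (star a * 1) := h'
  rw [star_one, one_mul, mul_one] at h''
  exact h''.symm

theorem step_centre (i : ι) (a b : A i) :
    step (E := E) 1 (amCentre i a) (amCentre i b) + star (E i a) * E i b = E i (star a * b) := by
  have h1 : E i (star (j i (E i a)) * b) = star (E i a) * E i b := by
    rw [← map_star]; exact (E i).map_mul_left _ _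
  have h2 : E i (star a * j i (E i b)) = star (E i a) * E i b := by
    rw [← condExp_star]; exact (E i).map_mul_right _ _
  have h3 : E i (star (j i (E i a)) * j i (E i b)) = star (E i a) * E i b := by
    rw [← map_star, ← map_mul]; exact (E i).map_incl _
  rw [amCentre, amCentre, step_self, map_one, mul_one, star_sub]
  simp only [mul_sub, sub_mul, map_sub, h1, h2, h3]
  abel

theorem chain_centre {i : ι} {x : List (AmLetter E)}
    (hx : (i :: x.map Sigma.fst).IsChain (· ≠ ·)) (a : A i) :
    ((amCentre (E := E) i a :: x).map Sigma.fst).IsChain (· ≠ ·) := hx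

variable (E) in
/-- The map `U_i : A_i ⊗_B F(i) ⊗_B K → F ⊗_B K`,
`a ⊗ w ↦ (a - E_i(a)) ⊗ w + E_i(a) w`. -/
noncomputable def amFrontMap (i : ι) : (amFrontKernel E ρ i).Space →L[ℂ] AmHilbert E ρ :=
  (amFrontKernel E ρ i).lift
    (fun p => amElem E ρ (amCentre i p.1 :: p.2.1.1) (chain_centre p.2.1.2 _) p.2.2 +
      amElem E ρ (bWord (E i p.1) p.2.1.1)
        (by rw [map_fst_bWord]; exact p.2.1.2.tail) (bVec ρ (E i p.1) p.2.1.1 p.2.2))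
    (fun p q => by
      simp only [inner_add_left, inner_add_right, inner_amElem, inner_bWord,
        nest_centre_left p.1 _ q.2.1.2, nest_centre_right q.1 _ p.2.1.2, map_zero,
        zero_apply, inner_zero_right, add_zero, zero_add]
      rw [← inner_add_right, nest_cons, ← add_apply, ← map_add, ← nest_add,
        step_centre]
      rfl)

variable (E) in
/-- `A_i` acts on `A_i ⊗_B F(i) ⊗_B K` by left multiplication on the first factor. -/
noncomputable def amFrontAction (i : ι) : (amFrontKernel E ρ i).Action (A i) where
  act a p := (a * p.1, p.2)
  adj a p q := by simp [amFrontKernel, mul_assoc]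
  one p q := by simp [amFrontKernel]
  mul a b p q := by simp [amFrontKernel, mul_assoc]
  add a b p q := by simp [amFrontKernel, add_mul, mul_add, nest_add]
  smul r a p q := by simp [amFrontKernel, nest_smul]

variable (E) in
/-- The action `λ_i(a) = U_i (a ⊗ 1) U_i⋆` of `a ∈ A_i`. -/
noncomputable def amOp (i : ι) (a : A i) : AmHilbert E ρ →L[ℂ] AmHilbert E ρ :=
  amFrontMap E ρ i ∘L (amFrontAction E ρ i).op a ∘L (amFrontMap E ρ i).adjoint

variable (E) in
/-- The C⋆-algebra of operators on `F ⊗_B K` generated by all `λ_i(A_i)`. -/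
noncomputable def redAmalgamAlg : StarSubalgebra ℂ (AmHilbert E ρ →L[ℂ] AmHilbert E ρ) :=
  (StarAlgebra.adjoin ℂ (⋃ i, Set.range (amOp E ρ i))).topologicalClosure

instance : IsClosed (redAmalgamAlg E ρ : Set (AmHilbert E ρ →L[ℂ] AmHilbert E ρ)) :=
  StarSubalgebra.isClosed_topologicalClosure _

variable (E) in
/-- The reduced amalgamated free product of the `A_i` over `B` with respect to the conditional
expectations `E_i`: the C⋆-algebra generated by the `A_i` acting on the free product Hilbert
`B`-module `F`. The adjointable operators on `F` are represented on `F ⊗_B K` by `T ↦ T ⊗ 1`,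
faithfully if `ρ` is a faithful representation of `B` on `K`. -/
def RedAmalgam : Type _ := redAmalgamAlg E ρ

noncomputable instance : CStarAlgebra (RedAmalgam E ρ) :=
  inferInstanceAs (CStarAlgebra (redAmalgamAlg E ρ))

variable (E) in
/-- The elements of the reduced amalgamated free product as operators. -/
noncomputable def amToOp : RedAmalgam E ρ →⋆ₐ[ℂ] (AmHilbert E ρ →L[ℂ] AmHilbert E ρ) :=
  (redAmalgamAlg E ρ).subtype

variable (E) in
/-- The embedding of `A_i` into the reduced amalgamated free product. -/
noncomputable def amIncl (i : ι) (a : A i) : RedAmalgam E ρ :=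
  ⟨amOp E ρ i a, StarSubalgebra.le_topologicalClosure _
    (StarAlgebra.subset_adjoin ℂ _ (Set.mem_iUnion.mpr ⟨i, a, rfl⟩))⟩

variable (E) in
/-- The isometry of `K = B ⊗_B K` into `F ⊗_B K`. -/
noncomputable def amIsometry : K →ₗᵢ[ℂ] AmHilbert E ρ :=
  LinearMap.isometryOfInner
    { toFun := fun ξ => amElem E ρ [] .nil ξ
      map_add' := fun ξ η => by
        rw [← sub_eq_zero, ← inner_self_eq_zero (𝕜 := ℂ)]
        simp only [inner_sub_left, inner_sub_right, inner_add_left, inner_add_right, inner_amElem,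
          nest_nil, map_one, one_apply_eq_self]
        ring
      map_smul' := fun c ξ => by
        rw [← sub_eq_zero, ← inner_self_eq_zero (𝕜 := ℂ)]
        simp only [inner_sub_left, inner_sub_right, inner_smul_left, inner_smul_right,
          inner_amElem, nest_nil, map_one, one_apply_eq_self, RingHom.id_apply]
        ring }
    fun ξ η => by
      simpa [nest_nil] using inner_amElem E ρ [] [] .nil .nil ξ η

variable (E) in
/-- The canonical conditional expectation of the reduced amalgamated free product onto `B`, acting
on `K`: the compression to `K`. -/
noncomputable def amExp (x : RedAmalgam E ρ) : K →L[ℂ] K :=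
  (amIsometry E ρ).toContinuousLinearMap.adjoint ∘L amToOp E ρ x ∘L (amIsometry E ρ).toContinuousLinearMap

end Amalgam

/-! ### The pieces of a graph at a vertex -/

section Pieces

variable {V : Type*} {A : V → Type*} [∀ v, CStarAlgebra (A v)] [∀ v, PartialOrder (A v)]
  [∀ v, StarOrderedRing (A v)]

/-- `Link(v)`, the set of neighbours of `v`. -/
abbrev link (Γ : SimpleGraph V) (v : V) : Set V := Γ.neighborSet v

/-- The vertex sets `Γ₁ = Star(v) = Link(v) ∪ {v}` and `Γ₂ = Γ ∖ {v}`. -/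
def pieces (Γ : SimpleGraph V) (v : V) : Fin 2 → Set V := ![link Γ v ∪ {v}, {v}ᶜ]

theorem link_subset_pieces (Γ : SimpleGraph V) (v : V) (i : Fin 2) : link Γ v ⊆ pieces Γ v i := by
  intro w hw
  fin_cases i
  · exact Or.inl hw
  · exact fun h => (SimpleGraph.ne_of_adj Γ hw) h.symm

/-- The canonical inclusion `A_S ⊆ A_T` for `S ⊆ T`: the injective `*`-homomorphism that is the
identity on each `A_w`, `w ∈ S`. -/
def IsSubInclusion (Γ : SimpleGraph V) (φ : ∀ v, GNSFaithfulState (A v)) {S T : Set V} (h : S ⊆ T)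
    (f : SubProd Γ φ S →⋆ₐ[ℂ] SubProd Γ φ T) : Prop :=
  Function.Injective f ∧
    ∀ (w : S) (a : A w), f (vertexIncl (Γ.induce S) (fun v : S => φ v) w a) =
      vertexIncl (Γ.induce T) (fun v : T => φ v) ⟨w, h w.2⟩ a

/-- The canonical inclusion `A_S ⊆ A_Γ`: the injective `*`-homomorphism that is the identity on each
`A_w`, `w ∈ S`. -/
def IsInclusion (Γ : SimpleGraph V) (φ : ∀ v, GNSFaithfulState (A v)) {S : Set V}
    (f : SubProd Γ φ S →⋆ₐ[ℂ] RedGraphProd Γ φ) : Prop :=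
  Function.Injective f ∧
    ∀ (w : S) (a : A w), f (vertexIncl (Γ.induce S) (fun v : S => φ v) w a) = vertexIncl Γ φ w a

/-- The compression of `x ∈ A_Γ` to the graph product Hilbert space of the subgraph on `S`. -/
noncomputable def compress (Γ : SimpleGraph V) (φ : ∀ v, GNSFaithfulState (A v)) (S : Set V)
    (x : RedGraphProd Γ φ) : GraphGNS (Γ.induce S) (fun v : S => φ v) →L[ℂ]
      GraphGNS (Γ.induce S) fun v : S => φ v :=
  (subIsometry Γ (fun v => (φ v).cyclic) S).adjoint ∘L toOp Γ φ x ∘L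
    subIsometry Γ (fun v => (φ v).cyclic) S

/-- The faithful representation of `A_{Link(v)}` on its graph product Hilbert space. -/
noncomputable abbrev linkRep (Γ : SimpleGraph V) (φ : ∀ v, GNSFaithfulState (A v)) (v : V) :
    SubProd Γ φ (link Γ v) →⋆ₐ[ℂ]
      (GraphGNS (Γ.induce (link Γ v)) (fun w : link Γ v => φ w) →L[ℂ]
        GraphGNS (Γ.induce (link Γ v)) fun w : link Γ v => φ w) :=
  toOp (Γ.induce (link Γ v)) fun w : link Γ v => φ w

end Pieces

end GraphProduct

open GraphProduct

/-! ### Operators on Hilbert spaces given by generators -/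

namespace PosKernel

variable {X : Type*} (k : PosKernel X)

/-! For a set `S` of vertices every reduced word factors, uniquely up to exchanging adjacent
neighbours, as a word in `S` followed by a word that cannot start in `S` (`exists_factor`,
`IsFree.equivII_append`). The inner product of elementary tensors respects this factorisation
(`elemInner_append`), so `H_Γ = H_S ⊗ H(S)`. On this tensor product `T ↦ T ⊗ 1` is isometric and
carries the vertex operators on `H_S` to those on `H_Γ` (`ampHom_graphRep`). All inclusions `A_S ⊆
A_T ⊆ A_Γ` come from this; `SubgraphModel` records exactly what is needed.

Compression to `H_S` maps `A_Γ` into `A_S` (`exists_rep_eq_compression`). An operator of a nonempty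
reduced centred word that cannot end in a letter of `S` compresses to zero, and right multiplication
by elements of `A_S` passes through the compression; an induction on generators reduces every
product to these two cases. The resulting map is a positive bimodule map, hence completely positive
(`map_cstarMatrix_nonneg_of_bimodule`), and so a conditional expectation.

The amalgamated free product is recognised by a general criterion, `AmalgamModel`. Suppose the `A_i`
act on a Hilbert space containing `K` and mutually orthogonal sectors `H_i`, all orthogonal to `K`,
such that `ker E_i` sends `K` and each `H_k` with `k ≠ i` into `H_i`. Then the inner products of the
vectors `a₁ ⋯ aₙ ξ` are forced to be the nested expectations defining the free product module
(`AmalgamModel.inner_word`). If `K` is cyclic, this gives a unitary intertwining the actions, and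
the generated algebras agree (`AmalgamModel.exists_equiv`).

In `H_Γ` take `K = H_Link(v)` and divide the words containing a letter outside `Link(v)` by whether
they can start with `v`. For `a` in `A_{Γ_i}` write a word outside sector `i` as `y ⊗ z`, with `y`
in the `i`-th piece and `z` unable to start there. Then `y` is a word in `Link(v)`, and `a` acts on
`y` alone. If `E_i(a) = 0`, then `a y` is orthogonal to `H_Link(v)`, so `a (y ⊗ z)` lies in sector
`i` (`opHom_mem_sector`). The vacuum is cyclic, the vertex algebras generate, and the isomorphism
with its uniqueness and state preservation follows. -/

theorem toSpace_mem_span (f : k.Pre) : k.toSpace f ∈ Submodule.span ℂ (Set.range k.vec) := by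
  have key : ∀ g : X →₀ ℂ, k.toSpace (k.coef.symm g) ∈ Submodule.span ℂ (Set.range k.vec) := by
    intro g
    induction g using Finsupp.induction_linear with
    | zero => simp
    | add f g hf hg => rw [map_add, map_add]; exact add_mem hf hg
    | single x c =>
      have : Finsupp.single x c = c • Finsupp.single x (1 : ℂ) := by simp
      rw [this, map_smul, map_smul]
      exact Submodule.smul_mem _ _ (Submodule.subset_span ⟨x, rfl⟩)
  simpa using key (k.coef f)

theorem dense_span_vec : Dense (Submodule.span ℂ (Set.range k.vec) : Set k.Space) := by
  have h : DenseRange k.toSpace := UniformSpace.Completion.denseRange_coe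
  refine h.mono ?_
  rintro _ ⟨f, rfl⟩
  exact k.toSpace_mem_span f

end PosKernel

/-! ### Total families and closed spans -/

section Generic

variable {X E F : Type*} [NormedAddCommGroup E] [InnerProductSpace ℂ E]
  [NormedAddCommGroup F] [InnerProductSpace ℂ F]

theorem eq_of_inner_total {f : X → E} (hf : Dense (Submodule.span ℂ (Set.range f) : Set E))
    {a b : E} (h : ∀ x, ⟪f x, a⟫_ℂ = ⟪f x, b⟫_ℂ) : a = b := by
  rw [← sub_eq_zero]
  refine hf.eq_zero_of_mem_orthogonal (𝕜 := ℂ) ?_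
  rw [Submodule.mem_orthogonal]
  intro u hu
  induction hu using Submodule.span_induction with
  | mem x hx =>
    obtain ⟨x, rfl⟩ := hx
    rw [inner_sub_right, h, sub_self]
  | zero => simp
  | add x y _ _ hx hy => rw [inner_add_left, hx, hy, add_zero]
  | smul c x _ hx => rw [inner_smul_left, hx, mul_zero]

theorem clm_ext_total {f : X → E} (hf : Dense (Submodule.span ℂ (Set.range f) : Set E))
    {S T : E →L[ℂ] F} (h : ∀ x, S (f x) = T (f x)) : S = T :=
  ContinuousLinearMap.ext_on hf (by rintro _ ⟨x, rfl⟩; exact h x)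

/-- A bounded operator maps the closed span of a set into a closed subspace if it maps the set
into it. -/
theorem map_mem_of_closure_span {s : Set E} {N : Submodule ℂ F} (hN : IsClosed (N : Set F))
    (T : E →L[ℂ] F) (h : ∀ x ∈ s, T x ∈ N) {x : E}
    (hx : x ∈ (Submodule.span ℂ s).topologicalClosure) : T x ∈ N := by
  have h1 : Submodule.span ℂ s ≤ N.comap T.toLinearMap := Submodule.span_le.mpr h
  have h2 := Submodule.topologicalClosure_minimal _ h1 (hN.preimage T.continuous)
  exact h2 hx

theorem inner_eq_zero_of_closure_span {s t : Set E} (h : ∀ x ∈ s, ∀ y ∈ t, ⟪x, y⟫_ℂ = 0) {x y : E}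
    (hx : x ∈ (Submodule.span ℂ s).topologicalClosure)
    (hy : y ∈ (Submodule.span ℂ t).topologicalClosure) : ⟪x, y⟫_ℂ = 0 := by
  have h1 : ∀ x ∈ s, ⟪x, y⟫_ℂ = 0 := fun x hx => by
    have := map_mem_of_closure_span (N := ⊥) isClosed_singleton (innerSL ℂ x)
      (fun z hz => by simpa using h x hx z hz) hy
    simpa using this
  have := map_mem_of_closure_span (N := ⊥) isClosed_singleton (innerSL ℂ y)
      (fun z hz => by
        simpa using inner_eq_zero_symm.mp (h1 z hz)) hx
  exact inner_eq_zero_symm.mp (by simpa using this)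

variable [CompleteSpace E]

/-- If the generators split into two orthogonal families, the orthogonal complement of the first is
the closed span of the second. -/
theorem mem_closure_span_of_orthogonal {f : X → E}
    (hf : Dense (Submodule.span ℂ (Set.range f) : Set E)) (P : X → Prop)
    (hP : ∀ x y, P x → ¬ P y → ⟪f x, f y⟫_ℂ = 0) {a : E} (ha : ∀ x, P x → ⟪f x, a⟫_ℂ = 0) :
    a ∈ (Submodule.span ℂ (f '' {x | ¬ P x})).topologicalClosure := by
  set N := (Submodule.span ℂ (f '' {x | ¬ P x})).topologicalClosure with hN
  have hNc : IsClosed (N : Set E) := Submodule.isClosed_topologicalClosure _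
  have : CompleteSpace N := hNc.completeSpace_coe
  -- It suffices to compare `a` with its projection to `N` on the generators: against the first
  -- family both give zero, against the second they agree by the defining property of the
  -- projection.
  have h0 : a = N.starProjection a := by
    refine eq_of_inner_total hf fun x => ?_
    by_cases hx : P x
    · rw [ha x hx]
      refine (inner_eq_zero_of_closure_span (s := {f x}) (t := f '' {x | ¬ P x}) ?_ ?_ ?_).symm
      · rintro _ rfl _ ⟨y, hy, rfl⟩
        exact hP x y hx hy
      · exact Submodule.le_topologicalClosure _ (Submodule.subset_span rfl)
      · exact Submodule.starProjection_apply_mem _ _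
    · have hxN : f x ∈ N :=
        Submodule.le_topologicalClosure _ (Submodule.subset_span ⟨x, hx, rfl⟩)
      have := Submodule.starProjection_inner_eq_zero (K := N) a (f x) hxN
      rw [inner_sub_left, sub_eq_zero] at this
      rw [← inner_conj_symm, this, inner_conj_symm]
  rw [h0]
  exact Submodule.starProjection_apply_mem _ _

end Generic

/-! ### Isometries and representations determined on generators -/

namespace PosKernel

variable {X : Type*} {k : PosKernel X} {E : Type*} [NormedAddCommGroup E] [InnerProductSpace ℂ E]
  [CompleteSpace E] {A : Type*} [CStarAlgebra A]

theorem adjoint_lift_lift (f : X → E) (hf : ∀ x y, ⟪f x, f y⟫_ℂ = k.ker x y) (a : k.Space) :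
    (k.lift f hf).adjoint (k.lift f hf a) = a := by
  have : (k.lift f hf).adjoint ∘L k.lift f hf = ContinuousLinearMap.id ℂ _ := by
    refine clm_ext_total k.dense_span_vec fun y => eq_of_inner_total k.dense_span_vec fun x => ?_
    rw [ContinuousLinearMap.comp_apply, ContinuousLinearMap.adjoint_inner_right, lift_vec, lift_vec,
      hf, ContinuousLinearMap.id_apply, inner_vec]
  exact congrArg (fun T => T a) this

theorem inner_lift_lift (f : X → E) (hf : ∀ x y, ⟪f x, f y⟫_ℂ = k.ker x y) (a b : k.Space) :
    ⟪k.lift f hf a, k.lift f hf b⟫_ℂ = ⟪a, b⟫_ℂ := by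
  rw [← ContinuousLinearMap.adjoint_inner_right, adjoint_lift_lift]

/-- Each `f y` is in the range of the isometry, so the range projection fixes a total family and the
isometry is unitary. -/
theorem lift_adjoint_lift (f : X → E) (hf : ∀ x y, ⟪f x, f y⟫_ℂ = k.ker x y)
    (hd : Dense (Submodule.span ℂ (Set.range f) : Set E)) (a : E) :
    k.lift f hf ((k.lift f hf).adjoint a) = a := by
  have : k.lift f hf ∘L (k.lift f hf).adjoint = ContinuousLinearMap.id ℂ _ := by
    refine clm_ext_total hd fun y => ?_
    rw [← k.lift_vec f hf y, ContinuousLinearMap.comp_apply, adjoint_lift_lift]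
    rfl
  exact congrArg (fun T => T a) this

theorem Action.op_adjoint (α : k.Action A) (a : A) : (α.op a).adjoint = α.op (star a) := by
  refine clm_ext_total k.dense_span_vec fun y => eq_of_inner_total k.dense_span_vec fun x => ?_
  rw [ContinuousLinearMap.adjoint_inner_right, Action.op_vec, Action.op_vec, inner_vec, inner_vec,
    α.adj]

/-- An action is only required to satisfy its axioms inside the kernel, that is, as matrix
coefficients between generators; this turns them into identities of operators. -/
theorem Action.op_ext {α : k.Action A} {a : A} {T : k.Space →L[ℂ] k.Space}
    (h : ∀ x y, k.ker x (α.act a y) = ⟪k.vec x, T (k.vec y)⟫_ℂ) : α.op a = T := by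
  refine clm_ext_total k.dense_span_vec fun y => eq_of_inner_total k.dense_span_vec fun x => ?_
  rw [Action.op_vec, inner_vec, h]

/-- The representation of `A` on the Hilbert space generated by `k`. -/
noncomputable def Action.rep (α : k.Action A) : A →⋆ₐ[ℂ] (k.Space →L[ℂ] k.Space) where
  toFun := α.op
  map_one' := op_ext fun x y => by rw [α.one]; exact (k.inner_vec x y).symm
  map_mul' a b := op_ext fun x y => by
    rw [α.mul, mul_apply_eq_comp, op_vec, op_vec, inner_vec]
  map_zero' := op_ext fun x y => by
    -- The axioms of an action do not mention zero; it is reached as `0 • 0`.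
    have := α.smul 0 0 x y
    rw [zero_smul, zero_mul] at this
    rw [this]; simp
  map_add' a b := op_ext fun x y => by
    rw [α.add, add_apply, op_vec, op_vec, inner_add_right, inner_vec, inner_vec]
  commutes' c := op_ext fun x y => by
    rw [Algebra.algebraMap_eq_smul_one, Algebra.algebraMap_eq_smul_one, α.smul, α.one,
      smul_apply, one_apply_eq_self, inner_smul_right, inner_vec]
  map_star' a := by
    rw [ContinuousLinearMap.star_eq_adjoint, op_adjoint]

/-- The representation of `A` obtained by identifying the generators with the total family `f`. -/
noncomputable def Action.transport (α : k.Action A) (f : X → E)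
    (hf : ∀ x y, ⟪f x, f y⟫_ℂ = k.ker x y)
    (hd : Dense (Submodule.span ℂ (Set.range f) : Set E)) : A →⋆ₐ[ℂ] (E →L[ℂ] E) where
  toFun a := k.lift f hf ∘L α.op a ∘L (k.lift f hf).adjoint
  map_one' := by
    ext x
    have : α.op 1 = 1 := map_one α.rep
    simp [this, lift_adjoint_lift f hf hd]
  map_mul' a b := by
    ext x
    have : α.op (a * b) = α.op a * α.op b := map_mul α.rep a b
    simp [this, adjoint_lift_lift]
  map_zero' := by
    ext x
    have : α.op 0 = 0 := map_zero α.rep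
    simp [this]
  map_add' a b := by
    ext x
    have : α.op (a + b) = α.op a + α.op b := map_add α.rep a b
    simp [this]
  commutes' c := by
    ext x
    have : α.op (algebraMap ℂ A c) = algebraMap ℂ _ c := AlgHomClass.commutes α.rep c
    change k.lift f hf (α.op (algebraMap ℂ A c) ((k.lift f hf).adjoint x)) = _
    rw [this]
    simp only [Algebra.algebraMap_eq_smul_one, smul_apply, one_apply_eq_self, map_smul,
      lift_adjoint_lift f hf hd]
  map_star' a := by
    rw [ContinuousLinearMap.star_eq_adjoint, ContinuousLinearMap.adjoint_comp,
      ContinuousLinearMap.adjoint_comp, ContinuousLinearMap.adjoint_adjoint, Action.op_adjoint]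
    rfl

/-- Since `f x` is the image of a generator under an isometry, its adjoint recovers the generator.
Totality of `f` plays no role, so this applies to the defining expression of `amOp` before
surjectivity of `amFrontMap` is known. -/
theorem Action.lift_op_adjoint_apply (α : k.Action A) (f : X → E)
    (hf : ∀ x y, ⟪f x, f y⟫_ℂ = k.ker x y) (a : A) (x : X) :
    (k.lift f hf ∘L α.op a ∘L (k.lift f hf).adjoint) (f x) = f (α.act a x) := by
  conv_lhs => rw [← k.lift_vec f hf x]
  simp only [ContinuousLinearMap.comp_apply, adjoint_lift_lift]
  rw [op_vec, lift_vec]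

theorem Action.transport_apply (α : k.Action A) (f : X → E)
    (hf : ∀ x y, ⟪f x, f y⟫_ℂ = k.ker x y)
    (hd : Dense (Submodule.span ℂ (Set.range f) : Set E)) (a : A) (x : X) :
    α.transport f hf hd a (f x) = f (α.act a x) := α.lift_op_adjoint_apply f hf a x

end PosKernel

namespace GraphProduct

/-! ### Combinatorics of reduced words -/

section Words

variable {V : Type*} {Γ : SimpleGraph V}

theorem canStart_append {v : V} {x y : List V} :
    CanStart Γ v (x ++ y) ↔ CanStart Γ v x ∨ ((∀ a ∈ x, Γ.Adj v a) ∧ CanStart Γ v y) := by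
  induction x with
  | nil => simp [CanStart]
  | cons a x ih =>
    simp only [List.cons_append, CanStart, ih, List.forall_mem_cons]
    tauto

theorem canStart_mem {v : V} {w : List V} (h : CanStart Γ v w) : v ∈ w := by
  obtain ⟨m, z, rfl, -⟩ := h.exists_eq
  simp

/-- Recursive form of reducedness. If between two occurrences of `v` only letters of `Star(v)`
appear, the first later occurrence of `v` is preceded only by neighbours of `v`, so it can be moved
to the front. -/
theorem isReducedWord_cons {a : V} {w : List V} :
    IsReducedWord Γ (a :: w) ↔ IsReducedWord Γ w ∧ ¬ CanStart Γ a w := by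
  refine ⟨fun h => ⟨h.tail, h.not_canStart⟩, ?_⟩
  rintro ⟨h1, h2⟩ v u m z e hm
  cases u with
  | cons b u =>
    simp only [List.cons_append, List.cons.injEq] at e
    exact h1 v u m z e.2 hm
  | nil =>
    simp only [List.nil_append, List.cons.injEq] at e
    obtain ⟨rfl, rfl⟩ := e
    refine h2 ?_
    clear h1 h2
    induction m with
    | nil => exact Or.inl rfl
    | cons b m ih =>
      rcases hm b (by simp) with h | h
      · exact Or.inl h
      · exact Or.inr ⟨h, ih fun x hx => hm x (by simp [hx])⟩

theorem EquivII.canStart_iff {v : V} {w w' : List V} (h : EquivII Γ w w') :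
    CanStart Γ v w ↔ CanStart Γ v w' := ⟨h.canStart v, h.symm.canStart v⟩

theorem EquivII.isReducedWord {w w' : List V} (h : EquivII Γ w w') :
    IsReducedWord Γ w → IsReducedWord Γ w' := by
  induction h with
  | refl w => exact id
  | swap a b w hab =>
    simp only [isReducedWord_cons, CanStart]
    have := hab.symm
    have := hab.ne
    have := hab.ne.symm
    tauto
  | cons a h ih =>
    simp only [isReducedWord_cons, h.canStart_iff]
    tauto
  | trans _ _ ih₁ ih₂ => exact ih₂ ∘ ih₁

theorem EquivII.append_right {w w' : List V} (h : EquivII Γ w w') (z : List V) :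
    EquivII Γ (w ++ z) (w' ++ z) := by
  induction h with
  | refl w => exact .refl _
  | swap a b w h => exact .swap _ _ _ h
  | cons a _ ih => exact .cons _ ih
  | trans _ _ ih₁ ih₂ => exact .trans ih₁ ih₂

theorem EquivII.append_left {w w' : List V} (h : EquivII Γ w w') (z : List V) :
    EquivII Γ (z ++ w) (z ++ w') := by
  induction z with
  | nil => exact h
  | cons a z ih => exact .cons a ih

theorem EquivII.append {w w' z z' : List V} (h : EquivII Γ w w') (h' : EquivII Γ z z') :
    EquivII Γ (w ++ z) (w' ++ z') := (h.append_right z).trans (h'.append_left w')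

theorem CanStart.exists_cons {v : V} : ∀ {w : List V}, CanStart Γ v w →
    ∃ w', EquivII Γ w (v :: w')
  | a :: w, Or.inl h => ⟨w, h ▸ .refl _⟩
  | a :: w, Or.inr ⟨h1, h2⟩ => by
    obtain ⟨w', h⟩ := h2.exists_cons
    exact ⟨a :: w', (h.cons a).trans (.swap _ _ _ h1.symm)⟩

variable (Γ) in
/-- The reduced words that cannot start with a letter of `S`. -/
def IsFree (S : Set V) (z : List V) : Prop := IsReducedWord Γ z ∧ ∀ s ∈ S, ¬ CanStart Γ s z

theorem IsFree.nil (S : Set V) : IsFree Γ S [] := ⟨.nil, fun _ _ h => h⟩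

/-- A letter that starts `x ++ z` either starts `x` or passes through `x` and starts `z`. The second
is impossible for letters of `S`, so reducedness is only tested inside `x`. -/
theorem IsFree.append {S : Set V} {x z : List V} (hz : IsFree Γ S z) (hx : IsReducedWord Γ x)
    (hxS : ∀ a ∈ x, a ∈ S) : IsReducedWord Γ (x ++ z) := by
  induction x with
  | nil => exact hz.1
  | cons a x ih =>
    rw [List.cons_append, isReducedWord_cons, canStart_append]
    rw [isReducedWord_cons] at hx
    refine ⟨ih hx.1 fun b hb => hxS b (by simp [hb]), ?_⟩
    rintro (h | ⟨-, h⟩)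
    · exact hx.2 h
    · exact hz.2 a (hxS a (by simp)) h

/-- Uniqueness of the factorisation. The first letter `a ∈ S` of `x` can start `y ++ z'`; as `z'`
cannot start in `S`, it must start `y`, where it can be moved to the front and cancelled. -/
theorem IsFree.equivII_append {S : Set V} {x y z z' : List V} (hz : IsFree Γ S z)
    (hz' : IsFree Γ S z') (hxS : ∀ a ∈ x, a ∈ S) (hyS : ∀ a ∈ y, a ∈ S)
    (h : EquivII Γ (x ++ z) (y ++ z')) : EquivII Γ x y ∧ EquivII Γ z z' := by
  induction x generalizing y with
  | nil =>
    cases y with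
    | nil => exact ⟨.refl _, h⟩
    | cons b y => exact absurd (h.symm.canStart b (Or.inl rfl)) (hz.2 b (hyS b (by simp)))
  | cons a x ih =>
    have haS := hxS a (by simp)
    rcases canStart_append.mp (h.canStart a (Or.inl rfl)) with h1 | ⟨-, h1⟩
    · obtain ⟨y', hy'⟩ := h1.exists_cons
      have h2 := (h.trans (hy'.append_right z')).of_cons
      have := ih (fun b hb => hxS b (by simp [hb]))
        (fun b hb => hyS b (hy'.perm.mem_iff.mpr (by simp [hb]))) h2
      exact ⟨(this.1.cons a).trans hy'.symm, this.2⟩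
    · exact absurd h1 (hz'.2 a haS)

variable (Γ) in
/-- The word is type II equivalent to one that ends with `v`. -/
def CanEnd (v : V) : List V → Prop
  | [] => False
  | a :: w => CanEnd v w ∨ (a = v ∧ ∀ x ∈ w, Γ.Adj v x)

theorem EquivII.canEnd (v : V) {w w' : List V} (h : EquivII Γ w w') :
    CanEnd Γ v w → CanEnd Γ v w' := by
  induction h with
  | refl w => exact id
  | swap a b w h =>
    simp only [CanEnd, List.forall_mem_cons]
    rintro ((h1 | ⟨rfl, h1⟩) | ⟨rfl, h1, h2⟩)
    · exact Or.inl (Or.inl h1)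
    · exact Or.inr ⟨rfl, h.symm, h1⟩
    · exact Or.inl (Or.inr ⟨rfl, h2⟩)
  | cons a h ih =>
    refine Or.imp ih (And.imp_right fun h' x hx => h' x (h.perm.mem_iff.mpr hx))
  | trans _ _ ih₁ ih₂ => exact ih₂ ∘ ih₁

theorem canEnd_of_ne_nil : ∀ {w : List V}, w ≠ [] → ∃ v ∈ w, CanEnd Γ v w
  | [a], _ => ⟨a, by simp, Or.inr ⟨rfl, by simp⟩⟩
  | a :: b :: w, _ => by
    obtain ⟨v, hv, h⟩ := canEnd_of_ne_nil (w := b :: w) (by simp)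
    exact ⟨v, List.mem_cons_of_mem _ hv, Or.inl h⟩

/-- The only new obstruction is a letter `a` of `u` that commutes past the rest of `u` and starts
`z`. It would then belong to `S` and be able to end `u`. -/
theorem isReducedWord_append_of_not_canEnd {S : Set V} {u z : List V} (hu : IsReducedWord Γ u)
    (huS : ∀ s ∈ S, ¬ CanEnd Γ s u) (hz : IsReducedWord Γ z) (hzS : ∀ a ∈ z, a ∈ S) :
    IsReducedWord Γ (u ++ z) := by
  induction u with
  | nil => exact hz
  | cons a u ih =>
    rw [isReducedWord_cons] at hu
    rw [List.cons_append, isReducedWord_cons, canStart_append]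
    refine ⟨ih hu.1 fun s hs h => huS s hs (Or.inl h), ?_⟩
    rintro (h | ⟨h1, h2⟩)
    · exact hu.2 h
    · exact huS a (hzS a (canStart_mem h2)) (Or.inr ⟨rfl, h1⟩)

/-! Words of decorated letters -/

/-- A sequence of letters can be permuted along a type II equivalence of the vertices. -/
theorem EquivII.exists_lift {L : Type*} (f : L → V) {u w : List V} (h : EquivII Γ u w) :
    ∀ x : List L, x.map f = u → ∃ y : List L, y.map f = w ∧ EquivII (Γ.comap f) x y := by
  induction h with
  | refl w => exact fun x hx => ⟨x, hx, .refl _⟩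
  | swap a b w h =>
    intro x hx
    obtain ⟨p, x, rfl, rfl, hx'⟩ := List.map_eq_cons_iff.mp hx
    obtain ⟨q, x, rfl, rfl, rfl⟩ := List.map_eq_cons_iff.mp hx'
    exact ⟨q :: p :: x, rfl, .swap _ _ _ h⟩
  | cons a _ ih =>
    intro x hx
    obtain ⟨p, x, rfl, rfl, hx'⟩ := List.map_eq_cons_iff.mp hx
    obtain ⟨y, rfl, h⟩ := ih x hx'
    exact ⟨p :: y, rfl, h.cons p⟩
  | trans _ _ ih₁ ih₂ =>
    intro x hx
    obtain ⟨y, hy, h⟩ := ih₁ x hx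
    obtain ⟨z, hz, h'⟩ := ih₂ y hy
    exact ⟨z, hz, h.trans h'⟩

theorem EquivII.map_comap {L : Type*} {f : L → V} {x y : List L}
    (h : EquivII (Γ.comap f) x y) : EquivII Γ (x.map f) (y.map f) := by
  induction h with
  | refl w => exact .refl _
  | swap a b w h => exact .swap _ _ _ h
  | cons a _ ih => exact .cons _ ih
  | trans _ _ ih₁ ih₂ => exact .trans ih₁ ih₂

theorem exists_cons_of_canStart {L : Type*} {f : L → V} {v : V} {x : List L}
    (h : CanStart Γ v (x.map f)) : ∃ p y, f p = v ∧ EquivII (Γ.comap f) x (p :: y) := by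
  obtain ⟨w, hw⟩ := h.exists_cons
  obtain ⟨y, hy, h⟩ := hw.exists_lift f x rfl
  obtain ⟨p, y, rfl, hp, -⟩ := List.map_eq_cons_iff.mp hy
  exact ⟨p, y, hp, h⟩

/-- Every reduced word splits into a word in `S` and a word that cannot start in `S`. -/
theorem exists_factor {L : Type*} (f : L → V) (S : Set V) (x : List L)
    (hx : IsReducedWord Γ (x.map f)) :
    ∃ y z, EquivII (Γ.comap f) x (y ++ z) ∧ (∀ p ∈ y, f p ∈ S) ∧ IsFree Γ S (z.map f) := by
  induction n : x.length generalizing x with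
  | zero =>
    obtain rfl := List.length_eq_zero_iff.mp n
    exact ⟨[], [], .refl _, by simp, .nil S⟩
  | succ n ih =>
    -- Letters of `S` are pulled to the front one at a time until none can start the remaining word.
    by_cases h : ∀ s ∈ S, ¬ CanStart Γ s (x.map f)
    · exact ⟨[], x, .refl _, by simp, hx, h⟩
    · push Not at h
      obtain ⟨s, hs, h⟩ := h
      obtain ⟨p, x', rfl, hx'⟩ := exists_cons_of_canStart h
      have hr := (hx'.map_comap).isReducedWord hx
      obtain ⟨y, z, h1, h2, h3⟩ := ih x' (IsReducedWord.tail hr) (by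
        have := hx'.perm.length_eq
        simp only [List.length_cons] at this
        omega)
      exact ⟨p :: y, z, hx'.trans (h1.cons p), by simpa [hs] using h2, h3⟩

end Words

end GraphProduct

namespace GraphProduct

/-! ### Elementary tensors -/

section Elem

variable {V : Type*} {H : V → Type*} [∀ v, NormedAddCommGroup (H v)]
  [∀ v, InnerProductSpace ℂ (H v)] {Γ : SimpleGraph V} {ξ : ∀ v, H v}

/-- Type II equivalence of elementary tensors. -/
abbrev LetterEquiv (Γ : SimpleGraph V) (x y : List (Letter ξ)) : Prop :=
  EquivII (Γ.comap Sigma.fst) x y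

theorem verts_append (x y : List (Letter ξ)) : verts (x ++ y) = verts x ++ verts y :=
  List.map_append

theorem LetterEquiv.verts {x y : List (Letter ξ)} (h : LetterEquiv Γ x y) :
    EquivII Γ (verts x) (verts y) := EquivII.map_comap h

theorem colour_append (v : V) (x y : List (Letter ξ)) :
    colour v (x ++ y) = colour v x ++ colour v y := List.filterMap_append

/-- Exchanged letters sit at adjacent, hence distinct, vertices, so the order of the letters of one
colour never changes. -/
theorem LetterEquiv.colour {x y : List (Letter ξ)} (h : LetterEquiv Γ x y) (v : V) :
    colour v x = colour v y := by
  unfold LetterEquiv at h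
  induction h with
  | refl w => rfl
  | swap p q w hab =>
    obtain ⟨a, η⟩ := p
    obtain ⟨b, ζ⟩ := q
    have hne : a ≠ b := SimpleGraph.ne_of_adj Γ hab
    by_cases ha : a = v
    · subst ha
      rw [colour_cons_self, colour_cons_ne hne.symm, colour_cons_ne hne.symm, colour_cons_self]
    · rw [colour_cons_ne ha]
      by_cases hb : b = v
      · subst hb
        rw [colour_cons_self, colour_cons_self, colour_cons_ne ha]
      · rw [colour_cons_ne hb, colour_cons_ne hb, colour_cons_ne ha]
  | cons p _ ih =>
    obtain ⟨a, η⟩ := p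
    by_cases ha : a = v
    · subst ha; rw [colour_cons_self, colour_cons_self, ih]
    · rw [colour_cons_ne ha, colour_cons_ne ha, ih]
  | trans _ _ ih₁ ih₂ => exact ih₁.trans ih₂

theorem length_colour [DecidableEq V] (v : V) (x : List (Letter ξ)) :
    (colour v x).length = (verts x).count v := by
  induction x with
  | nil => rfl
  | cons p x ih =>
    obtain ⟨a, η⟩ := p
    by_cases ha : a = v
    · subst ha
      rw [colour_cons_self, List.length_cons, ih]
      exact (List.count_cons_self).symm
    · rw [colour_cons_ne ha, ih]
      exact (List.count_cons_of_ne ha).symm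

theorem LetterEquiv.elemInner_right {y y' : List (Letter ξ)} (h : LetterEquiv Γ y y')
    (x : List (Letter ξ)) : elemInner Γ x y = elemInner Γ x y' := by
  have e : EquivII Γ (GraphProduct.verts x) (GraphProduct.verts y) ↔
      EquivII Γ (GraphProduct.verts x) (GraphProduct.verts y') :=
    ⟨fun h' => h'.trans h.verts, fun h' => h'.trans h.verts.symm⟩
  simp only [elemInner, matched, letter, h.colour]
  classical
  exact if_congr e rfl rfl

/-- The inner product of products of tensors along words that multiply freely. -/
theorem elemInner_append {S : Set V} {x y z z' : List (Letter ξ)}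
    (hx : ∀ p ∈ x, p.1 ∈ S) (hy : ∀ p ∈ y, p.1 ∈ S) (hz : IsFree Γ S (verts z))
    (hz' : IsFree Γ S (verts z')) :
    elemInner Γ (x ++ z) (y ++ z') = elemInner Γ x y * elemInner Γ z z' := by
  classical
  have hx' : ∀ a ∈ verts x, a ∈ S := by simpa [verts] using fun a b h => hx ⟨a, b⟩ h
  have hy' : ∀ a ∈ verts y, a ∈ S := by simpa [verts] using fun a b h => hy ⟨a, b⟩ h
  unfold elemInner
  rw [verts_append, verts_append]
  by_cases h : EquivII Γ (verts x) (verts y)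
  · by_cases h' : EquivII Γ (verts z) (verts z')
    · rw [if_pos h, if_pos h', if_pos (h.append h')]
      have hs : (verts x).toFinset ⊆ (verts x ++ verts z).toFinset := by
        intro a ha; simp at ha ⊢; exact Or.inl ha
      have hs' : (verts z).toFinset ⊆ (verts x ++ verts z).toFinset := by
        intro a ha; simp at ha ⊢; exact Or.inr ha
      rw [matched_subset subset_rfl, matched_subset hs, matched_subset hs',
        ← Finset.prod_mul_distrib]
      refine Finset.prod_congr rfl fun v _ => ?_
      -- Among the letters of colour `v`, those with index below the count of `v` in `x` come from
      -- `x` and `y`, the others from `z` and `z'`. The cut is at the same index on both sides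
      -- because `x` and `y` contain `v` equally often.
      rw [List.count_append, Finset.prod_range_add]
      have l1 := length_colour v x
      have l2 : (colour v y).length = (verts x).count v := by
        rw [length_colour, h.perm.count_eq]
      congr 1
      · refine Finset.prod_congr rfl fun k hk => ?_
        have hk := Finset.mem_range.mp hk
        simp only [letter, colour_append]
        rw [List.getD_append _ _ _ _ (by omega), List.getD_append _ _ _ _ (by omega)]
      · refine Finset.prod_congr rfl fun k hk => ?_
        simp only [letter, colour_append]
        rw [List.getD_append_right _ _ _ _ (by omega), List.getD_append_right _ _ _ _ (by omega),
          l1, l2, Nat.add_sub_cancel_left]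
    · rw [if_neg h', mul_zero, if_neg fun e => h' (hz.equivII_append hz' hx' hy' e).2]
  · rw [if_neg h, zero_mul, if_neg fun e => h (hz.equivII_append hz' hx' hy' e).1]

theorem dense_span_elem :
    Dense (Submodule.span ℂ (Set.range fun x : RedTensor Γ ξ => elem Γ x.1 x.2) :
      Set (GraphHilbert Γ ξ)) := (graphKernel Γ ξ).dense_span_vec

theorem LetterEquiv.elem_eq {x y : List (Letter ξ)} (h : LetterEquiv Γ x y)
    (hx : IsReducedWord Γ (GraphProduct.verts x)) (hy : IsReducedWord Γ (GraphProduct.verts y)) :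
    elem Γ x hx = elem Γ y hy :=
  eq_of_inner_total dense_span_elem fun z => by
    rw [inner_elem, inner_elem, h.elemInner_right]

/-- The space is presented only by inner products of generators, so linearity in a letter is not
built in: the difference of the two sides has norm zero. -/
theorem elem_cons_add {v : V} (a b : (ℂ ∙ ξ v)ᗮ) {x : List (Letter ξ)}
    (hx : IsReducedWord Γ (v :: verts x)) :
    elem Γ (⟨v, a + b⟩ :: x) (hx.cons_letter _) =
      elem Γ (⟨v, a⟩ :: x) (hx.cons_letter _) + elem Γ (⟨v, b⟩ :: x) (hx.cons_letter _) := by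
  rw [← sub_eq_zero, ← inner_self_eq_zero (𝕜 := ℂ)]
  simp only [inner_sub_left, inner_sub_right, inner_add_left, inner_add_right, inner_elem,
    elemInner_cons]
  ring

theorem elem_cons_smul {v : V} (c : ℂ) (a : (ℂ ∙ ξ v)ᗮ) {x : List (Letter ξ)}
    (hx : IsReducedWord Γ (v :: verts x)) :
    elem Γ (⟨v, c • a⟩ :: x) (hx.cons_letter _) =
      c • elem Γ (⟨v, a⟩ :: x) (hx.cons_letter _) := by
  rw [← sub_eq_zero, ← inner_self_eq_zero (𝕜 := ℂ)]
  simp only [inner_sub_left, inner_sub_right, inner_smul_left, inner_smul_right, inner_elem,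
    elemInner_cons]
  ring

theorem elem_cons_zero {v : V} {x : List (Letter ξ)} (hx : IsReducedWord Γ (v :: verts x)) :
    elem Γ (⟨v, (0 : (ℂ ∙ ξ v)ᗮ)⟩ :: x) (hx.cons_letter _) = 0 := by
  simpa using elem_cons_smul (0 : ℂ) (0 : (ℂ ∙ ξ v)ᗮ) hx

theorem norm_elem_cons {v : V} (a : (ℂ ∙ ξ v)ᗮ) {x : List (Letter ξ)}
    (hx : IsReducedWord Γ (v :: verts x)) :
    ‖elem Γ (⟨v, a⟩ :: x) (hx.cons_letter _)‖ = ‖elem Γ x hx.tail‖ * ‖a‖ := by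
  have h : ⟪elem Γ (⟨v, a⟩ :: x) (hx.cons_letter _), elem Γ (⟨v, a⟩ :: x) (hx.cons_letter _)⟫_ℂ =
      ⟪a, a⟫_ℂ * ⟪elem Γ x hx.tail, elem Γ x hx.tail⟫_ℂ := by
    rw [inner_elem, inner_elem, elemInner_cons]
  simp only [inner_self_eq_norm_sq_to_K] at h
  have hsq : ‖elem Γ (⟨v, a⟩ :: x) (hx.cons_letter _)‖ ^ 2 = (‖elem Γ x hx.tail‖ * ‖a‖) ^ 2 := by
    have : ‖elem Γ (⟨v, a⟩ :: x) (hx.cons_letter _)‖ ^ 2 = ‖a‖ ^ 2 * ‖elem Γ x hx.tail‖ ^ 2 := by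
      exact_mod_cast h
    rw [this]; ring
  exact (sq_eq_sq₀ (norm_nonneg _) (by positivity)).mp hsq

/-- The map `a ↦ a ⊗ x`. -/
noncomputable def consMap {v : V} {x : List (Letter ξ)} (hx : IsReducedWord Γ (v :: verts x)) :
    (ℂ ∙ ξ v)ᗮ →L[ℂ] GraphHilbert Γ ξ :=
  LinearMap.mkContinuous
    { toFun := fun a => elem Γ (⟨v, a⟩ :: x) (hx.cons_letter _)
      map_add' := fun a b => elem_cons_add a b hx
      map_smul' := fun c a => elem_cons_smul c a hx }
    ‖elem Γ x hx.tail‖ fun a => (norm_elem_cons a hx).le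

/-- The vector `U_v (η ⊗ x)`. -/
noncomputable def frontVec {v : V} (η : H v) {x : List (Letter ξ)}
    (hx : IsReducedWord Γ (v :: verts x)) : GraphHilbert Γ ξ :=
  elem Γ (⟨v, (ℂ ∙ ξ v)ᗮ.orthogonalProjectionOnto η⟩ :: x) (hx.cons_letter _) +
    ⟪ξ v, η⟫_ℂ • elem Γ x hx.tail

theorem frontVec_coe {v : V} (a : (ℂ ∙ ξ v)ᗮ) {x : List (Letter ξ)}
    (hx : IsReducedWord Γ (v :: verts x)) :
    frontVec (a : H v) hx = elem Γ (⟨v, a⟩ :: x) (hx.cons_letter _) := by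
  rw [frontVec, Submodule.mem_orthogonal_singleton_iff_inner_right.mp a.2, zero_smul, add_zero]
  congr 3
  simp

theorem frontVec_vacuum (hξ : ∀ v, ‖ξ v‖ = 1) {v : V} {x : List (Letter ξ)}
    (hx : IsReducedWord Γ (v :: verts x)) : frontVec (ξ v) hx = elem Γ x hx.tail := by
  have h : (ℂ ∙ ξ v)ᗮ.orthogonalProjectionOnto (ξ v) = 0 :=
    Submodule.orthogonalProjectionOnto_apply_of_mem_orthogonal
      (Submodule.le_orthogonal_orthogonal _ (Submodule.mem_span_singleton_self _))
  rw [frontVec, h, elem_cons_zero hx, inner_self_eq_norm_sq_to_K, hξ]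
  simp

/-- A vector `U_v (η ⊗ x)` is the elementary tensor of every reduced word. -/
theorem exists_frontVec (hξ : ∀ v, ‖ξ v‖ = 1) (v : V) (x : List (Letter ξ))
    (hx : IsReducedWord Γ (verts x)) :
    ∃ (η : H v) (y : List (Letter ξ)) (hy : IsReducedWord Γ (v :: verts y)),
      elem Γ x hx = frontVec η hy := by
  -- If `v` can start the word, its letter is moved to the front and serves as `η`; otherwise `η` is
  -- the cyclic vector `ξ_v`.
  by_cases h : CanStart Γ v (verts x)
  · obtain ⟨⟨_, a⟩, y, rfl, hy⟩ := exists_cons_of_canStart h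
    have hr : IsReducedWord Γ (_ :: verts y) := (LetterEquiv.verts hy).isReducedWord hx
    exact ⟨a, y, hr, (LetterEquiv.elem_eq hy hx hr).trans (frontVec_coe a hr).symm⟩
  · exact ⟨ξ v, x, isReducedWord_cons.mpr ⟨hx, h⟩, by rw [frontVec_vacuum hξ]⟩

theorem dense_span_frontVec (hξ : ∀ v, ‖ξ v‖ = 1) (v : V) :
    Dense (Submodule.span ℂ (Set.range fun p : FrontTensor Γ ξ v => frontVec p.1 p.2.2) :
      Set (GraphHilbert Γ ξ)) := by
  refine dense_span_elem.mono (Submodule.span_mono ?_)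
  rintro _ ⟨x, rfl⟩
  obtain ⟨η, y, hy, h⟩ := exists_frontVec hξ v x.1 x.2
  exact ⟨(η, ⟨y, hy⟩), h.symm⟩

theorem inner_frontVec (hξ : ∀ v, ‖ξ v‖ = 1) (v : V) (p q : FrontTensor Γ ξ v) :
    ⟪frontVec p.1 p.2.2, frontVec q.1 q.2.2⟫_ℂ = (frontKernel Γ ξ v).ker p q := by
  simp only [frontVec, inner_add_left, inner_add_right, inner_smul_left, inner_smul_right,
    inner_elem, elemInner_cons, elemInner_cons_left_eq_zero _ q.2.2,
    elemInner_cons_right_eq_zero _ p.2.2, mul_zero, add_zero, zero_add]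
  refine Eq.trans ?_ (congrArg (· * elemInner Γ p.2.1 q.2.1) (inner_decomp (hξ v) p.1 q.1))
  simp only [Complex.star_def]
  ring

end Elem

/-! ### The vertex representations on elementary tensors -/

section Rep

variable {V : Type*} {H : V → Type*} [∀ v, NormedAddCommGroup (H v)]
  [∀ v, InnerProductSpace ℂ (H v)] [∀ v, CompleteSpace (H v)] {Γ : SimpleGraph V} {ξ : ∀ v, H v}

variable (Γ) in
/-- The representation `λ_v` of `B(H_v)`. -/
noncomputable def graphRepHom (hξ : ∀ v, ‖ξ v‖ = 1) (v : V) :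
    (H v →L[ℂ] H v) →⋆ₐ[ℂ] (GraphHilbert Γ ξ →L[ℂ] GraphHilbert Γ ξ) :=
  (frontAction Γ ξ v).transport (fun p => frontVec p.1 p.2.2) (inner_frontVec hξ v)
    (dense_span_frontVec hξ v)

/-- `frontMap` sends the generator `η ⊗ x` to `frontVec η hx` by definition, so `graphRep` is the
action `T ⊗ 1` transported along the total family `frontVec`. -/
theorem graphRep_frontVec (hξ : ∀ v, ‖ξ v‖ = 1) {v : V} (T : H v →L[ℂ] H v) (η : H v)
    {x : List (Letter ξ)} (hx : IsReducedWord Γ (v :: verts x)) :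
    graphRep Γ ξ hξ v T (frontVec η hx) = frontVec (T η) hx :=
  (frontAction Γ ξ v).transport_apply _ (inner_frontVec hξ v) (dense_span_frontVec hξ v) T
    (η, ⟨x, hx⟩)

theorem graphRep_elem (hξ : ∀ v, ‖ξ v‖ = 1) {v : V} (T : H v →L[ℂ] H v)
    {x : List (Letter ξ)} (hx : IsReducedWord Γ (v :: verts x)) :
    graphRep Γ ξ hξ v T (elem Γ x hx.tail) = frontVec (T (ξ v)) hx := by
  rw [← frontVec_vacuum hξ hx, graphRep_frontVec]

end Rep

end GraphProduct

namespace GraphProduct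

/-! ### The action of the operators of a subgraph -/

section SubWords

variable {V : Type*} {Γ : SimpleGraph V} {S : Set V}

theorem canStart_map_val {s : S} {w : List S} :
    CanStart Γ s.1 (w.map Subtype.val) ↔ CanStart (Γ.induce S) s w := by
  induction w with
  | nil => exact Iff.rfl
  | cons a w ih =>
    simp only [List.map_cons, CanStart, ih, SimpleGraph.comap_adj, Function.Embedding.subtype_apply,
      Subtype.ext_iff]

theorem isReducedWord_map_val {w : List S} :
    IsReducedWord Γ (w.map Subtype.val) ↔ IsReducedWord (Γ.induce S) w := by
  induction w with
  | nil => exact ⟨fun _ => .nil, fun _ => .nil⟩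
  | cons a w ih => rw [List.map_cons, isReducedWord_cons, isReducedWord_cons, ih, canStart_map_val]

end SubWords

section Sub

variable {V : Type*} {H : V → Type*} [∀ v, NormedAddCommGroup (H v)]
  [∀ v, InnerProductSpace ℂ (H v)] {Γ : SimpleGraph V} {ξ : ∀ v, H v} {S : Set V}

theorem fst_mem_of_mem_ofSub {x : List (Letter fun v : S => ξ v)} :
    ∀ p ∈ x.map (Letter.ofSub (ξ := ξ)), p.1 ∈ S := by
  intro p hp
  obtain ⟨q, -, rfl⟩ := List.mem_map.mp hp
  exact q.1.2

theorem exists_ofSub {x : List (Letter ξ)} (hx : ∀ p ∈ x, p.1 ∈ S) :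
    ∃ y : List (Letter fun v : S => ξ v), y.map Letter.ofSub = x := by
  induction x with
  | nil => exact ⟨[], rfl⟩
  | cons p x ih =>
    obtain ⟨y, rfl⟩ := ih fun q hq => hx q (by simp [hq])
    exact ⟨⟨⟨p.1, hx p (by simp)⟩, p.2⟩ :: y, rfl⟩

theorem isReducedWord_ofSub {x : List (Letter fun v : S => ξ v)} :
    IsReducedWord Γ (verts (x.map (Letter.ofSub (ξ := ξ)))) ↔
      IsReducedWord (Γ.induce S) (verts x) := by
  rw [verts_ofSub, isReducedWord_map_val]

variable (Γ ξ S) in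
/-- Elementary tensors along words that cannot start in `S`. -/
abbrev FreeTensor := {z : List (Letter ξ) // IsFree Γ S (verts z)}

theorem FreeTensor.isReducedWord (z : FreeTensor Γ ξ S) {x : List (Letter fun v : S => ξ v)}
    (hx : IsReducedWord (Γ.induce S) (verts x)) :
    IsReducedWord Γ (verts (x.map Letter.ofSub ++ z.1)) := by
  rw [verts_append]
  refine z.2.append (isReducedWord_ofSub.mpr hx) ?_
  intro a ha
  obtain ⟨p, hp, rfl⟩ := List.mem_map.mp ha
  exact fst_mem_of_mem_ofSub p hp

theorem FreeTensor.isReducedWord_cons (z : FreeTensor Γ ξ S) {w : S}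
    {x : List (Letter fun v : S => ξ v)} (hx : IsReducedWord (Γ.induce S) (w :: verts x)) :
    IsReducedWord Γ (w.1 :: verts (x.map Letter.ofSub ++ z.1)) :=
  z.isReducedWord (x := ⟨w, 0⟩ :: x) hx

theorem FreeTensor.inner (z z' : FreeTensor Γ ξ S) {x y : List (Letter fun v : S => ξ v)}
    (hx : IsReducedWord Γ (verts (x.map Letter.ofSub ++ z.1)))
    (hy : IsReducedWord Γ (verts (y.map Letter.ofSub ++ z'.1))) :
    ⟪elem Γ _ hx, elem Γ _ hy⟫_ℂ = elemInner (Γ.induce S) x y * elemInner Γ z.1 z'.1 := by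
  rw [inner_elem, elemInner_append fst_mem_of_mem_ofSub fst_mem_of_mem_ofSub z.2 z'.2,
    elemInner_ofSub]

/-- The inner product of `x ⊗ z` and `y ⊗ z` factors, so tensoring with `z` multiplies every norm by
exactly `‖z‖`. -/
theorem FreeTensor.preLift_le (z : FreeTensor Γ ξ S)
    (g : (graphKernel (Γ.induce S) fun v : S => ξ v).Pre) :
    ‖(graphKernel (Γ.induce S) fun v : S => ξ v).preLift
      (fun x => elem Γ _ (z.isReducedWord x.2)) g‖ ≤ ‖elem Γ z.1 z.2.1‖ * ‖g‖ := by
  let k := graphKernel (Γ.induce S) fun v : S => ξ v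
  have h : ⟪k.preLift (fun x => elem Γ _ (z.isReducedWord x.2)) g,
      k.preLift (fun x => elem Γ _ (z.isReducedWord x.2)) g⟫_ℂ =
      ⟪elem Γ z.1 z.2.1, elem Γ z.1 z.2.1⟫_ℂ * ⟪g, g⟫_ℂ := by
    rw [PosKernel.inner_preLift, PosKernel.inner_def, inner_elem]
    simp only [FreeTensor.inner, PosKernel.form, Finsupp.mul_sum]
    refine Finsupp.sum_congr fun x _ => Finsupp.sum_congr fun y _ => ?_
    change _ = _ * (_ * elemInner (Γ.induce S) x.1 y.1 * _)
    ring
  simp only [inner_self_eq_norm_sq_to_K] at h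
  have hsq : ‖k.preLift (fun x => elem Γ _ (z.isReducedWord x.2)) g‖ ^ 2 =
      (‖elem Γ z.1 z.2.1‖ * ‖g‖) ^ 2 := by
    rw [mul_pow]; exact_mod_cast h
  exact ((sq_eq_sq₀ (norm_nonneg _) (by positivity)).mp hsq).le

/-- The map `x ↦ x ⊗ z` of the graph product Hilbert space of the subgraph on `S`, where `z` is an
elementary tensor along a word that cannot start in `S`. -/
noncomputable def rightMap (z : FreeTensor Γ ξ S) :
    GraphHilbert (Γ.induce S) (fun v : S => ξ v) →L[ℂ] GraphHilbert Γ ξ :=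
  (graphKernel (Γ.induce S) fun v : S => ξ v).liftBdd
    (fun x => elem Γ _ (z.isReducedWord x.2)) ‖elem Γ z.1 z.2.1‖ z.preLift_le

theorem rightMap_elem (z : FreeTensor Γ ξ S) {x : List (Letter fun v : S => ξ v)}
    (hx : IsReducedWord (Γ.induce S) (verts x)) :
    rightMap z (elem (Γ.induce S) x hx) = elem Γ (x.map Letter.ofSub ++ z.1) (z.isReducedWord hx) :=
  (graphKernel (Γ.induce S) fun v : S => ξ v).liftBdd_vec _ _ _ ⟨x, hx⟩

/-- On elementary tensors the adjoint of `rightMap z` composed with `rightMap z'` is a scalar. This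
is the isometry half of `H_Γ = H_S ⊗ H(S)`; the other half is `dense_span_rightMap`. -/
theorem inner_rightMap (z z' : FreeTensor Γ ξ S)
    (h h' : GraphHilbert (Γ.induce S) (fun v : S => ξ v)) :
    ⟪rightMap z h, rightMap z' h'⟫_ℂ = ⟪h, h'⟫_ℂ * elemInner Γ z.1 z'.1 := by
  have : (rightMap z).adjoint ∘L rightMap z' =
      elemInner Γ z.1 z'.1 • ContinuousLinearMap.id ℂ _ := by
    refine clm_ext_total dense_span_elem fun y => eq_of_inner_total dense_span_elem fun x => ?_
    rw [ContinuousLinearMap.comp_apply, ContinuousLinearMap.adjoint_inner_right, rightMap_elem,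
      rightMap_elem, FreeTensor.inner]
    simp [inner_elem, mul_comm]
  rw [← ContinuousLinearMap.adjoint_inner_right, ← ContinuousLinearMap.comp_apply, this]
  simp [inner_smul_right, mul_comm]

theorem rightMap_frontVec (z : FreeTensor Γ ξ S) {w : S} (η : H w)
    {x : List (Letter fun v : S => ξ v)} (hx : IsReducedWord (Γ.induce S) (w :: verts x)) :
    rightMap z (frontVec (H := fun v : S => H v) (ξ := fun v : S => ξ v) (v := w) η hx) =
      frontVec (v := w.1) η (x := x.map Letter.ofSub ++ z.1)
        (z.isReducedWord_cons hx) := by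
  rw [frontVec, map_add, map_smul, rightMap_elem, rightMap_elem]
  rfl

theorem rightMap_nil_eq :
    rightMap (⟨[], .nil S⟩ : FreeTensor Γ ξ S) = subIsometry Γ ξ S := by
  refine clm_ext_total dense_span_elem fun x => ?_
  rw [rightMap_elem]
  refine Eq.trans ?_ ((graphKernel (Γ.induce S) fun v : S => ξ v).lift_vec _ _ x).symm
  congr 1
  simp

theorem subIsometry_elem {x : List (Letter fun v : S => ξ v)}
    (hx : IsReducedWord (Γ.induce S) (verts x)) :
    subIsometry Γ ξ S (elem (Γ.induce S) x hx) =
      elem Γ (x.map Letter.ofSub) (isReducedWord_ofSub.mpr hx) :=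
  (graphKernel (Γ.induce S) fun v : S => ξ v).lift_vec _ _ ⟨x, hx⟩

theorem adjoint_subIsometry_subIsometry (h : GraphHilbert (Γ.induce S) fun v : S => ξ v) :
    (subIsometry Γ ξ S).adjoint (subIsometry Γ ξ S h) = h := PosKernel.adjoint_lift_lift _ _ h

theorem inner_subIsometry (x y : GraphHilbert (Γ.induce S) fun v : S => ξ v) :
    ⟪subIsometry Γ ξ S x, subIsometry Γ ξ S y⟫_ℂ = ⟪x, y⟫_ℂ := PosKernel.inner_lift_lift _ _ x y

/-- Every elementary tensor along a reduced word splits off its part in `S`. -/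
theorem exists_rightMap (S : Set V) (x : List (Letter ξ)) (hx : IsReducedWord Γ (verts x)) :
    ∃ (y : List (Letter fun v : S => ξ v)) (hy : IsReducedWord (Γ.induce S) (verts y))
      (z : FreeTensor Γ ξ S), LetterEquiv Γ x (y.map Letter.ofSub ++ z.1) ∧
        elem Γ x hx = rightMap z (elem (Γ.induce S) y hy) := by
  obtain ⟨y, z, h, hy, hz⟩ := exists_factor Sigma.fst S x hx
  obtain ⟨y, rfl⟩ := exists_ofSub hy
  have hr : IsReducedWord Γ (verts (y.map Letter.ofSub ++ z)) :=
    (LetterEquiv.verts h).isReducedWord hx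
  have hy : IsReducedWord (Γ.induce S) (verts y) := by
    rw [← isReducedWord_ofSub (ξ := ξ)]
    intro v u m t e
    refine hr v u m (t ++ verts z) ?_
    rw [verts_append, e]
    simp
  refine ⟨y, hy, ⟨z, hz⟩, h, ?_⟩
  rw [rightMap_elem]
  exact LetterEquiv.elem_eq h _ _

theorem dense_span_rightMap (S : Set V) :
    Dense (Submodule.span ℂ (Set.range fun p : GraphHilbert (Γ.induce S) (fun v : S => ξ v) ×
      FreeTensor Γ ξ S => rightMap p.2 p.1) : Set (GraphHilbert Γ ξ)) := by
  refine dense_span_elem.mono (Submodule.span_mono ?_)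
  rintro _ ⟨x, rfl⟩
  obtain ⟨y, hy, z, -, h⟩ := exists_rightMap S x.1 x.2
  exact ⟨(_, z), h.symm⟩

variable (Γ ξ S) in
/-- The inner products of the generators `h ⊗ z` of `H_S ⊗ H(S)`. -/
noncomputable def ampKernel :
    PosKernel (GraphHilbert (Γ.induce S) (fun v : S => ξ v) × FreeTensor Γ ξ S) where
  ker p q := ⟪p.1, q.1⟫_ℂ * elemInner Γ p.2.1 q.2.1
  psd := by
    -- The kernel is the Gram kernel of the vectors `h ⊗ z`, already realised in `H_Γ`.
    simp only [← inner_rightMap]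
    exact posSemidef_inner fun p : GraphHilbert (Γ.induce S) (fun v : S => ξ v) ×
      FreeTensor Γ ξ S => rightMap p.2 p.1

variable (Γ ξ S) in
/-- `B(H_S)` acts on `H_S ⊗ H(S)` by `T ⊗ 1`. -/
noncomputable def ampAction : (ampKernel Γ ξ S).Action
    (GraphHilbert (Γ.induce S) (fun v : S => ξ v) →L[ℂ]
      GraphHilbert (Γ.induce S) fun v : S => ξ v) where
  act T p := (T p.1, p.2)
  adj T p q := by
    simp [ampKernel, ContinuousLinearMap.star_eq_adjoint, ContinuousLinearMap.adjoint_inner_right]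
  one p q := rfl
  mul S T p q := rfl
  add S T p q := by simp [ampKernel, add_mul]
  smul c T p q := by simp [ampKernel, mul_assoc]

variable (Γ ξ S) in
/-- The representation of `B(H_S)` on the graph product Hilbert space by `T ⊗ 1`. -/
noncomputable def ampHom :
    (GraphHilbert (Γ.induce S) (fun v : S => ξ v) →L[ℂ]
      GraphHilbert (Γ.induce S) fun v : S => ξ v) →⋆ₐ[ℂ] (GraphHilbert Γ ξ →L[ℂ] GraphHilbert Γ ξ) :=
  (ampAction Γ ξ S).transport (fun p => rightMap p.2 p.1)
    (fun p q => inner_rightMap p.2 q.2 p.1 q.1) (dense_span_rightMap S)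

theorem ampHom_rightMap (T : GraphHilbert (Γ.induce S) (fun v : S => ξ v) →L[ℂ]
      GraphHilbert (Γ.induce S) fun v : S => ξ v) (z : FreeTensor Γ ξ S)
    (h : GraphHilbert (Γ.induce S) fun v : S => ξ v) :
    ampHom Γ ξ S T (rightMap z h) = rightMap z (T h) :=
  (ampAction Γ ξ S).transport_apply _ (fun p q => inner_rightMap p.2 q.2 p.1 q.1)
    (dense_span_rightMap S) T (h, z)

variable [∀ v, CompleteSpace (H v)]

/-- Every elementary tensor can be written `η ⊗ y' ⊗ z`, by splitting off its part in `S` and then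
the front vector at `w` of that part. Both operators act there as `T` on `η`. -/
theorem ampHom_graphRep (hξ : ∀ v, ‖ξ v‖ = 1) (w : S) (T : H w →L[ℂ] H w) :
    ampHom Γ ξ S (graphRep (H := fun v : S => H v) (Γ.induce S) (fun v : S => ξ v)
      (fun v => hξ v) w T) = graphRep Γ ξ hξ w.1 T := by
  refine clm_ext_total dense_span_elem fun x => ?_
  obtain ⟨y, hy, z, -, e⟩ := exists_rightMap S x.1 x.2
  obtain ⟨η, y', hy', e'⟩ := exists_frontVec (H := fun v : S => H v) (fun v : S => hξ v) w y hy
  rw [e, ampHom_rightMap, e', rightMap_frontVec, graphRep_frontVec, rightMap_frontVec,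
    graphRep_frontVec]

/-- Operators of adjacent vertices commute. -/
theorem graphRep_commute (hξ : ∀ v, ‖ξ v‖ = 1) {v w : V} (hvw : Γ.Adj v w) (T : H v →L[ℂ] H v)
    (R : H w →L[ℂ] H w) : Commute (graphRep Γ ξ hξ v T) (graphRep Γ ξ hξ w R) := by
  have hcons : ∀ {z : List (Letter ξ)}, IsReducedWord Γ (v :: verts z) →
      IsReducedWord Γ (w :: verts z) → ∀ (a : (ℂ ∙ ξ v)ᗮ) (b : (ℂ ∙ ξ w)ᗮ),
      IsReducedWord Γ (v :: verts (⟨w, b⟩ :: z)) ∧ IsReducedWord Γ (w :: verts (⟨v, a⟩ :: z)) := by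
    intro z hv hw a b
    rw [isReducedWord_cons] at hv hw
    have := hvw.ne
    have := hvw.ne.symm
    change IsReducedWord Γ (v :: w :: verts z) ∧ IsReducedWord Γ (w :: v :: verts z)
    simp only [isReducedWord_cons, CanStart]
    tauto
  -- Both sides are `η ⊗ ζ ⊗ z` expanded into four terms, with the `v`-factor or the `w`-factor
  -- outermost; the zeros passed to `hcons` are placeholders for an irrelevant letter.
  have hswap : ∀ (η : H v) (ζ : H w) {z : List (Letter ξ)}
      (hv : IsReducedWord Γ (v :: verts z)) (hw : IsReducedWord Γ (w :: verts z)),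
      frontVec η (x := ⟨w, (ℂ ∙ ξ w)ᗮ.orthogonalProjectionOnto ζ⟩ :: z) (hcons hv hw 0 _).1 +
        ⟪ξ w, ζ⟫_ℂ • frontVec η hv =
      frontVec ζ (x := ⟨v, (ℂ ∙ ξ v)ᗮ.orthogonalProjectionOnto η⟩ :: z) (hcons hv hw _ 0).2 +
        ⟪ξ v, η⟫_ℂ • frontVec ζ hw := by
    intro η ζ z hv hw
    have := LetterEquiv.elem_eq (Γ := Γ)
      (x := ⟨v, (ℂ ∙ ξ v)ᗮ.orthogonalProjectionOnto η⟩ ::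
        ⟨w, (ℂ ∙ ξ w)ᗮ.orthogonalProjectionOnto ζ⟩ :: z)
      (y := ⟨w, (ℂ ∙ ξ w)ᗮ.orthogonalProjectionOnto ζ⟩ ::
        ⟨v, (ℂ ∙ ξ v)ᗮ.orthogonalProjectionOnto η⟩ :: z) (EquivII.swap _ _ _ hvw)
        ((hcons hv hw 0 _).1.cons_letter _) ((hcons hv hw _ 0).2.cons_letter _)
    simp only [frontVec, this, smul_add]
    rw [smul_comm]
    abel
  -- On `η ⊗ ζ ⊗ z` both products give `Tη ⊗ Rζ ⊗ z`: before each operator is applied, `hswap`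
  -- brings its factor to the front.
  have key : ∀ (η : H v) (ζ : H w) {z : List (Letter ξ)}
      (hv : IsReducedWord Γ (v :: verts z)) (hw : IsReducedWord Γ (w :: verts z)),
      (graphRep Γ ξ hξ v T * graphRep Γ ξ hξ w R)
        (frontVec ζ (x := ⟨v, (ℂ ∙ ξ v)ᗮ.orthogonalProjectionOnto η⟩ :: z) (hcons hv hw _ 0).2 +
          ⟪ξ v, η⟫_ℂ • frontVec ζ hw) =
      (graphRep Γ ξ hξ w R * graphRep Γ ξ hξ v T)
        (frontVec ζ (x := ⟨v, (ℂ ∙ ξ v)ᗮ.orthogonalProjectionOnto η⟩ :: z) (hcons hv hw _ 0).2 +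
          ⟪ξ v, η⟫_ℂ • frontVec ζ hw) := by
    intro η ζ z hv hw
    rw [mul_apply_eq_comp, mul_apply_eq_comp, map_add, map_smul, graphRep_frontVec,
      graphRep_frontVec, ← hswap η (R ζ) hv hw, ← hswap η ζ hv hw, map_add, map_smul,
      graphRep_frontVec, graphRep_frontVec, hswap (T η) (R ζ) hv hw, map_add, map_smul,
      graphRep_frontVec, graphRep_frontVec, hswap (T η) ζ hv hw, map_add, map_smul,
      graphRep_frontVec, graphRep_frontVec]
  refine clm_ext_total dense_span_elem fun x => ?_
  obtain ⟨ζ, y, hy, e⟩ := exists_frontVec hξ w x.1 x.2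
  rw [e]
  -- After the factor at `w` is split off, the remainder is `η ⊗ z`, with `η` a letter of colour `v`
  -- if `v` can start it and `η = ξ_v` otherwise. In both cases `key` applies.
  by_cases h : CanStart Γ v (verts y)
  · obtain ⟨⟨_, a⟩, z, rfl, hz⟩ := exists_cons_of_canStart h
    have hy' : IsReducedWord Γ (w :: _ :: verts z) :=
      ((LetterEquiv.verts hz).cons w).isReducedWord hy
    have hv : IsReducedWord Γ (_ :: verts z) := hy'.tail
    have hw : IsReducedWord Γ (w :: verts z) := by
      rw [isReducedWord_cons] at hy' ⊢
      refine ⟨hv.tail, fun h => hy'.2 (Or.inr ⟨hvw.symm, h⟩)⟩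
    have e2 := key a ζ hv hw
    have hp : (ℂ ∙ ξ _)ᗮ.orthogonalProjectionOnto (a : H _) = a := by simp
    rw [Submodule.mem_orthogonal_singleton_iff_inner_right.mp a.2, zero_smul, add_zero] at e2
    have e3 : frontVec ζ hy = frontVec ζ (x := ⟨_, (ℂ ∙ ξ _)ᗮ.orthogonalProjectionOnto a⟩ :: z)
        (hcons hv hw _ 0).2 := by
      simp only [frontVec, hp]
      congr 1
      · exact LetterEquiv.elem_eq (EquivII.cons _ hz) _ _
      · congr 1
        exact LetterEquiv.elem_eq hz _ _
    rw [e3]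
    exact e2
  · have hv : IsReducedWord Γ (v :: verts y) := isReducedWord_cons.mpr ⟨hy.tail, h⟩
    have e2 := key (ξ v) ζ hv hy
    rw [← hswap (ξ v) ζ hv hy, frontVec_vacuum hξ, frontVec_vacuum hξ] at e2
    exact e2

end Sub

end GraphProduct

/-! ### Positivity -/

section Positivity

/-- A selfadjoint element is positive if the cube of its negative part `n` vanishes. -/
theorem exists_negPart_cube {A : Type*} [CStarAlgebra A] [PartialOrder A]
    [StarOrderedRing A] {a : A} (ha : IsSelfAdjoint a) :
    ∃ n : A, 0 ≤ n ∧ n * a * n = -(n * n * n) ∧ (n * n * n = 0 → 0 ≤ a) := by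
  have hn : IsSelfAdjoint a⁻ := IsSelfAdjoint.of_nonneg (CFC.negPart_nonneg a)
  refine ⟨a⁻, CFC.negPart_nonneg a, ?_, fun h => ?_⟩
  -- With `n` the negative part, `n a = -n²`, because `n` annihilates the positive part.
  · have h := congrArg (a⁻ * ·) (CFC.posPart_sub_negPart a ha)
    simp only [mul_sub, CFC.negPart_mul_posPart, zero_sub] at h
    rw [← h, neg_mul]
  -- From `n³ = 0` follows `(n²)⋆ n² = n³ n = 0`, hence `n² = 0`, hence `n = 0`.
  · have h1 : a⁻ * a⁻ = 0 := by
      rw [← CStarRing.star_mul_self_eq_zero_iff, star_mul, hn.star_eq, ← mul_assoc, h, zero_mul]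
    have h2 : a⁻ = 0 := by
      rw [← CStarRing.star_mul_self_eq_zero_iff, hn.star_eq, h1]
    rw [← CFC.posPart_sub_negPart a ha, h2, sub_zero]
    exact CFC.posPart_nonneg a

/-- An injective `*`-homomorphism reflects positivity. -/
theorem nonneg_of_map_nonneg {A B : Type*} [CStarAlgebra A] [PartialOrder A] [StarOrderedRing A]
    [CStarAlgebra B] [PartialOrder B] [StarOrderedRing B] (f : A →⋆ₐ[ℂ] B)
    (hf : Function.Injective f) {a : A} (h : 0 ≤ f a) : 0 ≤ a := by
  have ha : IsSelfAdjoint a := hf (by rw [map_star]; exact (IsSelfAdjoint.of_nonneg h).star_eq)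
  obtain ⟨n, hn, h1, h2⟩ := exists_negPart_cube ha
  refine h2 (hf ?_)
  have hnsa := (IsSelfAdjoint.of_nonneg hn).map f
  rw [map_zero]
  -- `f(n a n) = -f(n³)` is positive because `f a` is, and `f(n³)` is positive because `n` is; so
  -- `f(n³) = 0`.
  refine le_antisymm ?_ ?_
  · have h3 : 0 ≤ f (n * a * n) := by
      rw [map_mul, map_mul]
      exact hnsa.conjugate_nonneg h
    rw [h1, map_neg] at h3
    exact neg_nonneg.mp h3
  · rw [map_mul, map_mul]
    exact hnsa.conjugate_nonneg (map_nonneg f hn)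

/-- A positive linear map `E : A → B` that is a bimodule map over `B` is completely positive. -/
theorem map_cstarMatrix_nonneg_of_bimodule {A B : Type*} [CStarAlgebra A] [PartialOrder A]
    [StarOrderedRing A] [CStarAlgebra B] [PartialOrder B] [StarOrderedRing B] (j : B →⋆ₐ[ℂ] A)
    (E : A →ₗ[ℂ] B) (hstar : ∀ a, E (star a) = star (E a)) (hpos : ∀ a, 0 ≤ E (star a * a))
    (hl : ∀ b a, E (j b * a) = b * E a) (hr : ∀ a b, E (a * j b) = E a * b) {n : ℕ}
    (M : CStarMatrix (Fin n) (Fin n) A) (hM : 0 ≤ M) : 0 ≤ M.map E := by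
  obtain ⟨N, hN⟩ := exists_star_mul_self hM
  have hM' : ∀ s t, M s t = ∑ k, star (N k s) * N k t := fun s t =>
    (congrFun (congrFun hN s) t).trans CStarMatrix.mul_apply
  have hsa : IsSelfAdjoint (M.map E) := by
    refine CStarMatrix.ext fun s t => ?_
    rw [CStarMatrix.star_apply, CStarMatrix.map_apply, CStarMatrix.map_apply, ← hstar]
    congr 1
    exact congrFun (congrFun (IsSelfAdjoint.of_nonneg hM).star_eq s) t
  -- `m` is positive, annihilates the positive part of the image matrix, and must be shown to have
  -- vanishing cube. With `m = d⋆ d` the cube is `(d m)⋆ (d m)`, so it is enough that `d m = 0`.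
  obtain ⟨m, hm, hneg, hfin⟩ := exists_negPart_cube hsa
  refine hfin ?_
  obtain ⟨d, hd⟩ := exists_star_mul_self hm
  have hmsa : star m = m := (IsSelfAdjoint.of_nonneg hm).star_eq
  have hcube : m * m * m = star (d * m) * (d * m) := by
    rw [star_mul, hmsa]
    conv_lhs => enter [1, 2]; rw [hd]
    simp only [mul_assoc]
  have hzero : d * m = 0 := by
    refine CStarMatrix.ext fun k s => ?_
    -- Writing `M = N⋆ N`, the bimodule property moves the entries of `m` inside `E`, and the
    -- diagonal entry becomes `E` of a sum of squares. By the choice of `m` it is also minus a sum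
    -- of squares of entries of `d m`, which forces those entries to vanish.
    have h1 : 0 ≤ (m * M.map E * m) s s := by
      have e : (m * M.map E * m) s s =
          E (∑ k, star (∑ t, N k t * j (m t s)) * ∑ t, N k t * j (m t s)) := by
        have hms : ∀ t, m s t = star (m t s) := fun t => by
          conv_lhs => rw [← hmsa]
          rfl
        simp only [CStarMatrix.mul_apply, CStarMatrix.map_apply, hM', hms, star_sum, star_mul,
          Finset.sum_mul, Finset.mul_sum, map_sum, ← map_star]
        conv_rhs => rw [Finset.sum_comm]; enter [2, s]; rw [Finset.sum_comm]
        refine Finset.sum_congr rfl fun t _ => Finset.sum_congr rfl fun u _ =>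
          Finset.sum_congr rfl fun k _ => ?_
        rw [mul_assoc (j _), hl, ← mul_assoc (star _), hr, mul_assoc]
      rw [e, map_sum]
      exact Finset.sum_nonneg fun k _ => hpos _
    rw [hneg, hcube, CStarMatrix.neg_apply, CStarMatrix.mul_apply] at h1
    have h2 : ∑ k, star ((d * m) k s) * (d * m) k s = 0 :=
      le_antisymm (neg_nonneg.mp h1) (Finset.sum_nonneg fun k _ => star_mul_self_nonneg _)
    have h3 := (Finset.sum_eq_zero_iff_of_nonneg fun k _ =>
      star_mul_self_nonneg ((d * m) k s)).mp h2 k (Finset.mem_univ k)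
    exact CStarRing.star_mul_self_eq_zero_iff _ |>.mp h3
  rw [hcube, hzero, mul_zero]

end Positivity

/-! ### Compressions -/

section Compression

variable {K H : Type*} [NormedAddCommGroup K] [InnerProductSpace ℂ K] [CompleteSpace K]
  [NormedAddCommGroup H] [InnerProductSpace ℂ H] [CompleteSpace H]

/-- The compression `T ↦ J⋆ T J` of operators. -/
noncomputable def compression (J : K →L[ℂ] H) : (H →L[ℂ] H) →L[ℂ] (K →L[ℂ] K) :=
  (ContinuousLinearMap.compL ℂ K H K J.adjoint) ∘L (ContinuousLinearMap.compL ℂ K H H).flip J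

variable (J : K →L[ℂ] H)

theorem compression_apply (T : H →L[ℂ] H) : compression J T = J.adjoint ∘L T ∘L J := rfl

theorem inner_compression (T : H →L[ℂ] H) (x y : K) : ⟪x, compression J T y⟫_ℂ = ⟪J x, T (J y)⟫_ℂ := by
  rw [compression_apply, ContinuousLinearMap.comp_apply, ContinuousLinearMap.adjoint_inner_right]
  rfl

variable {J}

theorem compression_ext {T : H →L[ℂ] H} {R : K →L[ℂ] K}
    (h : ∀ x y, ⟪J x, T (J y)⟫_ℂ = ⟪x, R y⟫_ℂ) : compression J T = R := by
  ext y
  exact ext_inner_left ℂ fun x => by rw [inner_compression, h]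

theorem compression_star (T : H →L[ℂ] H) : compression J (star T) = star (compression J T) :=
  compression_ext fun x y => by
    rw [ContinuousLinearMap.star_eq_adjoint, ContinuousLinearMap.star_eq_adjoint,
      ContinuousLinearMap.adjoint_inner_right, ContinuousLinearMap.adjoint_inner_right,
      ← inner_conj_symm, ← inner_compression, inner_conj_symm]

theorem compression_nonneg (T : H →L[ℂ] H) : 0 ≤ compression J (star T * T) := by
  rw [ContinuousLinearMap.nonneg_iff_isPositive]
  have : compression J (star T * T) = (T ∘L J).adjoint ∘L (T ∘L J) := by
    rw [compression_apply, ContinuousLinearMap.adjoint_comp]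
    rfl
  rw [this]
  exact ContinuousLinearMap.isPositive_adjoint_comp_self _

/-- `R'` leaves the range of `J` invariant and acts there as `R`, so it can be carried through `J`
to the right. -/
theorem compression_mul {T R' : H →L[ℂ] H} {R : K →L[ℂ] K} (h : ∀ x, R' (J x) = J (R x)) :
    compression J (T * R') = compression J T * R :=
  compression_ext fun x y => by
    rw [mul_apply_eq_comp, mul_apply_eq_comp, inner_compression, h]

/-- A `*`-homomorphism is contractive, and `α T` restricted to the range of `J` is a copy of `T`,
which gives the reverse inequality. -/
theorem isometry_of_intertwining (hJ : ∀ x, ‖J x‖ = ‖x‖) {α : (K →L[ℂ] K) →⋆ₐ[ℂ] (H →L[ℂ] H)}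
    (h : ∀ R x, α R (J x) = J (R x)) : Isometry α := by
  refine AddMonoidHomClass.isometry_of_norm _ fun T => le_antisymm
    (NonUnitalStarAlgHom.norm_apply_le _ T) ?_
  refine ContinuousLinearMap.opNorm_le_bound _ (norm_nonneg _) fun x => ?_
  rw [← hJ (T x), ← hJ x, ← h]
  exact ContinuousLinearMap.le_opNorm _ _

end Compression

namespace GraphProduct

/-! ### Reduced graph products and their subgraphs -/

section GNS

variable {A : Type*} [CStarAlgebra A] [PartialOrder A] [StarOrderedRing A]

theorem GNSFaithfulState.gns_cyclic (φ : GNSFaithfulState A) (a : A) :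
    φ.toPos.gnsStarAlgHom a φ.cyclic =
      ((φ.toPos.toPreGNS a : φ.toPos.PreGNS) : φ.toPos.GNS) := by
  rw [cyclic]
  refine (φ.toPos.gnsNonUnitalStarAlgHom_apply_coe (a := a)).trans ?_
  simp [PositiveLinearMap.leftMulMapPreGNS_apply]

theorem GNSFaithfulState.inner_cyclic (φ : GNSFaithfulState A) (a : A) :
    ⟪φ.cyclic, φ.toPos.gnsStarAlgHom a φ.cyclic⟫_ℂ = φ.toPos a := by
  rw [gns_cyclic, cyclic, UniformSpace.Completion.inner_coe, PositiveLinearMap.preGNS_inner_def]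
  simp

theorem GNSFaithfulState.denseRange_cyclic (φ : GNSFaithfulState A) :
    DenseRange fun a => φ.toPos.gnsStarAlgHom a φ.cyclic := by
  simp only [gns_cyclic]
  exact UniformSpace.Completion.denseRange_coe.comp φ.toPos.toPreGNS.surjective.denseRange
    (UniformSpace.Completion.continuous_coe _)

end GNS

section Algebra

variable {V : Type*} {A : V → Type*} [∀ v, CStarAlgebra (A v)] [∀ v, PartialOrder (A v)]
  [∀ v, StarOrderedRing (A v)] {Γ : SimpleGraph V} {φ : ∀ v, GNSFaithfulState (A v)}

variable (Γ φ) in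
/-- The representation `λ_v` of `A_v`. -/
noncomputable def vertexHom (v : V) : A v →⋆ₐ[ℂ] (GraphGNS Γ φ →L[ℂ] GraphGNS Γ φ) :=
  (graphRepHom Γ (fun v => (φ v).norm_cyclic) v).comp (φ v).toPos.gnsStarAlgHom

theorem vertexHom_apply (v : V) (a : A v) : vertexHom Γ φ v a = vertexOp Γ φ v a := rfl

variable (Γ φ) in
theorem toOp_injective : Function.Injective (toOp Γ φ) := Subtype.val_injective

theorem toOp_vertexIncl (v : V) (a : A v) :
    toOp Γ φ (vertexIncl Γ φ v a) = vertexOp Γ φ v a := rfl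

variable (Γ φ) in
theorem toOp_mem (x : RedGraphProd Γ φ) : toOp Γ φ x ∈ redGraphAlg Γ φ := x.2

variable (Γ φ) in
theorem vertexOp_mem (v : V) (a : A v) : vertexOp Γ φ v a ∈ redGraphAlg Γ φ :=
  toOp_mem Γ φ (vertexIncl Γ φ v a)

variable (Γ φ) in
theorem isClosed_redGraphAlg :
    IsClosed (redGraphAlg Γ φ : Set (GraphGNS Γ φ →L[ℂ] GraphGNS Γ φ)) :=
  StarSubalgebra.isClosed_topologicalClosure _

variable (Γ φ) in
theorem redGraphAlg_le {M : StarSubalgebra ℂ (GraphGNS Γ φ →L[ℂ] GraphGNS Γ φ)}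
    (hM : IsClosed (M : Set (GraphGNS Γ φ →L[ℂ] GraphGNS Γ φ)))
    (h : ∀ v a, vertexOp Γ φ v a ∈ M) : redGraphAlg Γ φ ≤ M := by
  refine StarSubalgebra.topologicalClosure_minimal (StarAlgebra.adjoin_le ?_) hM
  intro T hT
  obtain ⟨v, a, rfl⟩ := Set.mem_iUnion.mp hT
  exact h v a

variable (Γ φ) in
-- The generators are stable under adjoints, so a closed subalgebra containing them suffices. This
-- matters for sets defined by right multiplication, whose stability under adjoints is not visible.
theorem mem_of_mem_redGraphAlg {M : Subalgebra ℂ (GraphGNS Γ φ →L[ℂ] GraphGNS Γ φ)}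
    (hM : IsClosed (M : Set (GraphGNS Γ φ →L[ℂ] GraphGNS Γ φ)))
    (h : ∀ v a, vertexOp Γ φ v a ∈ M) {T : GraphGNS Γ φ →L[ℂ] GraphGNS Γ φ}
    (hT : T ∈ redGraphAlg Γ φ) : T ∈ M := by
  have h1 : (StarAlgebra.adjoin ℂ (⋃ v, Set.range (vertexOp Γ φ v))).toSubalgebra ≤ M := by
    rw [StarAlgebra.adjoin_toSubalgebra, Algebra.adjoin_le_iff]
    rintro T (hT | hT)
    · obtain ⟨v, a, rfl⟩ := Set.mem_iUnion.mp hT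
      exact h v a
    · obtain ⟨v, a, e⟩ := Set.mem_iUnion.mp hT
      have : T = vertexOp Γ φ v (star a) := by
        rw [← vertexHom_apply, map_star, vertexHom_apply, e, star_star]
      rw [this]
      exact h v _
  have h2 : T ∈ closure (StarAlgebra.adjoin ℂ (⋃ v, Set.range (vertexOp Γ φ v)) :
      Set (GraphGNS Γ φ →L[ℂ] GraphGNS Γ φ)) := hT
  exact closure_minimal h1 hM h2

/-! #### Reduced operators -/

/-- The product of the operators of a word of algebra elements. -/
noncomputable def opProd (Γ : SimpleGraph V) (φ : ∀ v, GNSFaithfulState (A v))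
    (u : List (Σ v, A v)) : GraphGNS Γ φ →L[ℂ] GraphGNS Γ φ :=
  (u.map fun p => vertexOp Γ φ p.1 p.2).prod

theorem opProd_cons (p : Σ v, A v) (u : List (Σ v, A v)) :
    opProd Γ φ (p :: u) = vertexOp Γ φ p.1 p.2 * opProd Γ φ u := List.prod_cons

theorem vertexOp_commute {v w : V} (h : Γ.Adj v w) (a : A v) (b : A w) :
    Commute (vertexOp Γ φ v a) (vertexOp Γ φ w b) := graphRep_commute _ h _ _

theorem opProd_equiv {u u' : List (Σ v, A v)} (h : EquivII (Γ.comap Sigma.fst) u u') :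
    opProd Γ φ u = opProd Γ φ u' := by
  induction h with
  | refl w => rfl
  | swap p q w h =>
    simp only [opProd_cons, ← mul_assoc]
    rw [(vertexOp_commute (Γ := Γ) (φ := φ) h p.2 q.2).eq]
  | cons p _ ih => rw [opProd_cons, opProd_cons, ih]
  | trans _ _ ih₁ ih₂ => exact ih₁.trans ih₂

/-- The letter `(a - φ(a)) ξ_v`. -/
noncomputable def vacLetter (φ : ∀ v, GNSFaithfulState (A v)) (p : Σ v, A v) :
    Letter fun v => (φ v).cyclic :=
  ⟨p.1, (ℂ ∙ (φ p.1).cyclic)ᗮ.orthogonalProjectionOnto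
    ((φ p.1).toPos.gnsStarAlgHom p.2 (φ p.1).cyclic)⟩

theorem verts_vacLetter (u : List (Σ v, A v)) :
    verts (u.map (vacLetter φ)) = u.map Sigma.fst := by
  simp only [verts, List.map_map]; rfl

theorem vertexOp_elem {v : V} (a : A v) {x : List (Letter fun v => (φ v).cyclic)}
    (hx : IsReducedWord Γ (v :: verts x)) :
    vertexOp Γ φ v a (elem Γ x hx.tail) =
      elem Γ (vacLetter φ ⟨v, a⟩ :: x) (hx.cons_letter _) + (φ v).toPos a • elem Γ x hx.tail := by
  rw [vertexOp, graphRep_elem _ _ hx, frontVec, GNSFaithfulState.inner_cyclic]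
  rfl

/-- Centred elements act as pure creation operators: when `v` may be prepended to `x`, `λ_v(a)`
sends `x` to `(a ξ_v)° ⊗ x + φ(a) x`, and the second term vanishes. -/
theorem opProd_elem {u : List (Σ v, A v)} (hu : ∀ p ∈ u, (φ p.1).toPos p.2 = 0)
    {x : List (Letter fun v => (φ v).cyclic)} (hx : IsReducedWord Γ (verts x))
    (hux : IsReducedWord Γ (verts (u.map (vacLetter φ) ++ x))) :
    opProd Γ φ u (elem Γ x hx) = elem Γ (u.map (vacLetter φ) ++ x) hux := by
  induction u with
  | nil => rfl
  | cons p u ih =>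
    have hux' : IsReducedWord Γ (p.1 :: verts (u.map (vacLetter φ) ++ x)) := hux
    rw [opProd_cons, mul_apply_eq_comp, ih (fun q hq => hu q (by simp [hq])) hux'.tail,
      vertexOp_elem _ hux', hu p (by simp), zero_smul, add_zero]
    rfl

end Algebra

end GraphProduct

/-- A `*`-homomorphism whose values lie in the range of an injective `*`-homomorphism `σ`, factored
through `σ`. -/
noncomputable def StarAlgHom.liftThrough {X Y C : Type*} [CStarAlgebra X] [CStarAlgebra Y]
    [CStarAlgebra C] (σ : Y →⋆ₐ[ℂ] C) (hσ : Function.Injective σ) (α : X →⋆ₐ[ℂ] C)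
    (h : ∀ x, ∃ y, σ y = α x) : X →⋆ₐ[ℂ] Y :=
  (StarAlgEquiv.ofInjective σ hσ).symm.toStarAlgHom.comp (α.codRestrict σ.range h)

theorem StarAlgHom.apply_liftThrough {X Y C : Type*} [CStarAlgebra X] [CStarAlgebra Y]
    [CStarAlgebra C] (σ : Y →⋆ₐ[ℂ] C) (hσ : Function.Injective σ) (α : X →⋆ₐ[ℂ] C)
    (h : ∀ x, ∃ y, σ y = α x) (x : X) : σ (σ.liftThrough hσ α h x) = α x :=
  congrArg Subtype.val ((StarAlgEquiv.ofInjective σ hσ).apply_symm_apply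
    (α.codRestrict σ.range h x))

namespace GraphProduct

/-! ### Models of the reduced graph product of a subgraph -/

section Inside

variable {V : Type*} {H : V → Type*} [∀ v, NormedAddCommGroup (H v)]
  [∀ v, InnerProductSpace ℂ (H v)] {Γ : SimpleGraph V} {ξ : ∀ v, H v} {S : Set V}

variable (Γ ξ S) in
/-- Elementary tensors along reduced words in `S`. -/
abbrev InsideTensor :=
  {x : List (Letter ξ) // IsReducedWord Γ (verts x) ∧ ∀ a ∈ verts x, a ∈ S}

theorem InsideTensor.isReducedWord_append (x : InsideTensor Γ ξ S) (z : FreeTensor Γ ξ S) :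
    IsReducedWord Γ (verts (x.1 ++ z.1)) := by
  rw [verts_append]
  exact z.2.append x.2.1 x.2.2

theorem exists_inside_free (S : Set V) (x : List (Letter ξ)) (hx : IsReducedWord Γ (verts x)) :
    ∃ (y : InsideTensor Γ ξ S) (z : FreeTensor Γ ξ S), LetterEquiv Γ x (y.1 ++ z.1) := by
  obtain ⟨y, z, h, hy, hz⟩ := exists_factor Sigma.fst S x hx
  have hr : IsReducedWord Γ (verts (y ++ z)) := (LetterEquiv.verts h).isReducedWord hx
  refine ⟨⟨y, ?_, ?_⟩, ⟨z, hz⟩, h⟩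
  · intro v u m t e
    refine hr v u m (t ++ verts z) ?_
    rw [verts_append, e]
    simp
  · intro a ha
    obtain ⟨p, hp, rfl⟩ := List.mem_map.mp ha
    exact hy p hp

end Inside

section Model

variable {V : Type*} {A : V → Type*} [∀ v, CStarAlgebra (A v)] [∀ v, PartialOrder (A v)]
  [∀ v, StarOrderedRing (A v)]

/-- A C⋆-algebra `B` acting on a Hilbert space `K` in the same way as the reduced graph product of
the subgraph on `S` acts on its graph product Hilbert space, together with the decomposition
`H_Γ = K ⊗ H(S)`. -/
structure SubgraphModel (Γ : SimpleGraph V) (φ : ∀ v, GNSFaithfulState (A v)) (S : Set V)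
    (K B : Type*) [NormedAddCommGroup K] [InnerProductSpace ℂ K] [CompleteSpace K]
    [CStarAlgebra B] where
  /-- the action on `K` -/
  rep : B →⋆ₐ[ℂ] (K →L[ℂ] K)
  rep_injective : Function.Injective rep
  /-- the map `T ↦ T ⊗ 1` -/
  amp : (K →L[ℂ] K) →⋆ₐ[ℂ] (GraphGNS Γ φ →L[ℂ] GraphGNS Γ φ)
  /-- the map `h ↦ h ⊗ z` -/
  right : FreeTensor Γ (fun v => (φ v).cyclic) S → K →L[ℂ] GraphGNS Γ φ
  /-- the elementary tensors -/
  elt : InsideTensor Γ (fun v => (φ v).cyclic) S → K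
  /-- the embeddings of the vertex algebras -/
  incl : ∀ v ∈ S, A v → B
  dense_elt : Dense (Submodule.span ℂ (Set.range elt) : Set K)
  inner_right_nil : ∀ h h', ⟪right ⟨[], .nil S⟩ h, right ⟨[], .nil S⟩ h'⟫_ℂ = ⟪h, h'⟫_ℂ
  right_elt : ∀ z x, right z (elt x) = elem Γ (x.1 ++ z.1) (x.isReducedWord_append z)
  amp_right : ∀ T z h, amp T (right z h) = right z (T h)
  amp_incl : ∀ v hv a, amp (rep (incl v hv a)) = vertexOp Γ φ v a
  generated : ∀ M : StarSubalgebra ℂ B, IsClosed (M : Set B) → (∀ v hv a, incl v hv a ∈ M) →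
    ∀ b, b ∈ M

namespace SubgraphModel

variable {Γ : SimpleGraph V} {φ : ∀ v, GNSFaithfulState (A v)} {S T : Set V}
  {K B : Type*} [NormedAddCommGroup K] [InnerProductSpace ℂ K] [CompleteSpace K]
  [CStarAlgebra B]
  {L C : Type*} [NormedAddCommGroup L] [InnerProductSpace ℂ L] [CompleteSpace L]
  [CStarAlgebra C] (D : SubgraphModel Γ φ S K B) (D' : SubgraphModel Γ φ T L C)

/-- The isometry of `K` into the graph product Hilbert space. -/
noncomputable def iso : K →L[ℂ] GraphGNS Γ φ := D.right ⟨[], .nil S⟩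

theorem inner_iso (h h' : K) : ⟪D.iso h, D.iso h'⟫_ℂ = ⟪h, h'⟫_ℂ := D.inner_right_nil h h'

theorem norm_iso (h : K) : ‖D.iso h‖ = ‖h‖ := by
  rw [← sq_eq_sq₀ (norm_nonneg _) (norm_nonneg _), ← inner_self_eq_norm_sq (𝕜 := ℂ),
    ← inner_self_eq_norm_sq (𝕜 := ℂ), inner_iso]

theorem iso_elt (x : InsideTensor Γ (fun v => (φ v).cyclic) S) :
    D.iso (D.elt x) = elem Γ x.1 x.2.1 := by
  rw [iso, D.right_elt]
  congr 1
  simp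

theorem amp_iso (R : K →L[ℂ] K) (h : K) : D.amp R (D.iso h) = D.iso (R h) := D.amp_right R _ h

theorem isometry_amp : Isometry D.amp := isometry_of_intertwining D.norm_iso D.amp_iso

theorem isometry_rep : Isometry D.rep :=
  NonUnitalStarAlgHom.isometry D.rep D.rep_injective

/-- The inclusion `A_S ⊆ A_Γ` as operators. -/
noncomputable def opHom : B →⋆ₐ[ℂ] (GraphGNS Γ φ →L[ℂ] GraphGNS Γ φ) := D.amp.comp D.rep

theorem opHom_apply (b : B) : D.opHom b = D.amp (D.rep b) := rfl

theorem opHom_iso (b : B) (h : K) : D.opHom b (D.iso h) = D.iso (D.rep b h) := D.amp_iso _ h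

theorem opHom_incl {v : V} (hv : v ∈ S) (a : A v) : D.opHom (D.incl v hv a) = vertexOp Γ φ v a :=
  D.amp_incl v hv a

theorem isometry_opHom : Isometry D.opHom := D.isometry_amp.comp D.isometry_rep

theorem opHom_mem_of {M : StarSubalgebra ℂ (GraphGNS Γ φ →L[ℂ] GraphGNS Γ φ)}
    (hM : IsClosed (M : Set (GraphGNS Γ φ →L[ℂ] GraphGNS Γ φ)))
    (h : ∀ v ∈ S, ∀ a, vertexOp Γ φ v a ∈ M) (b : B) : D.opHom b ∈ M := by
  refine D.generated (M.comap D.opHom) (hM.preimage D.isometry_opHom.continuous) ?_ b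
  intro v hv a
  change D.opHom _ ∈ M
  rw [D.opHom_incl]
  exact h v hv a

theorem isClosed_range_opHom :
    IsClosed (D.opHom.range : Set (GraphGNS Γ φ →L[ℂ] GraphGNS Γ φ)) := by
  have : (D.opHom.range : Set (GraphGNS Γ φ →L[ℂ] GraphGNS Γ φ)) = Set.range D.opHom := rfl
  rw [this]
  exact D.isometry_opHom.isClosedEmbedding.isClosed_range

/-- The inclusion `A_S ⊆ A_Γ`. -/
noncomputable def toGraph : B →⋆ₐ[ℂ] RedGraphProd Γ φ :=
  D.opHom.codRestrict (redGraphAlg Γ φ)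
    (D.opHom_mem_of (isClosed_redGraphAlg Γ φ) fun v _ a => vertexOp_mem Γ φ v a)

theorem toGraph_injective : Function.Injective D.toGraph := by
  intro b c h
  exact D.isometry_opHom.injective (congrArg (toOp Γ φ) h)

theorem toGraph_incl {v : V} (hv : v ∈ S) (a : A v) :
    D.toGraph (D.incl v hv a) = vertexIncl Γ φ v a :=
  toOp_injective Γ φ (D.opHom_incl hv a)

section Inclusion

/-- The range of an isometric `*`-homomorphism is closed, and the operators of `A_T` contain the
generators of `A_S`. Comparing both algebras on `H_Γ` avoids building a map from `H_S` to `H_T`. -/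
theorem exists_opHom_eq (hST : S ⊆ T) (b : B) : ∃ b', D'.opHom b' = D.opHom b :=
  D.opHom_mem_of D'.isClosed_range_opHom
    (fun v hv a => ⟨D'.incl v (hST hv) a, D'.opHom_incl _ _⟩) b

variable (hST : S ⊆ T)

/-- The inclusion `A_S ⊆ A_T` for `S ⊆ T`. -/
noncomputable def subHom : B →⋆ₐ[ℂ] C :=
  D'.opHom.liftThrough D'.isometry_opHom.injective D.opHom (D.exists_opHom_eq D' hST)

theorem opHom_subHom (b : B) : D'.opHom (D.subHom D' hST b) = D.opHom b :=
  StarAlgHom.apply_liftThrough _ _ _ _ b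

theorem subHom_injective : Function.Injective (D.subHom D' hST) := by
  intro b c h
  apply D.isometry_opHom.injective
  rw [← D.opHom_subHom D' hST, h, opHom_subHom]

theorem subHom_incl {v : V} (hv : v ∈ S) (a : A v) :
    D.subHom D' hST (D.incl v hv a) = D'.incl v (hST hv) a := by
  apply D'.isometry_opHom.injective
  rw [opHom_subHom, opHom_incl, opHom_incl]

end Inclusion

end SubgraphModel

end Model

end GraphProduct

/-! ### The graph product of an induced subgraph as a model -/

namespace GraphProduct

section InsideHilbert

variable {V : Type*} {H : V → Type*} [∀ v, NormedAddCommGroup (H v)]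
  [∀ v, InnerProductSpace ℂ (H v)] {Γ : SimpleGraph V} {ξ : ∀ v, H v} {S : Set V}

theorem InsideTensor.exists_ofSub (x : InsideTensor Γ ξ S) :
    ∃ y : List (Letter fun v : S => ξ v), y.map Letter.ofSub = x.1 ∧
      IsReducedWord (Γ.induce S) (verts y) := by
  obtain ⟨y, hy⟩ := GraphProduct.exists_ofSub (x := x.1)
    fun p hp => x.2.2 p.1 (List.mem_map_of_mem hp)
  exact ⟨y, hy, isReducedWord_ofSub.mp (by rw [hy]; exact x.2.1)⟩

/-- An elementary tensor along a word in `S` in the graph product Hilbert space of the subgraph. -/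
noncomputable def subElem (x : InsideTensor Γ ξ S) :
    GraphHilbert (Γ.induce S) (fun v : S => ξ v) :=
  elem (Γ.induce S) x.exists_ofSub.choose x.exists_ofSub.choose_spec.2

theorem rightMap_subElem (z : FreeTensor Γ ξ S) (x : InsideTensor Γ ξ S) :
    rightMap z (subElem x) = elem Γ (x.1 ++ z.1) (x.isReducedWord_append z) := by
  rw [subElem, rightMap_elem]
  congr 1
  rw [x.exists_ofSub.choose_spec.1]

/-- The choice of preimage in `subElem` is harmless, because `subIsometry` is injective and both
vectors have the same image. -/
theorem subElem_eq {y : List (Letter fun v : S => ξ v)}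
    (hy : IsReducedWord (Γ.induce S) (verts y)) (x : InsideTensor Γ ξ S)
    (hx : x.1 = y.map Letter.ofSub) : subElem x = elem (Γ.induce S) y hy := by
  rw [← adjoint_subIsometry_subIsometry (subElem x),
    ← adjoint_subIsometry_subIsometry (elem (Γ.induce S) y hy), ← rightMap_nil_eq,
    rightMap_subElem, rightMap_elem]
  congr 2
  rw [hx]

theorem dense_span_subElem :
    Dense (Submodule.span ℂ (Set.range (subElem : InsideTensor Γ ξ S → _)) :
      Set (GraphHilbert (Γ.induce S) fun v : S => ξ v)) := by
  refine dense_span_elem.mono (Submodule.span_mono ?_)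
  rintro _ ⟨y, rfl⟩
  refine ⟨⟨y.1.map Letter.ofSub, isReducedWord_ofSub.mpr y.2, ?_⟩, subElem_eq y.2 _ rfl⟩
  intro a ha
  obtain ⟨p, hp, rfl⟩ := List.mem_map.mp ha
  exact fst_mem_of_mem_ofSub p hp

theorem inner_rightMap_nil (h h' : GraphHilbert (Γ.induce S) fun v : S => ξ v) :
    ⟪rightMap (⟨[], .nil S⟩ : FreeTensor Γ ξ S) h, rightMap ⟨[], .nil S⟩ h'⟫_ℂ = ⟪h, h'⟫_ℂ := by
  rw [rightMap_nil_eq, inner_subIsometry]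

end InsideHilbert

section Model

variable {V : Type*} {A : V → Type*} [∀ v, CStarAlgebra (A v)] [∀ v, PartialOrder (A v)]
  [∀ v, StarOrderedRing (A v)] {Γ : SimpleGraph V} {φ : ∀ v, GNSFaithfulState (A v)}

theorem redGraphProd_generated (M : StarSubalgebra ℂ (RedGraphProd Γ φ))
    (hM : IsClosed (M : Set (RedGraphProd Γ φ))) (h : ∀ v a, vertexIncl Γ φ v a ∈ M)
    (b : RedGraphProd Γ φ) : b ∈ M := by
  have hi : Isometry (toOp Γ φ) := isometry_subtype_coe
  have h1 := redGraphAlg_le Γ φ (M := M.map (toOp Γ φ)) (by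
    rw [StarSubalgebra.coe_map]
    exact hi.isClosedEmbedding.isClosedMap _ hM) fun v a => ⟨_, h v a, rfl⟩
  obtain ⟨c, hc, e⟩ := h1 (toOp_mem Γ φ b)
  rw [← toOp_injective Γ φ e]
  exact hc

theorem ampHom_vertexOp {S : Set V} (w : S) (a : A w) :
    ampHom Γ (fun v => (φ v).cyclic) S (vertexOp (Γ.induce S) (fun v : S => φ v) w a) =
      vertexOp Γ φ w a :=
  ampHom_graphRep (Γ := Γ) (ξ := fun v => (φ v).cyclic) (S := S)
    (fun v => (φ v).norm_cyclic) w ((φ w).toPos.gnsStarAlgHom a)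

theorem ampHom_toOp_vertexIncl {S : Set V} (w : S) (a : A w) :
    ampHom Γ (fun v => (φ v).cyclic) S (toOp (Γ.induce S) (fun v : S => φ v)
      (vertexIncl (Γ.induce S) (fun v : S => φ v) w a)) = vertexOp Γ φ w a := by
  rw [toOp_vertexIncl]
  exact ampHom_vertexOp w a

variable (Γ φ) in
set_option maxHeartbeats 1000000 in
/-- The reduced graph product of the subgraph on `S`. -/
noncomputable def subgraphModel (S : Set V) :
    SubgraphModel Γ φ S (GraphGNS (Γ.induce S) fun v : S => φ v) (SubProd Γ φ S) where
  rep := toOp (Γ.induce S) fun v : S => φ v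
  rep_injective := toOp_injective (Γ.induce S) fun v : S => φ v
  amp := ampHom Γ (fun v => (φ v).cyclic) S
  right := rightMap (Γ := Γ) (ξ := fun v => (φ v).cyclic) (S := S)
  elt := subElem (Γ := Γ) (ξ := fun v => (φ v).cyclic) (S := S)
  incl v hv a := vertexIncl (Γ.induce S) (fun v : S => φ v) ⟨v, hv⟩ a
  dense_elt := dense_span_subElem (Γ := Γ) (ξ := fun v => (φ v).cyclic) (S := S)
  inner_right_nil h h' :=
    inner_rightMap_nil (Γ := Γ) (ξ := fun v => (φ v).cyclic) (S := S) h h'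
  right_elt z x := rightMap_subElem (Γ := Γ) (ξ := fun v => (φ v).cyclic) (S := S) z x
  amp_right T z h := ampHom_rightMap (Γ := Γ) (ξ := fun v => (φ v).cyclic) (S := S) T z h
  amp_incl v hv a := ampHom_toOp_vertexIncl (Γ := Γ) (φ := φ) (S := S) ⟨v, hv⟩ a
  generated M hM h b := redGraphProd_generated (Γ := Γ.induce S) (φ := fun v : S => φ v) M hM
    (fun v a => h v.1 v.2 a) b

end Model

end GraphProduct

/-! ### Compression of the graph product to a subgraph -/

namespace GraphProduct

section Centred

variable {V : Type*} {A : V → Type*} [∀ v, CStarAlgebra (A v)] [∀ v, PartialOrder (A v)]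
  [∀ v, StarOrderedRing (A v)]

/-- Reduced words of centred algebra elements that cannot end in `S`. -/
structure IsCentred (Γ : SimpleGraph V) (φ : ∀ v, GNSFaithfulState (A v)) (S : Set V)
    (u : List (Σ v, A v)) : Prop where
  state_eq_zero : ∀ p ∈ u, (φ p.1).toPos p.2 = 0
  isReducedWord : IsReducedWord Γ (u.map Sigma.fst)
  not_canEnd : ∀ s ∈ S, ¬ CanEnd Γ s (u.map Sigma.fst)

variable {Γ : SimpleGraph V} {φ : ∀ v, GNSFaithfulState (A v)} {S : Set V}

theorem IsCentred.nil : IsCentred Γ φ S [] := ⟨by simp, .nil, fun _ _ h => h⟩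

theorem IsCentred.of_equiv {u u' : List (Σ v, A v)} (hu : IsCentred Γ φ S u)
    (h : EquivII (Γ.comap Sigma.fst) u u') : IsCentred Γ φ S u' :=
  ⟨fun p hp => hu.state_eq_zero p (h.perm.mem_iff.mpr hp), h.map_comap.isReducedWord hu.isReducedWord,
    fun s hs h' => hu.not_canEnd s hs (h.map_comap.symm.canEnd s h')⟩

theorem IsCentred.tail {p : Σ v, A v} {u : List (Σ v, A v)} (hu : IsCentred Γ φ S (p :: u)) :
    IsCentred Γ φ S u :=
  ⟨fun q hq => hu.state_eq_zero q (by simp [hq]), IsReducedWord.tail hu.isReducedWord,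
    fun s hs h => hu.not_canEnd s hs (Or.inl h)⟩

theorem vertexOp_eq_add (v : V) (a : A v) :
    vertexOp Γ φ v a = vertexOp Γ φ v (a - (φ v).toPos a • 1) + (φ v).toPos a • 1 := by
  simp only [← vertexHom_apply, map_sub, map_smul, map_one, sub_add_cancel]

theorem vertexOp_mul (v : V) (a b : A v) :
    vertexOp Γ φ v a * vertexOp Γ φ v b = vertexOp Γ φ v (a * b) := by
  simp only [← vertexHom_apply, map_mul]

theorem vertexOp_commute_opProd {v : V} (a : A v) {u : List (Σ v, A v)}
    (h : ∀ w ∈ u.map Sigma.fst, Γ.Adj v w) : Commute (vertexOp Γ φ v a) (opProd Γ φ u) := by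
  induction u with
  | nil => exact Commute.one_right _
  | cons p u ih =>
    rw [opProd_cons]
    exact (vertexOp_commute (h p.1 (by simp)) a p.2).mul_right
      (ih fun w hw => h w (List.mem_cons_of_mem _ hw))

namespace SubgraphModel

variable {K B : Type*} [NormedAddCommGroup K] [InnerProductSpace ℂ K] [CompleteSpace K]
  [CStarAlgebra B] (D : SubgraphModel Γ φ S K B)

theorem isClosed_range_rep : IsClosed (D.rep.range : Set (K →L[ℂ] K)) := by
  have : (D.rep.range : Set (K →L[ℂ] K)) = Set.range D.rep := rfl
  rw [this]
  exact D.isometry_rep.isClosedEmbedding.isClosed_range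

theorem compression_one : compression D.iso 1 = 1 :=
  compression_ext fun x y => D.inner_iso x y

theorem compression_opHom (b : B) : compression D.iso (D.opHom b) = D.rep b := by
  have := compression_mul (T := 1) (D.opHom_iso b)
  rwa [one_mul, compression_one, one_mul] at this

/-- The operator prepends the word `u` to any word in `S`. Some letter can end `u`, and by
assumption it lies outside `S`; the new word contains it and is therefore inequivalent to every word
in `S`. -/
theorem compression_opProd_eq_zero {u : List (Σ v, A v)} (hu : IsCentred Γ φ S u) (hne : u ≠ []) :
    compression D.iso (opProd Γ φ u) = 0 := by
  refine clm_ext_total D.dense_elt fun y => eq_of_inner_total D.dense_elt fun x => ?_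
  have hr : IsReducedWord Γ (verts (u.map (vacLetter φ) ++ y.1)) := by
    rw [verts_append, verts_vacLetter]
    exact isReducedWord_append_of_not_canEnd hu.isReducedWord hu.not_canEnd y.2.1 y.2.2
  rw [inner_compression, iso_elt, iso_elt, opProd_elem hu.state_eq_zero y.2.1 hr, inner_elem,
    elemInner, if_neg]
  · simp
  · intro h
    obtain ⟨v, hv, hvu⟩ := canEnd_of_ne_nil (Γ := Γ) (w := u.map Sigma.fst) (by simpa using hne)
    refine hu.not_canEnd v (x.2.2 v (h.perm.mem_iff.mpr ?_)) hvu
    rw [verts_append, verts_vacLetter]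
    exact List.mem_append_left _ hv

/-- `x` multiplied by centred words compresses into the algebra of the subgraph. -/
def Compresses (x : GraphGNS Γ φ →L[ℂ] GraphGNS Γ φ) : Prop :=
  ∀ u, IsCentred Γ φ S u → compression D.iso (x * opProd Γ φ u) ∈ D.rep.range

variable {D}

theorem Compresses.one : D.Compresses 1 := by
  intro u hu
  rw [one_mul]
  by_cases h : u = []
  · subst h
    have : opProd Γ φ ([] : List (Σ v, A v)) = 1 := rfl
    rw [this, compression_one]
    exact one_mem _
  · rw [D.compression_opProd_eq_zero hu h]
    exact zero_mem _

/-- The inductive step behind the conditional expectation. The operator `λ_w(a)` is absorbed into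
the centred word to its right, or, if this would produce a word that can end in `S`, it is moved
past that word and leaves the compression as a right factor from `A_S`. -/
theorem Compresses.mul_vertexOp {x : GraphGNS Γ φ →L[ℂ] GraphGNS Γ φ} (hx : D.Compresses x) (w : V)
    (a : A w) : D.Compresses (x * vertexOp Γ φ w a) := by
  have key : ∀ (a : A w) (u : List (Σ v, A v)), IsCentred Γ φ S u →
      ¬ CanStart Γ w (u.map Sigma.fst) →
      compression D.iso (x * vertexOp Γ φ w a * opProd Γ φ u) ∈ D.rep.range := by
    intro a u hu hw
    -- Given that `u` cannot end in `S`, this is exactly the case in which prepending `w` gives a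
    -- word that can end in `S`: `w` belongs to `S` and commutes with all of `u`.
    by_cases h : w ∈ S ∧ ∀ z ∈ u.map Sigma.fst, Γ.Adj w z
    · rw [mul_assoc, (vertexOp_commute_opProd a h.2).eq, ← mul_assoc, ← D.opHom_incl h.1,
        compression_mul (D.opHom_iso _)]
      exact mul_mem (hx u hu) ⟨_, rfl⟩
    · have hc : IsCentred Γ φ S (⟨w, a - (φ w).toPos a • 1⟩ :: u) := by
        refine ⟨?_, ?_, ?_⟩
        · intro p hp
          rcases List.mem_cons.mp hp with rfl | hp
          · simp [(φ w).map_one]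
          · exact hu.state_eq_zero p hp
        · exact isReducedWord_cons.mpr ⟨hu.isReducedWord, hw⟩
        · rintro s hs (h' | ⟨h1, h2⟩)
          · exact hu.not_canEnd s hs h'
          · subst h1
            exact h ⟨hs, h2⟩
      have h1 := hx _ hc
      rw [opProd_cons] at h1
      rw [vertexOp_eq_add, mul_add, add_mul, map_add, mul_assoc, mul_smul_comm, mul_one,
        smul_mul_assoc, map_smul]
      exact add_mem h1 (SMulMemClass.smul_mem _ (hx u hu))
  intro u hu
  -- If `w` can start `u`, its letter is moved to the front and multiplied with `a`; reducedness
  -- then prevents `w` from starting the rest.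
  by_cases hw : CanStart Γ w (u.map Sigma.fst)
  · obtain ⟨⟨_, c⟩, u', rfl, h⟩ := exists_cons_of_canStart hw
    have hc := hu.of_equiv h
    rw [opProd_equiv h, opProd_cons, ← mul_assoc, mul_assoc x, vertexOp_mul]
    exact key _ u' hc.tail (isReducedWord_cons.mp hc.isReducedWord).2
  · exact key a u hu hw

variable (D) in
-- Operators whose right multiplication preserves `Compresses` form a subalgebra containing the
-- generators. It is closed because the image of `A_S` on its Hilbert space is closed. Applying
-- membership to the identity and the empty word gives the claim.
theorem exists_rep_eq_compression {x : GraphGNS Γ φ →L[ℂ] GraphGNS Γ φ}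
    (hx : x ∈ redGraphAlg Γ φ) : ∃ b, D.rep b = compression D.iso x := by
  let M : Subalgebra ℂ (GraphGNS Γ φ →L[ℂ] GraphGNS Γ φ) :=
    { carrier := {y | ∀ x, D.Compresses x → D.Compresses (x * y)}
      mul_mem' := fun {y z} hy hz x hx => by
        rw [← mul_assoc]
        exact hz _ (hy x hx)
      add_mem' := fun {y z} hy hz x hx u hu => by
        rw [mul_add, add_mul, map_add]
        exact add_mem (hy x hx u hu) (hz x hx u hu)
      algebraMap_mem' := fun c x hx u hu => by
        rw [Algebra.algebraMap_eq_smul_one, mul_smul_comm, mul_one, smul_mul_assoc, map_smul]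
        exact SMulMemClass.smul_mem _ (hx u hu) }
  have hM : IsClosed (M : Set (GraphGNS Γ φ →L[ℂ] GraphGNS Γ φ)) := by
    have : (M : Set (GraphGNS Γ φ →L[ℂ] GraphGNS Γ φ)) =
        ⋂ (x) (_ : D.Compresses x) (u) (_ : IsCentred Γ φ S u),
          {y | compression D.iso (x * y * opProd Γ φ u) ∈ D.rep.range} := by
      ext y
      simp only [Set.mem_iInter]
      rfl
    rw [this]
    refine isClosed_iInter fun x => isClosed_iInter fun _ => isClosed_iInter fun u =>
      isClosed_iInter fun _ => D.isClosed_range_rep.preimage ?_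
    fun_prop
  have h := mem_of_mem_redGraphAlg Γ φ hM (fun v a x hx => hx.mul_vertexOp v a) hx 1 .one [] .nil
  rw [one_mul] at h
  exact h

end SubgraphModel

end Centred

end GraphProduct

/-! ### The conditional expectations between subgraphs -/

namespace GraphProduct

namespace SubgraphModel

variable {V : Type*} {A : V → Type*} [∀ v, CStarAlgebra (A v)] [∀ v, PartialOrder (A v)]
  [∀ v, StarOrderedRing (A v)] {Γ : SimpleGraph V} {φ : ∀ v, GNSFaithfulState (A v)} {S T : Set V}
  {K B : Type*} [NormedAddCommGroup K] [InnerProductSpace ℂ K] [CompleteSpace K]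
  [CStarAlgebra B] {L C : Type*} [NormedAddCommGroup L] [InnerProductSpace ℂ L]
  [CompleteSpace L] [CStarAlgebra C] (D : SubgraphModel Γ φ S K B)
  (D' : SubgraphModel Γ φ T L C)

theorem exists_rep_eq_compression_opHom (x : C) :
    ∃ b, D.rep b = compression D.iso (D'.opHom x) :=
  D.exists_rep_eq_compression (toOp_mem Γ φ (D'.toGraph x))

/-- The compression of `x ∈ A_T` to the Hilbert space of the subgraph on `S`, as an element of
`A_S`. -/
noncomputable def expect (x : C) : B := (D.exists_rep_eq_compression_opHom D' x).choose

theorem rep_expect (x : C) : D.rep (D.expect D' x) = compression D.iso (D'.opHom x) :=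
  (D.exists_rep_eq_compression_opHom D' x).choose_spec

/-- The compression as a linear map. -/
noncomputable def expectₗ : C →ₗ[ℂ] B where
  toFun := D.expect D'
  map_add' x y := D.rep_injective (by simp only [map_add, rep_expect])
  map_smul' c x := D.rep_injective (by simp only [map_smul, rep_expect, RingHom.id_apply])

theorem rep_expectₗ (x : C) : D.rep (D.expectₗ D' x) = compression D.iso (D'.opHom x) :=
  D.rep_expect D' x

theorem expectₗ_star (x : C) : D.expectₗ D' (star x) = star (D.expectₗ D' x) :=
  D.rep_injective (by
    rw [rep_expectₗ, map_star D'.opHom, compression_star, map_star D.rep, rep_expectₗ])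

variable (hST : S ⊆ T)

theorem expectₗ_subHom (b : B) : D.expectₗ D' (D.subHom D' hST b) = b :=
  D.rep_injective (by rw [rep_expectₗ, opHom_subHom, compression_opHom])

theorem expectₗ_mul_right (x : C) (b : B) :
    D.expectₗ D' (x * D.subHom D' hST b) = D.expectₗ D' x * b :=
  D.rep_injective (by
    rw [rep_expectₗ, map_mul, opHom_subHom, compression_mul (D.opHom_iso b), map_mul, rep_expectₗ])

/-- The adjoint of the right module property. -/
theorem expectₗ_mul_left (b : B) (x : C) :
    D.expectₗ D' (D.subHom D' hST b * x) = b * D.expectₗ D' x := by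
  have := congrArg star (D.expectₗ_mul_right D' hST (star x) (star b))
  rwa [← expectₗ_star, star_mul, star_mul, ← map_star, star_star, star_star, ← expectₗ_star,
    star_star] at this

variable [PartialOrder B] [StarOrderedRing B]

/-- Compressions of operators preserve positivity, and the injective representation of `A_S`
reflects it. -/
theorem expectₗ_nonneg (x : C) : 0 ≤ D.expectₗ D' (star x * x) := by
  refine nonneg_of_map_nonneg D.rep D.rep_injective ?_
  rw [rep_expectₗ, map_mul, map_star]
  exact compression_nonneg _

variable [PartialOrder C] [StarOrderedRing C]

/-- The conditional expectation of `A_T` onto `A_S` for `S ⊆ T`. -/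
noncomputable def condExp : CondExp (D.subHom D' hST) where
  toLinearMap := D.expectₗ D'
  map_cstarMatrix_nonneg' _ M hM := map_cstarMatrix_nonneg_of_bimodule (D.subHom D' hST)
    (D.expectₗ D') (D.expectₗ_star D') (D.expectₗ_nonneg D') (D.expectₗ_mul_left D' hST)
    (D.expectₗ_mul_right D' hST) M hM
  map_incl := D.expectₗ_subHom D' hST
  map_mul_left := D.expectₗ_mul_left D' hST
  map_mul_right := D.expectₗ_mul_right D' hST

theorem rep_condExp (x : C) : D.rep (D.condExp D' hST x) = compression D.iso (D'.opHom x) :=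
  D.rep_expectₗ D' x

theorem rep_condExp_eq_adjoint (x : C) : D.rep (D.condExp D' hST x) =
    D.iso.adjoint ∘L toOp Γ φ (D'.toGraph x) ∘L D.iso := D.rep_condExp D' hST x

theorem compression_eq_zero {x : C} (hx : D.condExp D' hST x = 0) :
    compression D.iso (D'.opHom x) = 0 := by
  rw [← D.rep_condExp D' hST, hx, map_zero]

end SubgraphModel

end GraphProduct

namespace GraphProduct

/-! ### Concrete realisations of reduced amalgamated free products -/

section AmalgamModel

variable {ι : Type*} {A : ι → Type*} {B K H : Type*}
  [∀ i, CStarAlgebra (A i)] [∀ i, PartialOrder (A i)] [∀ i, StarOrderedRing (A i)]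
  [CStarAlgebra B] [PartialOrder B] [StarOrderedRing B]
  [NormedAddCommGroup K] [InnerProductSpace ℂ K] [CompleteSpace K]
  [NormedAddCommGroup H] [InnerProductSpace ℂ H] [CompleteSpace H]
  {j : ∀ i, B →⋆ₐ[ℂ] A i}

/-- The vector `U_i (a ⊗ w)`. -/
noncomputable def amFrontVec {E : ∀ i, CondExp (j i)} (ρ : B →⋆ₐ[ℂ] (K →L[ℂ] K)) {i : ι} (p : AmFront (K := K) E i) :
    AmHilbert E ρ :=
  amElem E ρ (amCentre i p.1 :: p.2.1.1) (chain_centre p.2.1.2 _) p.2.2 +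
    amElem E ρ (bWord (E i p.1) p.2.1.1)
      (by rw [map_fst_bWord]; exact p.2.1.2.tail) (bVec ρ (E i p.1) p.2.1.1 p.2.2)

/-- Representations of the `A_i` on a Hilbert space that contains `K` and orthogonal sectors `H_i`,
such that `ker E_i` maps `K` and the sectors `H_k` with `k ≠ i` into `H_i`. -/
structure AmalgamModel (E : ∀ i, CondExp (j i)) (ρ : B →⋆ₐ[ℂ] (K →L[ℂ] K)) (H : Type*)
    [NormedAddCommGroup H] [InnerProductSpace ℂ H] [CompleteSpace H] where
  /-- the representations of the `A_i` -/
  rep : ∀ i, A i →⋆ₐ[ℂ] (H →L[ℂ] H)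
  /-- the representation of `B` -/
  base : B →⋆ₐ[ℂ] (H →L[ℂ] H)
  /-- the embedding of `K` -/
  iso : K →L[ℂ] H
  /-- the sectors -/
  sector : ι → Submodule ℂ H
  rep_incl : ∀ i b, rep i (j i b) = base b
  inner_iso : ∀ x y, ⟪iso x, iso y⟫_ℂ = ⟪x, y⟫_ℂ
  base_iso : ∀ b x, base b (iso x) = iso (ρ b x)
  inner_sector : ∀ i k, i ≠ k → ∀ x ∈ sector i, ∀ y ∈ sector k, ⟪x, y⟫_ℂ = 0
  inner_iso_sector : ∀ i x, ∀ y ∈ sector i, ⟪iso x, y⟫_ℂ = 0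
  rep_iso : ∀ i a, E i a = 0 → ∀ x, rep i a (iso x) ∈ sector i
  rep_sector : ∀ i a, E i a = 0 → ∀ k, k ≠ i → ∀ x ∈ sector k, rep i a x ∈ sector i
  cyclic : ∀ N : Submodule ℂ H, IsClosed (N : Set H) → (∀ x, iso x ∈ N) →
    (∀ i a, ∀ x ∈ N, rep i a x ∈ N) → ∀ x, x ∈ N

namespace AmalgamModel

variable {E : ∀ i, CondExp (j i)} {ρ : B →⋆ₐ[ℂ] (K →L[ℂ] K)} (D : AmalgamModel E ρ H)

/-- The vector `a₁ ⋯ aₙ ξ`. -/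
noncomputable def word (x : List (AmLetter E)) (ξ : K) : H :=
  x.foldr (fun p h => D.rep p.1 p.2.1 h) (D.iso ξ)

theorem word_nil (ξ : K) : D.word [] ξ = D.iso ξ := rfl

theorem word_mem_sector (p : AmLetter E) (x : List (AmLetter E))
    (hx : ((p :: x).map Sigma.fst).IsChain (· ≠ ·)) (ξ : K) : D.word (p :: x) ξ ∈ D.sector p.1 := by
  induction x generalizing p with
  | nil => exact D.rep_iso _ _ p.2.2 ξ
  | cons q x ih =>
    have h := List.isChain_cons_cons.mp hx
    exact D.rep_sector _ _ p.2.2 q.1 h.1.symm _ (ih q h.2)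

theorem inner_word_sector {i : ι} {x : List (AmLetter E)}
    (hx : (i :: x.map Sigma.fst).IsChain (· ≠ ·)) (ξ : K) {h : H} (hh : h ∈ D.sector i) :
    ⟪D.word x ξ, h⟫_ℂ = 0 := by
  cases x with
  | nil => exact D.inner_iso_sector i ξ h hh
  | cons q x =>
    have h' := List.isChain_cons_cons.mp hx
    exact D.inner_sector q.1 i h'.1.symm _ (D.word_mem_sector q x h'.2 ξ) h hh

theorem base_word (b : B) (x : List (AmLetter E)) (ξ : K) :
    D.base b (D.word x ξ) = D.word (bWord b x) (bVec ρ b x ξ) := by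
  cases x with
  | nil => exact D.base_iso b ξ
  | cons p x =>
    have : D.rep p.1 (j p.1 b * p.2.1) = D.base b * D.rep p.1 p.2.1 := by
      rw [map_mul, D.rep_incl]
    exact (congrArg (fun T => T (D.word x ξ)) this).symm

theorem rep_word (i : ι) (a : A i) (x : List (AmLetter E)) (ξ : K) :
    D.rep i a (D.word x ξ) =
      D.word (amCentre i a :: x) ξ + D.word (bWord (E i a) x) (bVec ρ (E i a) x ξ) := by
  have h : D.rep i a = D.rep i (a - j i (E i a)) + D.base (E i a) := by
    rw [map_sub, D.rep_incl, sub_add_cancel]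
  rw [← base_word]
  exact congrArg (fun T => T (D.word x ξ)) h

/-- First letters are peeled off together. For equal colours, `⟪a x, c b y⟫ = ⟪x, (a⋆ c b) y⟫`, and
only `E_i(a⋆ c b)` contributes; it becomes the coefficient of the next step, which is why `c` must
be arbitrary. For different colours the vectors lie in orthogonal sectors. -/
theorem inner_word (c : B) (x y : List (AmLetter E)) (hx : (x.map Sigma.fst).IsChain (· ≠ ·))
    (hy : (y.map Sigma.fst).IsChain (· ≠ ·)) (ξ η : K) :
    ⟪D.word x ξ, D.base c (D.word y η)⟫_ℂ = ⟪ξ, ρ (nest c x y) η⟫_ℂ := by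
  induction x generalizing c y with
  | nil =>
    cases y with
    | nil => rw [word_nil, word_nil, D.base_iso, D.inner_iso, nest_nil]
    | cons q y =>
      rw [nest_nil_cons, base_word, bWord]
      refine (D.inner_iso_sector q.1 ξ _ ?_).trans (by simp)
      exact D.word_mem_sector (bLetter c q) y hy _
  | cons p x ih =>
    cases y with
    | nil =>
      rw [nest_cons_nil, word_nil, D.base_iso, inner_eq_zero_symm.mp
        (D.inner_iso_sector p.1 _ _ (D.word_mem_sector p x hx ξ))]
      simp
    | cons q y =>
      rw [nest_cons]
      by_cases h : q.1 = p.1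
      · obtain ⟨i, a⟩ := p
        obtain ⟨k, b⟩ := q
        obtain rfl : k = i := h
        rw [step_self, ← ih _ y hx.tail hy.tail]
        have e : D.base c (D.word (⟨k, b⟩ :: y) η) = (D.rep k (j k c * b.1)) (D.word y η) := by
          rw [map_mul, D.rep_incl]
          rfl
        have e2 : ⟪D.word (⟨k, a⟩ :: x) ξ, D.base c (D.word (⟨k, b⟩ :: y) η)⟫_ℂ =
            ⟪D.word x ξ, D.rep k (star a.1 * j k c * b.1) (D.word y η)⟫_ℂ := by
          rw [e, mul_assoc, map_mul (D.rep k) (star a.1), map_star, ContinuousLinearMap.star_eq_adjoint,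
            mul_apply_eq_comp, ContinuousLinearMap.adjoint_inner_right]
          rfl
        -- The centred part of `a⋆ c b` maps the word `y` into sector `k`, which is orthogonal to
        -- the word `x` because `x` does not start with colour `k`.
        rw [e2, rep_word, ← base_word, inner_add_right, D.inner_word_sector hx ξ
          (D.word_mem_sector (amCentre k _) y hy η), zero_add]
      · rw [step_ne _ h, nest_zero, base_word, bWord]
        refine (D.inner_sector p.1 q.1 (Ne.symm h) _ (D.word_mem_sector p x hx ξ) _
          (D.word_mem_sector (bLetter c q) y hy _)).trans (by simp)

theorem inner_word_eq_ker (p q : AmWord E × K) :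
    ⟪D.word p.1.1 p.2, D.word q.1.1 q.2⟫_ℂ = (amKernel E ρ).ker p q := by
  have := D.inner_word 1 p.1.1 q.1.1 p.1.2 q.1.2 p.2 q.2
  rwa [map_one] at this

/-- The closed span of the alternating words contains `K` and is invariant under every `A_i`, so
cyclicity of `K` makes it everything. -/
theorem dense_span_word :
    Dense (Submodule.span ℂ (Set.range fun p : AmWord E × K => D.word p.1.1 p.2) : Set H) := by
  rw [Submodule.dense_iff_topologicalClosure_eq_top, Submodule.eq_top_iff']
  set N := (Submodule.span ℂ (Set.range fun p : AmWord E × K => D.word p.1.1 p.2)).topologicalClosure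
  have hN : IsClosed (N : Set H) := Submodule.isClosed_topologicalClosure _
  have hmem : ∀ (x : List (AmLetter E)) (ξ : K), (x.map Sigma.fst).IsChain (· ≠ ·) →
      D.word x ξ ∈ N := fun x ξ hx =>
    Submodule.le_topologicalClosure _ (Submodule.subset_span ⟨(⟨x, hx⟩, ξ), rfl⟩)
  have hrep : ∀ (i : ι) (a : A i) (x : List (AmLetter E)) (ξ : K),
      (i :: x.map Sigma.fst).IsChain (· ≠ ·) → D.rep i a (D.word x ξ) ∈ N := by
    intro i a x ξ hx
    rw [rep_word]
    exact add_mem (hmem _ _ hx) (hmem _ _ (by rw [map_fst_bWord]; exact hx.tail))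
  refine D.cyclic N hN (fun ξ => hmem [] ξ .nil) ?_
  intro i a h hh
  refine map_mem_of_closure_span hN _ ?_ hh
  rintro _ ⟨⟨⟨x, hx⟩, ξ⟩, rfl⟩
  cases x with
  | nil => exact hrep i a [] ξ (.singleton _)
  | cons p x =>
    -- A first letter of colour `i` is first multiplied with `a`, which leaves a word to which any
    -- element of `A_i` may be applied.
    by_cases hp : i = p.1
    · subst hp
      have : D.rep p.1 a (D.word (p :: x) ξ) = D.rep p.1 (a * p.2.1) (D.word x ξ) := by
        rw [map_mul]; rfl
      change D.rep p.1 a (D.word (p :: x) ξ) ∈ N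
      rw [this]
      exact hrep _ _ _ _ hx
    · exact hrep i a (p :: x) ξ (List.isChain_cons_cons.mpr ⟨hp, hx⟩)

/-- The unitary of the Hilbert space of the amalgamated free product onto `H`, as an operator. -/
noncomputable def lift : AmHilbert E ρ →L[ℂ] H :=
  (amKernel E ρ).lift (fun p => D.word p.1.1 p.2) D.inner_word_eq_ker

theorem lift_amElem (x : List (AmLetter E)) (hx : (x.map Sigma.fst).IsChain (· ≠ ·)) (ξ : K) :
    D.lift (amElem E ρ x hx ξ) = D.word x ξ := (amKernel E ρ).lift_vec _ _ _

/-- The unitary of the Hilbert space of the amalgamated free product onto `H`. -/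
noncomputable def unitary : AmHilbert E ρ ≃ₗᵢ[ℂ] H :=
  LinearIsometryEquiv.ofSurjective
    (LinearMap.isometryOfInner D.lift.toLinearMap (PosKernel.inner_lift_lift _ D.inner_word_eq_ker))
    fun h => ⟨_, PosKernel.lift_adjoint_lift _ D.inner_word_eq_ker D.dense_span_word h⟩

theorem unitary_apply (h : AmHilbert E ρ) : D.unitary h = D.lift h := rfl

theorem lift_injective : Function.Injective D.lift := D.unitary.injective

theorem lift_amFrontVec {i : ι} (p : AmFront (K := K) E i) :
    D.lift (amFrontVec ρ p) = D.rep i p.1 (D.word p.2.1.1 p.2.2) := by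
  rw [amFrontVec, map_add, lift_amElem, lift_amElem, rep_word]

/-- The factor from `A_i` is the first letter if that has colour `i`, and `1` otherwise. The
equality of vectors is checked in `H`, where `lift` is injective and words multiply as operators. -/
theorem exists_amFrontVec (D : AmalgamModel E ρ H) (i : ι) (x : List (AmLetter E))
    (hx : (x.map Sigma.fst).IsChain (· ≠ ·)) (ξ : K) :
    ∃ p : AmFront (K := K) E i, amFrontVec ρ p = amElem E ρ x hx ξ := by
  have key : ∀ p : AmFront (K := K) E i, D.rep i p.1 (D.word p.2.1.1 p.2.2) = D.word x ξ →
      ∃ p : AmFront (K := K) E i, amFrontVec ρ p = amElem E ρ x hx ξ := fun p hp =>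
    ⟨p, D.lift_injective (by rw [lift_amFrontVec, lift_amElem, hp])⟩
  have hone : ∀ h : H, D.rep i 1 h = h := fun h => by rw [map_one]; rfl
  cases x with
  | nil => exact key (1, ⟨[], .singleton _⟩, ξ) (hone _)
  | cons p x =>
    by_cases hp : i = p.1
    · subst hp
      exact key (p.2.1, ⟨x, hx⟩, ξ) rfl
    · exact key (1, ⟨p :: x, List.isChain_cons_cons.mpr ⟨hp, hx⟩⟩, ξ) (hone _)

/-- The vectors `U_i (b ⊗ w)` exhaust the elementary tensors, and on them both sides replace `b` by
`a b`. -/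
theorem lift_amOp (i : ι) (a : A i) (h : AmHilbert E ρ) :
    D.lift (amOp E ρ i a h) = D.rep i a (D.lift h) := by
  have : D.lift ∘L amOp E ρ i a = D.rep i a ∘L D.lift := by
    refine clm_ext_total (amKernel E ρ).dense_span_vec ?_
    rintro ⟨⟨x, hx⟩, ξ⟩
    obtain ⟨p, hp⟩ := D.exists_amFrontVec i x hx ξ
    have e : amOp E ρ i a (amFrontVec ρ p) = amFrontVec ρ (a * p.1, p.2) :=
      (amFrontAction E ρ i).lift_op_adjoint_apply _ _ a p
    change D.lift (amOp E ρ i a (amElem E ρ x hx ξ)) = D.rep i a (D.lift (amElem E ρ x hx ξ))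
    rw [← hp, e, lift_amFrontVec, lift_amFrontVec, map_mul]
    rfl
  exact congrArg (fun T => T h) this

/-- The representation of the reduced amalgamated free product on `H`. -/
noncomputable def toOp : RedAmalgam E ρ →⋆ₐ[ℂ] (H →L[ℂ] H) :=
  D.unitary.conjStarAlgEquiv.toStarAlgHom.comp (amToOp E ρ)

theorem toOp_apply (x : RedAmalgam E ρ) (h : H) :
    D.toOp x h = D.unitary (amToOp E ρ x (D.unitary.symm h)) := rfl

theorem toOp_injective : Function.Injective D.toOp :=
  D.unitary.conjStarAlgEquiv.injective.comp Subtype.val_injective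

theorem toOp_amIncl (i : ι) (a : A i) : D.toOp (amIncl E ρ i a) = D.rep i a := by
  ext h
  rw [toOp_apply]
  refine (D.lift_amOp i a _).trans ?_
  rw [← unitary_apply, LinearIsometryEquiv.apply_symm_apply]

theorem inner_toOp (x : RedAmalgam E ρ) (ξ η : K) :
    ⟪D.iso ξ, D.toOp x (D.iso η)⟫_ℂ = ⟪ξ, amExp E ρ x η⟫_ℂ := by
  have h : ∀ ξ, D.iso ξ = D.unitary (amIsometry E ρ ξ) := fun ξ => (D.lift_amElem [] .nil ξ).symm
  rw [toOp_apply, h, h, LinearIsometryEquiv.symm_apply_apply, LinearIsometryEquiv.inner_map_map,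
    amExp, ContinuousLinearMap.comp_apply, ContinuousLinearMap.adjoint_inner_right]
  rfl

end AmalgamModel

theorem redAmalgam_generated {E : ∀ i, CondExp (j i)} {ρ : B →⋆ₐ[ℂ] (K →L[ℂ] K)}
    (M : StarSubalgebra ℂ (RedAmalgam E ρ)) (hM : IsClosed (M : Set (RedAmalgam E ρ)))
    (h : ∀ i a, amIncl E ρ i a ∈ M) (b : RedAmalgam E ρ) : b ∈ M := by
  have hi : Isometry (amToOp E ρ) := isometry_subtype_coe
  have h1 : redAmalgamAlg E ρ ≤ M.map (amToOp E ρ) := by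
    refine StarSubalgebra.topologicalClosure_minimal (StarAlgebra.adjoin_le ?_) ?_
    · intro T hT
      obtain ⟨i, a, rfl⟩ := Set.mem_iUnion.mp hT
      exact ⟨_, h i a, rfl⟩
    · rw [StarSubalgebra.coe_map]
      exact hi.isClosedEmbedding.isClosedMap _ hM
  obtain ⟨c, hc, e⟩ := h1 b.2
  rw [← hi.injective (a₁ := c) (a₂ := b) e]
  exact hc

/-- A C⋆-algebra that is generated by the images of the `A_i` in a faithful representation
realising the reduced amalgamated free product is the reduced amalgamated free product. -/
theorem AmalgamModel.exists_equiv {E : ∀ i, CondExp (j i)} {ρ : B →⋆ₐ[ℂ] (K →L[ℂ] K)}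
    (D : AmalgamModel E ρ H) {C : Type*} [CStarAlgebra C] (σ : C →⋆ₐ[ℂ] (H →L[ℂ] H))
    (hσ : Function.Injective σ) (κ : ∀ i, A i →⋆ₐ[ℂ] C) (hκ : ∀ i a, σ (κ i a) = D.rep i a)
    (hgen : ∀ M : StarSubalgebra ℂ C, IsClosed (M : Set C) → (∀ i a, κ i a ∈ M) → ∀ c, c ∈ M) :
    ∃ π : RedAmalgam E ρ ≃⋆ₐ[ℂ] C, (∀ i a, π (amIncl E ρ i a) = κ i a) ∧
      (∀ π' : RedAmalgam E ρ ≃⋆ₐ[ℂ] C, (∀ i a, π' (amIncl E ρ i a) = κ i a) → π' = π) ∧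
      ∀ x ξ η, ⟪D.iso ξ, σ (π x) (D.iso η)⟫_ℂ = ⟪ξ, amExp E ρ x η⟫_ℂ := by
  have hσi : Isometry σ := NonUnitalStarAlgHom.isometry σ hσ
  have hDi : Isometry D.toOp := NonUnitalStarAlgHom.isometry D.toOp D.toOp_injective
  have hc1 : IsClosed (σ.range : Set (H →L[ℂ] H)) := by
    have : (σ.range : Set (H →L[ℂ] H)) = Set.range σ := rfl
    rw [this]
    exact hσi.isClosedEmbedding.isClosed_range
  have hc2 : IsClosed (D.toOp.range : Set (H →L[ℂ] H)) := by
    have : (D.toOp.range : Set (H →L[ℂ] H)) = Set.range D.toOp := rfl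
    rw [this]
    exact hDi.isClosedEmbedding.isClosed_range
  -- The representations of the two algebras have closed ranges generated by the same operators,
  -- hence equal ranges; the isomorphism is `D.toOp` followed by the inverse of `σ`.
  have h1 : ∀ x, ∃ c, σ c = D.toOp x :=
    redAmalgam_generated (σ.range.comap D.toOp) (hc1.preimage hDi.continuous)
      fun i a => ⟨κ i a, (hκ i a).trans (D.toOp_amIncl i a).symm⟩
  have h2 : ∀ c, ∃ x, D.toOp x = σ c :=
    hgen (D.toOp.range.comap σ) (hc2.preimage hσi.continuous)
      fun i a => ⟨amIncl E ρ i a, (D.toOp_amIncl i a).trans (hκ i a).symm⟩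
  have hπ := σ.apply_liftThrough hσ D.toOp h1
  have hbij : Function.Bijective (σ.liftThrough hσ D.toOp h1) := by
    refine ⟨fun x y h => D.toOp_injective ?_, fun c => ?_⟩
    · rw [← hπ, ← hπ, h]
    · obtain ⟨x, hx⟩ := h2 c
      exact ⟨x, hσ (by rw [hπ, hx])⟩
  have hπ1 : ∀ i a, StarAlgEquiv.ofBijective _ hbij (amIncl E ρ i a) = κ i a := fun i a =>
    hσ ((hπ _).trans ((D.toOp_amIncl i a).trans (hκ i a).symm))
  refine ⟨StarAlgEquiv.ofBijective _ hbij, hπ1, fun π' hπ' => ?_, fun x ξ η => ?_⟩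
  · ext x
    set π := StarAlgEquiv.ofBijective _ hbij
    -- Two such isomorphisms agree on a closed `*`-subalgebra containing the generators.
    have hx := redAmalgam_generated (StarAlgHom.equalizer π'.toStarAlgHom π.toStarAlgHom)
      (isClosed_eq (NonUnitalStarAlgHom.isometry π'.toStarAlgHom π'.injective).continuous
        (NonUnitalStarAlgHom.isometry π.toStarAlgHom π.injective).continuous)
      (fun i a => (hπ' i a).trans (hπ1 i a).symm) x
    exact hx
  · rw [← D.inner_toOp, ← hπ]
    rfl

end AmalgamModel

end GraphProduct

namespace GraphProduct

/-! ### The decomposition of a graph product at a vertex -/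

section SectorWords

variable {V : Type*} {Γ : SimpleGraph V} {v : V}

variable (Γ v) in
/-- The words that are not words in `Link(v)` and can (`i = 0`) or cannot (`i = 1`) start with
`v`. -/
def InSector (i : Fin 2) (w : List V) : Prop :=
  ¬ (∀ a ∈ w, a ∈ link Γ v) ∧ (CanStart Γ v w ↔ i = 0)

theorem EquivII.inSector {i : Fin 2} {w w' : List V} (h : EquivII Γ w w')
    (hw : InSector Γ v i w) : InSector Γ v i w' :=
  ⟨fun h' => hw.1 fun a ha => h' a (h.perm.mem_iff.mp ha), h.canStart_iff.symm.trans hw.2⟩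

theorem InSector.unique {i k : Fin 2} {w : List V} (hi : InSector Γ v i w)
    (hk : InSector Γ v k w) : i = k := by
  have := hi.2.symm.trans hk.2
  omega

/-- All letters of `Star(v)` other than `v` commute with `v`, so its first occurrence moves to the
front. -/
theorem canStart_of_mem_star {w : List V} (hw : ∀ a ∈ w, a ∈ link Γ v ∪ {v}) (hv : v ∈ w) :
    CanStart Γ v w := by
  induction w with
  | nil => simp at hv
  | cons b w ih =>
    by_cases hb : b = v
    · exact Or.inl hb
    · have hb' : Γ.Adj v b := (hw b (by simp)).resolve_right hb
      exact Or.inr ⟨hb', ih (fun a ha => hw a (by simp [ha]))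
        ((List.mem_cons.mp hv).resolve_left (Ne.symm hb))⟩

/-- For `i = 0` the letter of `y` outside `Link(v)` is `v` itself, and it can be moved to the front.
For `i = 1` the word `y` has no `v`, and its letter outside `Link(v)` blocks every `v` of `z`. -/
theorem inSector_append {i : Fin 2} {y : List V} (hy : ∀ a ∈ y, a ∈ pieces Γ v i)
    (hl : ¬ ∀ a ∈ y, a ∈ link Γ v) (z : List V) : InSector Γ v i (y ++ z) := by
  refine ⟨fun h => hl fun a ha => h a (by simp [ha]), ?_⟩
  rw [canStart_append]
  fin_cases i
  · refine iff_of_true (Or.inl (canStart_of_mem_star hy ?_)) rfl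
    push Not at hl
    obtain ⟨a, ha, hal⟩ := hl
    have : a = v := (hy a ha).resolve_left hal
    rwa [← this]
  · refine iff_of_false ?_ (by simp)
    rintro (h | h)
    · exact hy v (canStart_mem h) rfl
    · exact hl h.1

theorem exists_mem_pieces (Γ : SimpleGraph V) (v w : V) : ∃ i, w ∈ pieces Γ v i := by
  by_cases h : w = v
  · exact ⟨0, Or.inr h⟩
  · exact ⟨1, h⟩

end SectorWords

/-! ### Cyclicity of the vacuum -/

section Cyclic

variable {V : Type*} {A : V → Type*} [∀ v, CStarAlgebra (A v)] [∀ v, PartialOrder (A v)]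
  [∀ v, StarOrderedRing (A v)] {Γ : SimpleGraph V} {φ : ∀ v, GNSFaithfulState (A v)}

/-- The vacuum vector is cyclic. -/
theorem mem_of_vacuum_mem (N : Submodule ℂ (GraphGNS Γ φ))
    (hN : IsClosed (N : Set (GraphGNS Γ φ))) (h0 : gnsVacuum Γ φ ∈ N)
    (h : ∀ v a, ∀ x ∈ N, vertexOp Γ φ v a x ∈ N) (x : GraphGNS Γ φ) : x ∈ N := by
  have key : ∀ (x : List (Letter fun v => (φ v).cyclic)) (hx : IsReducedWord Γ (verts x)),
      elem Γ x hx ∈ N := by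
    intro x
    induction x with
    | nil => exact fun _ => h0
    | cons p x ih =>
      obtain ⟨v, η⟩ := p
      intro hx
      have hx' : IsReducedWord Γ (v :: verts x) := hx
      let P := (ℂ ∙ (φ v).cyclic)ᗮ.orthogonalProjectionOnto
      -- `λ_v(a) x` differs from `(a ξ_v)° ⊗ x` by a multiple of `x`, which is already in `N`.
      have h1 : ∀ a, consMap hx' (P ((φ v).toPos.gnsStarAlgHom a (φ v).cyclic)) ∈ N := by
        intro a
        have h2 := h v a _ (ih hx'.tail)
        rw [vertexOp_elem a hx'] at h2
        exact (Submodule.add_mem_iff_left _ (N.smul_mem _ (ih hx'.tail))).mp h2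
      -- The vectors `a ξ_v` are dense in the GNS space and `N` is closed, so arbitrary letters are
      -- reached.
      have hc : IsClosed {ζ : (φ v).toPos.GNS | consMap hx' (P ζ) ∈ N} :=
        hN.preimage ((consMap hx').continuous.comp P.continuous)
      have h3 : ∀ ζ, consMap hx' (P ζ) ∈ N := fun ζ =>
        (φ v).denseRange_cyclic.induction_on (p := fun ζ => consMap hx' (P ζ) ∈ N) ζ hc h1
      have h4 := h3 η
      have h5 : P (η : (φ v).toPos.GNS) = η := by simp [P]
      rw [h5] at h4
      exact h4
  have hd := Submodule.dense_iff_topologicalClosure_eq_top.mp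
    (dense_span_elem (Γ := Γ) (ξ := fun v => (φ v).cyclic))
  refine map_mem_of_closure_span hN (ContinuousLinearMap.id ℂ _) ?_ (hd ▸ Submodule.mem_top)
  rintro _ ⟨x, rfl⟩
  exact key x.1 x.2

end Cyclic

/-! ### The two sectors and how centred elements permute them -/

section Sectors

variable {V : Type*} {A : V → Type*} [∀ v, CStarAlgebra (A v)] [∀ v, PartialOrder (A v)]
  [∀ v, StarOrderedRing (A v)] (Γ : SimpleGraph V) (φ : ∀ v, GNSFaithfulState (A v))

/-- The closed span of the elementary tensors along words with a given property. -/
noncomputable def wordSpan (P : List V → Prop) : Submodule ℂ (GraphGNS Γ φ) :=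
  (Submodule.span ℂ ((fun x : RedTensor Γ fun v => (φ v).cyclic => elem Γ x.1 x.2) ''
    {x | P (verts x.1)})).topologicalClosure

variable {Γ φ}

theorem isClosed_wordSpan (P : List V → Prop) :
    IsClosed (wordSpan Γ φ P : Set (GraphGNS Γ φ)) := Submodule.isClosed_topologicalClosure _

theorem elem_mem_wordSpan {P : List V → Prop} {x : List (Letter fun v => (φ v).cyclic)}
    (hx : IsReducedWord Γ (verts x)) (h : P (verts x)) : elem Γ x hx ∈ wordSpan Γ φ P :=
  Submodule.le_topologicalClosure _ (Submodule.subset_span ⟨⟨x, hx⟩, h, rfl⟩)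

theorem wordSpan_mono {P Q : List V → Prop} (h : ∀ w, P w → Q w) :
    wordSpan Γ φ P ≤ wordSpan Γ φ Q :=
  Submodule.topologicalClosure_mono
    (Submodule.span_mono (Set.image_mono fun _ hx => h _ hx))

theorem inner_elem_eq_zero {x y : List (Letter fun v => (φ v).cyclic)}
    (hx : IsReducedWord Γ (verts x)) (hy : IsReducedWord Γ (verts y))
    (h : ¬ EquivII Γ (verts x) (verts y)) : ⟪elem Γ x hx, elem Γ y hy⟫_ℂ = 0 := by
  rw [inner_elem, elemInner, if_neg h]

theorem inner_wordSpan {P Q : List V → Prop} (h : ∀ w w', P w → Q w' → ¬ EquivII Γ w w')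
    {x y : GraphGNS Γ φ} (hx : x ∈ wordSpan Γ φ P) (hy : y ∈ wordSpan Γ φ Q) : ⟪x, y⟫_ℂ = 0 := by
  refine inner_eq_zero_of_closure_span ?_ hx hy
  rintro _ ⟨x, hx, rfl⟩ _ ⟨y, hy, rfl⟩
  exact inner_elem_eq_zero _ _ (h _ _ hx hy)

namespace SubgraphModel

variable {v : V} {K B : Type*} [NormedAddCommGroup K] [InnerProductSpace ℂ K] [CompleteSpace K]
  [CStarAlgebra B] {S : Set V}

theorem iso_mem_wordSpan (D : SubgraphModel Γ φ S K B) (h : K) :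
    D.iso h ∈ wordSpan Γ φ fun w => ∀ a ∈ w, a ∈ S := by
  refine map_mem_of_closure_span (isClosed_wordSpan _) D.iso ?_
    (Submodule.dense_iff_topologicalClosure_eq_top.mp D.dense_elt ▸ Submodule.mem_top)
  rintro _ ⟨x, rfl⟩
  rw [iso_elt]
  exact elem_mem_wordSpan _ x.2.2

variable {L C : Type*} [NormedAddCommGroup L] [InnerProductSpace ℂ L] [CompleteSpace L]
  [CStarAlgebra C] {i : Fin 2}

/-- A tensor along a word in `Link(v)` belongs to `H_Link(v)`, and vanishing compression says that
`a` maps it to a vector orthogonal to `H_Link(v)`. In the space of the piece that complement is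
spanned by the words with a letter outside `Link(v)`. -/
theorem rep_elt_mem (D : SubgraphModel Γ φ (link Γ v) K B)
    (D' : SubgraphModel Γ φ (pieces Γ v i) L C) {a : C}
    (ha : compression D.iso (D'.opHom a) = 0)
    (y : InsideTensor Γ (fun v => (φ v).cyclic) (pieces Γ v i))
    (hy : ∀ c ∈ verts y.1, c ∈ link Γ v) :
    D'.rep a (D'.elt y) ∈ (Submodule.span ℂ (D'.elt '' {x | ¬ ∀ c ∈ verts x.1, c ∈ link Γ v})
      ).topologicalClosure := by
  have e : ∀ x : InsideTensor Γ (fun v => (φ v).cyclic) (pieces Γ v i),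
      (hx : ∀ c ∈ verts x.1, c ∈ link Γ v) → D'.iso (D'.elt x) = D.iso (D.elt ⟨x.1, x.2.1, hx⟩) :=
    fun x hx => by rw [iso_elt, iso_elt]
  refine mem_closure_span_of_orthogonal D'.dense_elt (fun x => ∀ c ∈ verts x.1, c ∈ link Γ v) ?_ ?_
  · intro x x' hx hx'
    rw [← D'.inner_iso, iso_elt, iso_elt]
    exact inner_elem_eq_zero _ _ fun h => hx' fun c hc => hx c (h.perm.mem_iff.mpr hc)
  · intro x hx
    rw [← D'.inner_iso, ← opHom_iso, e x hx, e y hy, ← inner_compression, ha]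
    simp

/-- The source includes both `H_Link(v)` and the other sector, so one argument yields both mapping
properties of an `AmalgamModel`. For a word outside sector `i` the factor `y` in the piece is a word
in `Link(v)`, since otherwise `inSector_append` would put the word into the sector; `a` acts on `y`
only. -/
theorem opHom_mem_sector (D : SubgraphModel Γ φ (link Γ v) K B)
    (D' : SubgraphModel Γ φ (pieces Γ v i) L C) {a : C}
    (ha : compression D.iso (D'.opHom a) = 0) {h : GraphGNS Γ φ}
    (hh : h ∈ wordSpan Γ φ fun w => ¬ InSector Γ v i w) :
    D'.opHom a h ∈ wordSpan Γ φ (InSector Γ v i) := by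
  refine map_mem_of_closure_span (isClosed_wordSpan _) _ ?_ hh
  rintro _ ⟨x, hx, rfl⟩
  obtain ⟨y, z, hyz⟩ := exists_inside_free (pieces Γ v i) x.1 x.2
  have e : elem Γ x.1 x.2 = D'.right z (D'.elt y) := by
    rw [D'.right_elt]
    exact LetterEquiv.elem_eq hyz _ _
  have hy : ∀ c ∈ verts y.1, c ∈ link Γ v := by
    by_contra hy
    refine hx ((LetterEquiv.verts hyz).symm.inSector ?_)
    rw [verts_append]
    exact inSector_append y.2.2 hy _
  change D'.opHom a (elem Γ x.1 x.2) ∈ _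
  rw [e, opHom_apply, D'.amp_right]
  refine map_mem_of_closure_span (isClosed_wordSpan _) _ ?_ (D.rep_elt_mem D' ha y hy)
  rintro _ ⟨y', hy', rfl⟩
  rw [D'.right_elt]
  refine elem_mem_wordSpan _ ?_
  rw [verts_append]
  exact inSector_append y'.2.2 hy' _

variable [PartialOrder B] [StarOrderedRing B] [PartialOrder C] [StarOrderedRing C]

theorem opHom_iso_mem_sector (D : SubgraphModel Γ φ (link Γ v) K B)
    (D' : SubgraphModel Γ φ (pieces Γ v i) L C) {a : C}
    (ha : D.condExp D' (link_subset_pieces Γ v i) a = 0) (x : K) :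
    D'.opHom a (D.iso x) ∈ wordSpan Γ φ (InSector Γ v i) :=
  D.opHom_mem_sector D' (D.compression_eq_zero D' _ ha)
    (wordSpan_mono (fun _ hw h => h.1 hw) (D.iso_mem_wordSpan x))

theorem opHom_sector_mem_sector (D : SubgraphModel Γ φ (link Γ v) K B)
    (D' : SubgraphModel Γ φ (pieces Γ v i) L C) {a : C}
    (ha : D.condExp D' (link_subset_pieces Γ v i) a = 0) {k : Fin 2} (hk : k ≠ i)
    {x : GraphGNS Γ φ} (hx : x ∈ wordSpan Γ φ (InSector Γ v k)) :
    D'.opHom a x ∈ wordSpan Γ φ (InSector Γ v i) :=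
  D.opHom_mem_sector D' (D.compression_eq_zero D' _ ha)
    (wordSpan_mono (P := InSector Γ v k) (Q := fun w => ¬ InSector Γ v i w)
      (fun _ hw h => hk (hw.unique h)) hx)

end SubgraphModel

end Sectors

/-! ### The isomorphism for abstract models of the pieces -/

section Final

variable {V : Type*} {A : V → Type*} [∀ v, CStarAlgebra (A v)] [∀ v, PartialOrder (A v)]
  [∀ v, StarOrderedRing (A v)] {Γ : SimpleGraph V} {φ : ∀ v, GNSFaithfulState (A v)} {v : V}
  {K B : Type*} [NormedAddCommGroup K] [InnerProductSpace ℂ K] [CompleteSpace K]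
  [CStarAlgebra B] [PartialOrder B] [StarOrderedRing B]
  {L C : Fin 2 → Type*} [∀ i, NormedAddCommGroup (L i)] [∀ i, InnerProductSpace ℂ (L i)]
  [∀ i, CompleteSpace (L i)] [∀ i, CStarAlgebra (C i)] [∀ i, PartialOrder (C i)]
  [∀ i, StarOrderedRing (C i)]

/-- The graph product Hilbert space as a model of the amalgamated free product over the link of a
vertex. -/
noncomputable def vertexModel (D : SubgraphModel Γ φ (link Γ v) K B)
    (D' : ∀ i, SubgraphModel Γ φ (pieces Γ v i) (L i) (C i)) :
    AmalgamModel (fun i => D.condExp (D' i) (link_subset_pieces Γ v i)) D.rep (GraphGNS Γ φ) where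
  rep i := (D' i).opHom
  base := D.opHom
  iso := D.iso
  sector i := wordSpan Γ φ (InSector Γ v i)
  rep_incl i b := D.opHom_subHom (D' i) (link_subset_pieces Γ v i) b
  inner_iso := D.inner_iso
  base_iso := D.opHom_iso
  inner_sector i k hik x hx y hy := inner_wordSpan
    (fun _ _ hw hw' h => hik ((h.inSector hw).unique hw')) hx hy
  inner_iso_sector i x y hy := inner_wordSpan
    (fun _ _ hw hw' h => (h.symm.inSector hw').1 hw) (D.iso_mem_wordSpan x) hy
  rep_iso i a ha x := D.opHom_iso_mem_sector (D' i) ha x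
  rep_sector i a ha k hk x hx := D.opHom_sector_mem_sector (D' i) ha hk hx
  cyclic N hN h0 h := by
    -- The vacuum is the image of the empty tensor of `Link(v)`, and every vertex lies in one of the
    -- two pieces, so invariance under the pieces gives invariance under all vertex operators.
    refine mem_of_vacuum_mem N hN ?_ fun w a x hx => ?_
    · have := h0 (D.elt ⟨[], .nil, by simp [verts]⟩)
      rw [D.iso_elt] at this
      exact this
    · obtain ⟨i, hi⟩ := exists_mem_pieces Γ v w
      rw [← (D' i).opHom_incl hi]
      exact h i _ x hx

/-- The representation `ρ` is kept separate from `D.rep` so that the result can be stated for the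
concrete representation of `A_{Link(v)}`. State preservation is the compression identity of
`exists_equiv` evaluated at the vacuum. -/
theorem exists_vertex_equiv (D : SubgraphModel Γ φ (link Γ v) K B)
    (D' : ∀ i, SubgraphModel Γ φ (pieces Γ v i) (L i) (C i))
    {ρ : B →⋆ₐ[ℂ] (K →L[ℂ] K)} (hρ : D.rep = ρ) :
    ∃ π : RedAmalgam (fun i => D.condExp (D' i) (link_subset_pieces Γ v i)) ρ ≃⋆ₐ[ℂ]
        RedGraphProd Γ φ,
      (∀ i x, π (amIncl _ ρ i x) = (D' i).toGraph x) ∧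
      (∀ π' : RedAmalgam (fun i => D.condExp (D' i) (link_subset_pieces Γ v i)) ρ ≃⋆ₐ[ℂ]
        RedGraphProd Γ φ, (∀ i x, π' (amIncl _ ρ i x) = (D' i).toGraph x) → π' = π) ∧
      ∀ x Ω, D.iso Ω = gnsVacuum Γ φ →
        graphState Γ φ (π x) = ⟪Ω, amExp _ ρ x Ω⟫_ℂ := by
  subst hρ
  obtain ⟨π, h1, h2, h3⟩ := (vertexModel D D').exists_equiv (toOp Γ φ) (toOp_injective Γ φ)
    (fun i => (D' i).toGraph) (fun i a => rfl) (fun M hM h c => redGraphProd_generated M hM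
      (fun w a => by
        obtain ⟨i, hi⟩ := exists_mem_pieces Γ v w
        rw [← (D' i).toGraph_incl hi]
        exact h i _) c)
  refine ⟨π, h1, h2, fun x Ω hΩ => ?_⟩
  rw [graphState, ← hΩ]
  exact h3 x Ω Ω

end Final

end GraphProduct

/-! ### Specialisation to the concrete induced subgraphs -/

namespace GraphProduct

section

variable {V : Type*} {A : V → Type*} [∀ v, CStarAlgebra (A v)] [∀ v, PartialOrder (A v)]
  [∀ v, StarOrderedRing (A v)] {Γ : SimpleGraph V} {φ : ∀ v, GNSFaithfulState (A v)}

theorem subgraphModel_iso (S : Set V) :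
    (subgraphModel Γ φ S).iso = subIsometry Γ (fun v => (φ v).cyclic) S :=
  rightMap_nil_eq (Γ := Γ) (ξ := fun v => (φ v).cyclic) (S := S)

theorem subIsometry_vacuum {H : V → Type*} [∀ v, NormedAddCommGroup (H v)]
    [∀ v, InnerProductSpace ℂ (H v)] {ξ : ∀ v, H v} (S : Set V) :
    subIsometry Γ ξ S (vacuum (Γ.induce S) fun v : S => ξ v) = vacuum Γ ξ :=
  subIsometry_elem .nil

theorem subgraphModel_iso_vacuum (S : Set V) :
    (subgraphModel Γ φ S).iso (gnsVacuum (Γ.induce S) fun v : S => φ v) = gnsVacuum Γ φ := by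
  rw [subgraphModel_iso]
  exact subIsometry_vacuum (ξ := fun v => (φ v).cyclic) S

theorem subgraphModel_rep (S : Set V) :
    (subgraphModel Γ φ S).rep = toOp (Γ.induce S) fun v : S => φ v := by
  delta subgraphModel
  with_reducible rfl

theorem subgraphModel_incl {S : Set V} (w : S) (a : A w) :
    (subgraphModel Γ φ S).incl w w.2 a = vertexIncl (Γ.induce S) (fun v : S => φ v) w a := by
  delta subgraphModel
  with_reducible rfl

theorem isInclusion_toGraph (S : Set V) : IsInclusion Γ φ (subgraphModel Γ φ S).toGraph := by
  refine ⟨(subgraphModel Γ φ S).toGraph_injective, fun w a => ?_⟩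
  rw [← subgraphModel_incl]
  exact (subgraphModel Γ φ S).toGraph_incl w.2 a

theorem isSubInclusion_subHom {S T : Set V} (h : S ⊆ T) :
    IsSubInclusion Γ φ h ((subgraphModel Γ φ S).subHom (subgraphModel Γ φ T) h) := by
  refine ⟨(subgraphModel Γ φ S).subHom_injective _ h, fun w a => ?_⟩
  rw [← subgraphModel_incl, ← subgraphModel_incl]
  exact (subgraphModel Γ φ S).subHom_incl (subgraphModel Γ φ T) h w.2 a

set_option maxHeartbeats 1000000 in
theorem toOp_condExp {S T : Set V} (h : S ⊆ T) (x : SubProd Γ φ T) :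
    toOp (Γ.induce S) (fun v : S => φ v)
      ((subgraphModel Γ φ S).condExp (subgraphModel Γ φ T) h x) =
      compress Γ φ S ((subgraphModel Γ φ T).toGraph x) := by
  rw [← subgraphModel_rep,
    (subgraphModel Γ φ S).rep_condExp_eq_adjoint (subgraphModel Γ φ T) h x, subgraphModel_iso,
    compress]

end

end GraphProduct

set_option maxHeartbeats 1000000 in
/-- Let `Γ` be a simplicial graph whose vertices `w` carry unital C⋆-algebras `A w` with GNS faithful
states `φ w`, and let `v` be a vertex. There are canonical inclusions
`j i : A_{Link(v)} → A_{Γᵢ}` and `κ i : A_{Γᵢ} → A_Γ`, where `Γ₁ = Star(v)` and `Γ₂ = Γ ∖ {v}`, and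
the compression to the graph product Hilbert space of `Link(v)` defines conditional expectations
`E i` of `A_{Γᵢ}` onto `A_{Link(v)}`. There is a unique `*`-isomorphism `π` of the reduced
amalgamated free product of `A_{Γ₁}` and `A_{Γ₂}` over `A_{Link(v)}` with respect to `E` onto `A_Γ`
that extends the inclusions `κ i`, and `π` is state-preserving. -/
theorem theorem2p15 {V : Type*} (Γ : SimpleGraph V) {A : V → Type*} [∀ w, CStarAlgebra (A w)]
    [∀ w, PartialOrder (A w)] [∀ w, StarOrderedRing (A w)] (φ : ∀ w, GNSFaithfulState (A w))
    (v : V) :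
    ∃ (j : ∀ i, SubProd Γ φ (link Γ v) →⋆ₐ[ℂ] SubProd Γ φ (pieces Γ v i))
      (κ : ∀ i, SubProd Γ φ (pieces Γ v i) →⋆ₐ[ℂ] RedGraphProd Γ φ)
      (E : ∀ i, CondExp (j i)),
      (∀ i, IsSubInclusion Γ φ (link_subset_pieces Γ v i) (j i)) ∧
      (∀ i, IsInclusion Γ φ (κ i)) ∧
      (∀ i x, linkRep Γ φ v (E i x) = compress Γ φ (link Γ v) (κ i x)) ∧
      ∃ π : RedAmalgam E (linkRep Γ φ v) ≃⋆ₐ[ℂ] RedGraphProd Γ φ,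
        (∀ i x, π (amIncl E (linkRep Γ φ v) i x) = κ i x) ∧
        (∀ π' : RedAmalgam E (linkRep Γ φ v) ≃⋆ₐ[ℂ] RedGraphProd Γ φ,
          (∀ i x, π' (amIncl E (linkRep Γ φ v) i x) = κ i x) → π' = π) ∧
        ∀ x, graphState Γ φ (π x) =
          ⟪gnsVacuum (Γ.induce (link Γ v)) (fun w : link Γ v => φ w),
            amExp E (linkRep Γ φ v) x
              (gnsVacuum (Γ.induce (link Γ v)) fun w : link Γ v => φ w)⟫_ℂ := by
  obtain ⟨π, h1, h2, h3⟩ := exists_vertex_equiv (subgraphModel Γ φ (link Γ v))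
    (fun i => subgraphModel Γ φ (pieces Γ v i)) (subgraphModel_rep (link Γ v))
  exact ⟨fun i => (subgraphModel Γ φ (link Γ v)).subHom (subgraphModel Γ φ (pieces Γ v i))
      (link_subset_pieces Γ v i),
    fun i => (subgraphModel Γ φ (pieces Γ v i)).toGraph,
    fun i => (subgraphModel Γ φ (link Γ v)).condExp (subgraphModel Γ φ (pieces Γ v i))
      (link_subset_pieces Γ v i),
    fun i => isSubInclusion_subHom (link_subset_pieces Γ v i),
    fun i => isInclusion_toGraph (pieces Γ v i),
    fun i x => toOp_condExp (link_subset_pieces Γ v i) x,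
    π, h1, h2, fun x => h3 x _ (subgraphModel_iso_vacuum (link Γ v))⟩
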